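/- Let $K\ge 800$ and $c\ge 0$ be integers with $c+2\le K$. There are a randomized fully dynamic algorithm (one fixed program for a random access machine that can draw uniformly random integers, where each elementary instruction is charged one plus the bit lengths of the numbers it handles) and constants $C,k$, depending only on $K$ and $c$, such that the following holds for all $n\ge 1$ and all rational $\tau>0$. The algorithm gets $n$ and $\tau$, and then processes a sequence of edge insertions and deletions, fixed in advance (oblivious adversary), of a simple graph $G$ on a fixed set $V$ of $n$ vertices that initially has no edges (only absent edges are inserted and only present edges are deleted). 1. (Contraction.) At all times and for all random choices, the algorithm stores a possibly incomplete contraction $G'$ of $G$ as a weighted graph: a vertex set $V'\subseteq V$, a partial map $g$ from $V$ to $V'$ with $g(a)=a$ for $a\in V'$ and with $g(v)$ a neighbor of $v$ in $G$ whenever $v\notin V'$ and $g(v)$ is defined, and for all distinct $a,b\in V'$ the weight $w(a,b)$, which is the number of edges $uv$ of $G$ with $g(u)=a$, $g(v)=b$ (pairs of weight $0$ are non-edges). The contraction is called complete if $g$ is defined at both endpoints of every edge of $G$. 2. (Star contraction.) The (static) $\tau$-star contraction of $G$ includes each vertex in a random set $R$ of centers independently with probability $p=\min\{1,K\log n/\tau\}$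 ($\log$ is the natural logarithm), and then contracts each vertex $v\notin R$ of degree at least $\tau$ that has a neighbor in $R$ into a neighbor $f(v)\in R$ chosen uniformly and independently; $f(v)=v$ for all other vertices. Whenever the minimum degree satisfies $\delta_G\ge\tau$, $G'$ is complete and constitutes a $\tau$-star contraction of $G$ with high probability: for every set $S$ of possible outcomes $(R,f)$, the probability that $G'$ is complete and that $(V',g)\in S$ is at least $\Pr[(R,f)\in S]-n^{-c}$. (In particular, $G'$ is complete with probability at least $1-n^{-c}$.) 3. (Time.) The expected total time of the first $T$ updates is at most $C\,T\log^k(n+1)$ for every $T$, that is, the amortized update time is polylogarithmic in expectation. In the worst case (for all random choices) every update takes time at most $C\,n\log^k(n+1)$, and the initialization takes time at most $C\,n\log^k(n+a+b)$, where $\tau=a/b$ in lowest terms. 4. (Recourse.) At every update of $G$, the number of modifications of edge weights of $G'$ is at most $C$ in expectation, and at most $C\,\frac{n}{\tau}\log^k(n+1)$ in the worst case (for all random choices). -/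

import Mathlib

open scoped ENNReal

/-! ### A randomized random access machine with logarithmic cost

Programs work on finitely many registers and finitely many named, unbounded, zero-initialized arrays
of natural numbers. Every elementary instruction is charged one plus the bit lengths of the numbers
it handles (operands, addresses and results). The only iteration is a counted loop, so all programs
terminate; this only restricts the programs whose existence can be claimed. -/

namespace DynStar

/-- Arithmetic instructions (subtraction is truncated at zero, division rounds down). -/
inductive ArithOp where
  | add | sub | mul | div

def ArithOp.eval : ArithOp → ℕ → ℕ → ℕ
  | .add, a, b => a + b
  | .sub, a, b => a - b
  | .mul, a, b => a * b
  | .div, a, b => a / b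

/-- Programs. Registers and arrays are named by numerals fixed in the program text. -/
inductive Prog where
  | skip : Prog
  /-- `reg x := k` -/
  | const (x k : ℕ) : Prog
  /-- `reg x := reg y ∘ reg z` -/
  | arith (o : ArithOp) (x y z : ℕ) : Prog
  /-- `reg x := array a [reg y]` -/
  | load (x a y : ℕ) : Prog
  /-- `array a [reg x] := reg y` -/
  | store (a x y : ℕ) : Prog
  /-- `reg x :=` a fresh uniformly random element of `{0, …, reg y}` -/
  | rand (x y : ℕ) : Prog
  | seq (P Q : Prog) : Prog
  /-- if `reg x < reg y` then `P` else `Q` -/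
  | ifLt (x y : ℕ) (P Q : Prog) : Prog
  /-- execute `P` as many times as the value of `reg x` on entry -/
  | loop (x : ℕ) (P : Prog) : Prog

/-- Machine states. `time` is the cost charged so far, and `writes` counts the store instructions
executed so far on array `0`; both counters are reset at the beginning of every update. -/
structure State where
  reg : ℕ → ℕ
  arr : ℕ → ℕ → ℕ
  time : ℕ
  writes : ℕ

namespace State

def charge (s : State) (c : ℕ) : State := { s with time := s.time + c }

def setReg (s : State) (x m : ℕ) : State := { s with reg := Function.update s.reg x m }

def setArr (s : State) (a i m : ℕ) : State :=
  { s with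
    arr := Function.update s.arr a (Function.update (s.arr a) i m)
    writes := s.writes + if a = 0 then 1 else 0 }

end State

/-- The distribution of the final state of a program; all random choices are independent. -/
noncomputable def Prog.exec : Prog → State → PMF State
  | .skip, s => PMF.pure s
  | .const x k, s => PMF.pure ((s.setReg x k).charge (1 + k.size))
  | .arith o x y z, s =>
      PMF.pure ((s.setReg x (o.eval (s.reg y) (s.reg z))).charge
        (1 + (s.reg y).size + (s.reg z).size + (o.eval (s.reg y) (s.reg z)).size))
  | .load x a y, s =>
      PMF.pure ((s.setReg x (s.arr a (s.reg y))).charge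
        (1 + (s.reg y).size + (s.arr a (s.reg y)).size))
  | .store a x y, s =>
      PMF.pure ((s.setArr a (s.reg x) (s.reg y)).charge (1 + (s.reg x).size + (s.reg y).size))
  | .rand x y, s =>
      (PMF.uniformOfFinset (Finset.range (s.reg y + 1)) Finset.nonempty_range_add_one).map fun m =>
        (s.setReg x m).charge (1 + (s.reg y).size + m.size)
  | .seq P Q, s => (P.exec s).bind fun t => Q.exec t
  | .ifLt x y P Q, s =>
      let t := s.charge (1 + (s.reg x).size + (s.reg y).size)
      if s.reg x < s.reg y then P.exec t else Q.exec t
  | .loop x P, s =>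
      (fun μ : PMF State => μ.bind fun t => P.exec (t.charge (1 + (s.reg x).size)))^[s.reg x]
        (PMF.pure (s.charge (1 + (s.reg x).size)))

/-! ### Dynamic graphs -/

/-- Insertion (`ins = true`) or deletion (`ins = false`) of the edge `uv`. -/
structure Update (n : ℕ) where
  u : Fin n
  v : Fin n
  ins : Bool

/-- Only absent edges (and no loops) are inserted, and only present edges are deleted. -/
def Update.Valid {n : ℕ} (e : Update n) (G : SimpleGraph (Fin n)) : Prop :=
  if e.ins = true then e.u ≠ e.v ∧ ¬ G.Adj e.u e.v else G.Adj e.u e.v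

def Update.apply {n : ℕ} (e : Update n) (G : SimpleGraph (Fin n)) : SimpleGraph (Fin n) :=
  if e.ins = true then G ⊔ SimpleGraph.edge e.u e.v else G.deleteEdges {s(e.u, e.v)}

/-- All updates of the list, performed in order starting from `G`, are valid. -/
def ValidFrom {n : ℕ} : SimpleGraph (Fin n) → List (Update n) → Prop
  | _, [] => True
  | G, e :: σ => e.Valid G ∧ ValidFrom (e.apply G) σ

/-- The dynamic graph after the given updates; it starts without edges. -/
def graphAfter {n : ℕ} (σ : List (Update n)) : SimpleGraph (Fin n) :=
  σ.foldl (fun G e => e.apply G) ⊥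

open Classical in
/-- The minimum degree `δ_G`. -/
noncomputable def minDeg {n : ℕ} (G : SimpleGraph (Fin n)) : ℕ := G.minDegree

/-! ### Contractions -/

/-- `g v = some a` means that `v` is contracted into the vertex `a` of `G'` (each vertex of `G'` is
one of the vertices of `G` and represents itself); `g v = none` means that `v` is not mapped. -/
def contractedVerts {n : ℕ} (g : Fin n → Option (Fin n)) : Set (Fin n) := {a | g a = some a}

open Classical in
/-- The map `g` and the weights `w` describe a possibly incomplete contraction of `G` in which every
mapped vertex either is a vertex of `G'` or is contracted along an edge of `G` into a vertex of `G'`,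
and where the weight of `ab` is the number of edges of `G` that are mapped to `ab`. -/
def IsPartialContraction {n : ℕ} (G : SimpleGraph (Fin n)) (g : Fin n → Option (Fin n))
    (w : Fin n → Fin n → ℕ) : Prop :=
  (∀ v a, g v = some a → a ∈ contractedVerts g ∧ (v = a ∨ G.Adj v a)) ∧
  ∀ a b, a ≠ b →
    w a b = (Finset.univ.filter fun q : Fin n × Fin n =>
      G.Adj q.1 q.2 ∧ g q.1 = some a ∧ g q.2 = some b).card

/-- Every edge of `G` is mapped. -/
def IsComplete {n : ℕ} (G : SimpleGraph (Fin n)) (g : Fin n → Option (Fin n)) : Prop :=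
  ∀ u v, G.Adj u v → g u ≠ none ∧ g v ≠ none

/-- The sampling probability `K log n / τ` of center vertices (capped at one). -/
noncomputable def centerProb (K n : ℕ) (τ : ℚ) : ℝ := min 1 (K * Real.log n / τ)

open Classical in
/-- The probability that static `τ`-star contraction of `G` produces the set `R` of centers and
contracts every vertex `v` into `f v`: each vertex is a center independently with probability `p`;
then each non-center of degree at least `τ` that has a neighbor in `R` is, independently, contracted
into a uniformly random neighbor in `R`; all other vertices stay uncontracted (`f v = v`). -/
noncomputable def starProb {n : ℕ} (G : SimpleGraph (Fin n)) (τ : ℚ) (p : ℝ)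
    (o : Finset (Fin n) × (Fin n → Fin n)) : ℝ :=
  (∏ v, if v ∈ o.1 then p else 1 - p) *
  ∏ v, if v ∉ o.1 ∧ τ ≤ (G.degree v : ℚ) ∧ (G.neighborFinset v ∩ o.1).Nonempty then
      (if o.2 v ∈ G.neighborFinset v ∩ o.1 then 1 / ((G.neighborFinset v ∩ o.1).card : ℝ) else 0)
    else (if o.2 v = v then 1 else 0)

/-- The contraction with map `g` is the outcome `o` of static star contraction. -/
def Realizes {n : ℕ} (g : Fin n → Option (Fin n)) (o : Finset (Fin n) × (Fin n → Fin n)) : Prop :=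
  contractedVerts g = (o.1 : Set (Fin n)) ∧ ∀ v, g v = some (o.2 v)

/-! ### Dynamic algorithms -/

/-- A dynamic algorithm: one program that is run at the beginning and one that is run at every
update. -/
structure Algorithm where
  init : Prog
  update : Prog

/-- Initially registers `0`, `1`, `2` hold `n` and the numerator and denominator of `τ`; everything
else is zero. -/
noncomputable def Algorithm.start (A : Algorithm) (n : ℕ) (τ : ℚ) : PMF State :=
  A.init.exec
    { reg := fun x => if x = 0 then n else if x = 1 then τ.num.natAbs else if x = 2 then τ.den else 0
      arr := fun _ _ => 0
      time := 0
      writes := 0 }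

/-- An update is passed to the algorithm in registers `0`, `1`, `2`. -/
noncomputable def Algorithm.step {n : ℕ} (A : Algorithm) (e : Update n) (s : State) : PMF State :=
  A.update.exec
    { reg := fun x => if x = 0 then (e.u : ℕ) else if x = 1 then (e.v : ℕ)
        else if x = 2 then (if e.ins = true then 1 else 0) else s.reg x
      arr := s.arr
      time := 0
      writes := 0 }

/-- The distribution of the state after processing the updates `σ`, which are fixed in advance
(oblivious adversary). Its counters `time` and `writes` refer to the last update
(to the initialization if there was none). -/
noncomputable def Algorithm.law (A : Algorithm) (n : ℕ) (τ : ℚ) (σ : List (Update n)) : PMF State :=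
  σ.foldl (fun μ e => μ.bind (A.step e)) (A.start n τ)

/-- Output convention: array `1` holds the map, `0` standing for `none` and `a + 1` for `some a`. -/
def State.outMap (n : ℕ) (s : State) (v : Fin n) : Option (Fin n) :=
  if h : 0 < s.arr 1 v ∧ s.arr 1 v ≤ n then some ⟨s.arr 1 v - 1, by omega⟩ else none

/-- Output convention: array `0` holds the weight of the edge `ab`, `a < b`, at index `a * n + b`. -/
def State.outWeight (n : ℕ) (s : State) (a b : Fin n) : ℕ :=
  s.arr 0 (min (a : ℕ) b * n + max (a : ℕ) b)

/-- Expected value of a natural number determined by the state. -/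
noncomputable def expect (μ : PMF State) (X : State → ℕ) : ℝ≥0∞ := ∑' s, μ s * (X s : ℝ≥0∞)

/-- Probability of an event. -/
noncomputable def prob (μ : PMF State) (E : Set State) : ℝ := (μ.toOuterMeasure E).toReal

end DynStar

/-! The set `R` of centers is drawn once, at the start, and never changes. An update changes only
the lists of center neighbors, and the target of a non-center `u` is kept uniform in its list by a
reservoir rule. When an edge `uv` with `u ∉ R` and `v ∈ R` is inserted, a uniform element of the new
list is drawn, and `u` moves to `v` exactly if `v` was drawn; when it is deleted, `u` moves to a
fresh uniform element exactly if it was contracted into `v`. Both rules preserve uniformity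
(`choiceLaw_bind_insert`, `choiceLaw_bind_erase`), and edges between two centers or two non-centers
affect no target. Hence at every time, given `R`, the targets are independent and uniform: the law
of the pair is `jointLaw q G`, with `q` the law of `R` and `G` the current graph, which is not
random because the adversary is oblivious (`jointLaw_bind_updateKernel`, `Tracks.foldl`).

Cost. Moving `u` takes time proportional to its degree, up to logarithmic factors, and happens only
if the target of `u` is `v`: in the map after an insertion, in the map before a deletion, so always
in a graph that contains `uv`. Since `q` depends only on the size of a set, all neighbors of `u` are
equally likely targets, so this event has probability at most `1 / deg u`
(`degree_mul_jointLaw_le`). The expected number of edges mapped anew is therefore bounded by a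
constant, whatever `τ` is. In the worst case the degree is at most `n`, which bounds the time. For
the recourse, the edges at `u` are first grouped by the target of their other end, so that removing
or adding them all costs at most one write per center (`shift_spec`, `Rep.image_card_le`). The
number of centers is capped at `4 K n l / τ`, where `n < 2 ^ l ≤ 2 n`: a larger sample is replaced
by the empty set, which keeps the law exchangeable (`centerLaw_card`).

Comparison with static star contraction. Non-centers of any degree are contracted when they can be,
so the two rules agree only when all degrees are at least `τ`. Then three errors remain
(`sum_starProb_sub_le`): the sampling probability is a rational approximation, computed from the
series of the logarithm (`abs_centerProb_sub_le`); `R` may miss a neighborhood, which would leave a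
non-center unmapped (`sum_pow_degree_le`); and the cap may take effect (`sum_largeProb_le`). They
add up to at most `n ^ (-c)`.

Machine. Deterministic pieces of program are treated as functions on memories; a bound on all
numbers turns the number of instructions into running time (`exec_eq_pure`). Randomness enters only
in the sampling loop and in at most one draw per update. -/

namespace DynStar

/-! ### Deterministic programs, without the clock -/

/-- The part of a machine state that influences the computation, and the write counter. -/
structure Mem where
  reg : ℕ → ℕ
  arr : ℕ → ℕ → ℕ
  writes : ℕ

def State.mem (s : State) : Mem := ⟨s.reg, s.arr, s.writes⟩

@[simp] theorem State.mem_reg (s : State) : s.mem.reg = s.reg := rfl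
@[simp] theorem State.mem_arr (s : State) : s.mem.arr = s.arr := rfl
@[simp] theorem State.mem_writes (s : State) : s.mem.writes = s.writes := rfl
@[simp] theorem State.mem_charge (s : State) (c : ℕ) : (s.charge c).mem = s.mem := rfl

namespace Prog

/-- Programs that make no random choices. -/
def Det : Prog → Prop
  | .rand _ _ => False
  | .seq P Q => P.Det ∧ Q.Det
  | .ifLt _ _ P Q => P.Det ∧ Q.Det
  | .loop _ P => P.Det
  | _ => True

/-- The effect of a deterministic program on the memory. -/
def run : Prog → Mem → Mem
  | .skip, m => m
  | .const x k, m => ⟨Function.update m.reg x k, m.arr, m.writes⟩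
  | .arith o x y z, m => ⟨Function.update m.reg x (o.eval (m.reg y) (m.reg z)), m.arr, m.writes⟩
  | .load x a y, m => ⟨Function.update m.reg x (m.arr a (m.reg y)), m.arr, m.writes⟩
  | .store a x y, m =>
      ⟨m.reg, Function.update m.arr a (Function.update (m.arr a) (m.reg x) (m.reg y)),
        m.writes + if a = 0 then 1 else 0⟩
  | .rand _ _, m => m
  | .seq P Q, m => Q.run (P.run m)
  | .ifLt x y P Q, m => if m.reg x < m.reg y then P.run m else Q.run m
  | .loop x P, m => P.run^[m.reg x] m

/-- The number of elementary instructions executed by a deterministic program. -/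
def steps : Prog → Mem → ℕ
  | .skip, _ => 0
  | .seq P Q, m => P.steps m + Q.steps (P.run m)
  | .ifLt x y P Q, m => 1 + if m.reg x < m.reg y then P.steps m else Q.steps m
  | .loop x P, m => 1 + ∑ i ∈ Finset.range (m.reg x), (1 + P.steps (P.run^[i] m))
  | _, _ => 1

/-- All numbers computed by the program from the given memory are at most `M`. -/
def Safe (M : ℕ) : Prog → Mem → Prop
  | .const _ k, _ => k ≤ M
  | .arith o _ y z, m => o.eval (m.reg y) (m.reg z) ≤ M
  | .seq P Q, m => P.Safe M m ∧ Q.Safe M (P.run m)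
  | .ifLt x y P Q, m => (m.reg x < m.reg y → P.Safe M m) ∧ (¬ m.reg x < m.reg y → Q.Safe M m)
  | .loop x P, m => ∀ i < m.reg x, P.Safe M (P.run^[i] m)
  | _, _ => True

/-- Loop-free programs. -/
def Flat : Prog → Prop
  | .seq P Q => P.Flat ∧ Q.Flat
  | .ifLt _ _ P Q => P.Flat ∧ Q.Flat
  | .loop _ _ => False
  | _ => True

/-- An upper bound for the number of instructions executed by a loop-free program. -/
def len : Prog → ℕ
  | .skip => 0
  | .seq P Q => P.len + Q.len
  | .ifLt _ _ P Q => 1 + (P.len + Q.len)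
  | .loop _ _ => 0
  | _ => 1

theorem steps_le_len : ∀ (P : Prog) (m : Mem), P.Flat → P.steps m ≤ P.len
  | .skip, _, _ => le_rfl
  | .const _ _, _, _ => le_rfl
  | .arith _ _ _ _, _, _ => le_rfl
  | .load _ _ _, _, _ => le_rfl
  | .store _ _ _, _, _ => le_rfl
  | .rand _ _, _, _ => le_rfl
  | .seq P Q, m, h => Nat.add_le_add (steps_le_len P m h.1) (steps_le_len Q _ h.2)
  | .ifLt x y P Q, m, h => by
      have hP := steps_le_len P m h.1
      have hQ := steps_le_len Q m h.2
      simp only [steps, len]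
      split_ifs <;> omega

theorem steps_loop_le (x : ℕ) (P : Prog) (m : Mem) (h : P.Flat) :
    (Prog.loop x P).steps m ≤ 1 + m.reg x * (1 + P.len) := by
  simp only [steps]
  have := Finset.sum_le_card_nsmul (Finset.range (m.reg x))
    (fun i => 1 + P.steps (P.run^[i] m)) (1 + P.len)
    (fun i _ => Nat.add_le_add_left (steps_le_len P _ h) 1)
  simpa using this

end Prog

/-- All numbers in the memory are at most `M`. -/
def Mem.Ok (M : ℕ) (m : Mem) : Prop := (∀ r, m.reg r ≤ M) ∧ ∀ a i, m.arr a i ≤ M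

/-- The largest cost of one instruction that handles numbers up to `M`. -/
def unitCost (M : ℕ) : ℕ := 1 + 3 * M.size

theorem update_le {ι : Type*} [DecidableEq ι] {f : ι → ℕ} {M : ℕ} (hf : ∀ i, f i ≤ M) (i : ι)
    {k : ℕ} (hk : k ≤ M) (j : ι) : Function.update f i k j ≤ M := by
  rcases eq_or_ne j i with rfl | h
  · simpa
  · simpa [h] using hf j

theorem Mem.Ok.setArr {M : ℕ} {m : Mem} (h : m.Ok M) (a i : ℕ) {k : ℕ} (hk : k ≤ M) (b j : ℕ) :
    Function.update m.arr a (Function.update (m.arr a) i k) b j ≤ M := by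
  rcases eq_or_ne b a with rfl | hb
  · simpa using update_le (h.2 b) i hk j
  · simpa [hb] using h.2 b j

/-- Loads and stores only move numbers that are already present, so only constants and results of
arithmetic need a bound, and this is all that `Safe` asks for. -/
theorem Mem.Ok.run {M : ℕ} : ∀ {P : Prog} {m : Mem}, m.Ok M → P.Safe M m → (P.run m).Ok M
  | .skip, _, h, _ => h
  | .const _ _, _, h, hs => ⟨update_le h.1 _ hs, h.2⟩
  | .arith _ _ _ _, _, h, hs => ⟨update_le h.1 _ hs, h.2⟩
  | .load _ _ _, _, h, _ => ⟨update_le h.1 _ (h.2 _ _), h.2⟩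
  | .store _ _ _, _, h, _ => ⟨h.1, h.setArr _ _ (h.1 _)⟩
  | .rand _ _, _, h, _ => h
  | .seq _ _, _, h, hs => (h.run hs.1).run hs.2
  | .ifLt x y P Q, m, h, hs => by
      simp only [Prog.run]
      split_ifs with hxy
      · exact h.run (hs.1 hxy)
      · exact h.run (hs.2 hxy)
  | .loop x P, m, h, hs => by
      have : ∀ i ≤ m.reg x, (P.run^[i] m).Ok M := by
        intro i
        induction i with
        | zero => exact fun _ => h
        | succ i ih =>
          intro hi
          rw [Function.iterate_succ_apply']
          exact (ih (by omega)).run (hs i (by omega))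
      exact this _ le_rfl

/-- A deterministic program ends in a determined state, whose memory is computed by `run`, and its
running time is at most the number of instructions times the largest cost of one. -/
theorem exec_eq_pure {M : ℕ} : ∀ {P : Prog} {s : State}, P.Det → s.mem.Ok M → P.Safe M s.mem →
    ∃ t, P.exec s = PMF.pure t ∧ t.mem = P.run s.mem ∧
      t.time ≤ s.time + P.steps s.mem * unitCost M
  | .skip, s, _, _, _ => ⟨s, rfl, rfl, by simp⟩
  | .const x k, s, _, _, hs => by
      refine ⟨_, rfl, rfl, ?_⟩
      have : k.size ≤ M.size := Nat.size_le_size hs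
      simp only [State.charge, State.setReg, Prog.steps, unitCost]
      omega
  | .arith o x y z, s, _, h, hs => by
      refine ⟨_, rfl, rfl, ?_⟩
      have h1 := Nat.size_le_size (h.1 y)
      have h2 := Nat.size_le_size (h.1 z)
      have h3 : (o.eval (s.reg y) (s.reg z)).size ≤ M.size := Nat.size_le_size hs
      simp only [State.mem_reg] at h1 h2
      simp only [State.charge, State.setReg, Prog.steps, unitCost]
      omega
  | .load x a y, s, _, h, _ => by
      refine ⟨_, rfl, rfl, ?_⟩
      have h1 := Nat.size_le_size (h.1 y)
      have h2 := Nat.size_le_size (h.2 a (s.reg y))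
      simp only [State.mem_reg, State.mem_arr] at h1 h2
      simp only [State.charge, State.setReg, Prog.steps, unitCost]
      omega
  | .store a x y, s, _, h, _ => by
      refine ⟨_, rfl, rfl, ?_⟩
      have h1 := Nat.size_le_size (h.1 x)
      have h2 := Nat.size_le_size (h.1 y)
      simp only [State.mem_reg] at h1 h2
      simp only [State.charge, State.setArr, Prog.steps, unitCost]
      omega
  | .seq P Q, s, hd, h, hs => by
      obtain ⟨t, h1, h2, h3⟩ := exec_eq_pure hd.1 h hs.1
      have hok : t.mem.Ok M := h2 ▸ h.run hs.1
      obtain ⟨t', h4, h5, h6⟩ := exec_eq_pure hd.2 hok (h2 ▸ hs.2)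
      refine ⟨t', by simp [Prog.exec, h1, h4], by rw [h5, h2]; rfl, ?_⟩
      rw [h2] at h6
      simp only [Prog.steps, add_mul]
      omega
  | .ifLt x y P Q, s, hd, h, hs => by
      have h1 := Nat.size_le_size (h.1 x)
      have h2 := Nat.size_le_size (h.1 y)
      simp only [State.mem_reg] at h1 h2
      simp only [Prog.exec, Prog.run, Prog.steps, State.mem_reg]
      by_cases hxy : s.reg x < s.reg y
      · simp only [hxy, ↓reduceIte]
        obtain ⟨t, h3, h4, h5⟩ := exec_eq_pure
          (s := s.charge (1 + (s.reg x).size + (s.reg y).size)) hd.1 h (hs.1 hxy)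
        refine ⟨t, h3, h4, ?_⟩
        simp only [State.mem_charge] at h5
        simp only [State.charge] at h5
        simp only [unitCost] at *
        rw [add_mul]
        omega
      · simp only [hxy, ↓reduceIte]
        obtain ⟨t, h3, h4, h5⟩ := exec_eq_pure
          (s := s.charge (1 + (s.reg x).size + (s.reg y).size)) hd.2 h (hs.2 hxy)
        refine ⟨t, h3, h4, ?_⟩
        simp only [State.mem_charge] at h5
        simp only [State.charge] at h5
        simp only [unitCost] at *
        rw [add_mul]
        omega
  | .loop x P, s, hd, h, hs => by
      have hx := Nat.size_le_size (h.1 x)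
      simp only [State.mem_reg] at hx
      -- The charge on entering the loop is the leading one in `steps`, the charge before each
      -- iteration is the one inside the sum. The bound on the numbers is carried along because
      -- every iteration needs it.
      have key : ∀ i ≤ s.reg x, ∃ t,
          (fun μ : PMF State => μ.bind fun t => P.exec (t.charge (1 + (s.reg x).size)))^[i]
            (PMF.pure (s.charge (1 + (s.reg x).size))) = PMF.pure t ∧ t.mem = P.run^[i] s.mem ∧
          t.mem.Ok M ∧ t.time ≤ s.time +
            (1 + ∑ j ∈ Finset.range i, (1 + P.steps (P.run^[j] s.mem))) * unitCost M := by
        intro i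
        induction i with
        | zero =>
          intro _
          refine ⟨_, rfl, rfl, h, ?_⟩
          simp only [State.charge, Finset.range_zero, Finset.sum_empty, unitCost]
          omega
        | succ i ih =>
          intro hi
          obtain ⟨t, h1, h2, h3, h4⟩ := ih (by omega)
          obtain ⟨t', h5, h6, h7⟩ := exec_eq_pure (P := P)
            (s := t.charge (1 + (s.reg x).size)) hd h3
            (by rw [State.mem_charge, h2]; exact hs i hi)
          rw [State.mem_charge, h2] at h6 h7
          rw [Function.iterate_succ_apply', Function.iterate_succ_apply', h1]
          have hok : t'.mem.Ok M := by
            rw [h6]; exact (h2 ▸ h3).run (hs i hi)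
          refine ⟨t', by simpa using h5, h6, hok, ?_⟩
          rw [Finset.sum_range_succ]
          simp only [State.charge] at h7
          have : 1 + (s.reg x).size ≤ unitCost M := by unfold unitCost; omega
          calc t'.time ≤ t.time + (1 + (s.reg x).size) + P.steps (P.run^[i] s.mem) * unitCost M := h7
            _ ≤ _ := by nlinarith
      obtain ⟨t, h1, h2, -, h4⟩ := key _ le_rfl
      exact ⟨t, h1, h2, h4⟩

/-- Verification of a loop by an invariant. -/
theorem Prog.loop_inv {M : ℕ} {P : Prog} {m : Mem} {x : ℕ} (Inv : ℕ → Mem → Prop) (hok : m.Ok M)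
    (h0 : Inv 0 m)
    (hstep : ∀ i < m.reg x, ∀ t, t.Ok M → Inv i t → P.Safe M t ∧ Inv (i + 1) (P.run t)) :
    (Prog.loop x P).Safe M m ∧ Inv (m.reg x) ((Prog.loop x P).run m) := by
  have key : ∀ i ≤ m.reg x, (P.run^[i] m).Ok M ∧ Inv i (P.run^[i] m) := by
    intro i
    induction i with
    | zero => exact fun _ => ⟨hok, h0⟩
    | succ i ih =>
      intro hi
      obtain ⟨h1, h2⟩ := ih (by omega)
      obtain ⟨h3, h4⟩ := hstep i hi _ h1 h2
      rw [Function.iterate_succ_apply']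
      exact ⟨h1.run h3, h4⟩
  exact ⟨fun i hi => (hstep i hi _ (key i hi.le).1 (key i hi.le).2).1, (key _ le_rfl).2⟩

/-! ### Dynamic sets stored in rows of arrays -/

/-- Sequential composition of a list of programs. -/
def Prog.block : List Prog → Prog
  | [] => .skip
  | P :: l => .seq P (block l)

/-- Row `x` of the arrays `k`, `k + 1`, `k + 2` stores the finite set `S`: array `k` lists the
elements, array `k + 1` holds their positions plus one, and array `k + 2` the cardinality. -/
def RowRep (n : ℕ) (A : ℕ → ℕ → ℕ) (k x : ℕ) (S : Finset ℕ) : Prop :=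
  A (k + 2) x = S.card ∧ ∀ i < S.card, A k (x * n + i) ∈ S ∧ A (k + 1) (x * n + A k (x * n + i)) = i + 1

/-- Division by `n` recovers the row, because the offset is less than `n`. This is what keeps writes
to one row, or to one weight, from touching another. -/
theorem addr_inj {n x y i j : ℕ} (hi : i < n) (hj : j < n) (h : x * n + i = y * n + j) :
    x = y ∧ i = j := by
  have h1 : (x * n + i) / n = x := by
    rw [mul_comm, Nat.mul_add_div (by omega), Nat.div_eq_of_lt hi, add_zero]
  have h2 : (y * n + j) / n = y := by
    rw [mul_comm, Nat.mul_add_div (by omega), Nat.div_eq_of_lt hj, add_zero]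
  have : x = y := by rw [← h1, ← h2, h]
  subst this
  exact ⟨rfl, by omega⟩

theorem addr_le {n x i : ℕ} (hx : x < n) (hi : i ≤ n) : x * n + i ≤ (n + 1) ^ 2 := by nlinarith

/-- The position array is a left inverse of the list, so the list has no repetitions. -/
theorem RowRep.injOn {n : ℕ} {A : ℕ → ℕ → ℕ} {k x : ℕ} {S : Finset ℕ} (h : RowRep n A k x S) :
    Set.InjOn (fun i => A k (x * n + i)) (Finset.range S.card : Set ℕ) := by
  intro i hi j hj hij
  have h1 := (h.2 i (by simpa using hi)).2
  have h2 := (h.2 j (by simpa using hj)).2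
  simp only at hij
  rw [hij, h2] at h1
  omega

/-- `RowRep` asks only that listed elements belong to `S`; being `S.card` many and distinct, they
exhaust it. -/
theorem RowRep.image_range {n : ℕ} {A : ℕ → ℕ → ℕ} {k x : ℕ} {S : Finset ℕ}
    (h : RowRep n A k x S) : (Finset.range S.card).image (fun i => A k (x * n + i)) = S := by
  apply Finset.eq_of_subset_of_card_le
  · intro y hy
    obtain ⟨i, hi, rfl⟩ := Finset.mem_image.1 hy
    exact (h.2 i (by simpa using hi)).1
  · rw [Finset.card_image_of_injOn h.injOn, Finset.card_range]

theorem RowRep.exists_index {n : ℕ} {A : ℕ → ℕ → ℕ} {k x : ℕ} {S : Finset ℕ}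
    (h : RowRep n A k x S) {y : ℕ} (hy : y ∈ S) : ∃ i < S.card, A k (x * n + i) = y := by
  rw [← h.image_range] at hy
  simpa using hy

theorem RowRep.congr {n : ℕ} {A B : ℕ → ℕ → ℕ} {k x : ℕ} {S : Finset ℕ} (h : RowRep n A k x S)
    (h0 : B k = A k) (h1 : B (k + 1) = A (k + 1)) (h2 : B (k + 2) = A (k + 2)) :
    RowRep n B k x S := by
  unfold RowRep
  rwa [h0, h1, h2]

theorem card_le_of_subset_range {n : ℕ} {S : Finset ℕ} (h : S ⊆ Finset.range n) : S.card ≤ n := by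
  simpa using Finset.card_le_card h

/-- Append the element in register `y` to the row in register `x`. -/
def rowInsert (k x y : ℕ) : Prog := .block [
  .load 6 (k + 2) x,
  .arith .mul 7 x 3,
  .arith .add 8 7 6,
  .store k 8 y,
  .arith .add 6 6 4,
  .arith .add 7 7 y,
  .store (k + 1) 7 6,
  .store (k + 2) x 6]

/-- Delete the element in register `y` from the row in register `x`; the last element takes its
place. -/
def rowDelete (k x y : ℕ) : Prog := .block [
  .load 6 (k + 2) x,
  .arith .sub 6 6 4,
  .arith .mul 7 x 3,
  .arith .add 8 7 y,
  .load 9 (k + 1) 8,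
  .arith .add 10 7 6,
  .load 11 k 10,
  .arith .add 8 7 9,
  .arith .sub 8 8 4,
  .store k 8 11,
  .arith .add 8 7 11,
  .store (k + 1) 8 9,
  .store (k + 2) x 6]

/-- Only registers `6`, …, `11` and the arrays in `T` differ. -/
structure Frame (T : ℕ → Prop) (m m' : Mem) : Prop where
  reg : ∀ r, r < 6 ∨ 11 < r → m'.reg r = m.reg r
  arr : ∀ a, ¬ T a → m'.arr a = m.arr a

theorem Frame.trans {T T' : ℕ → Prop} {m m' m'' : Mem} (h : Frame T m m') (h' : Frame T' m' m'') :
    Frame (fun a => T a ∨ T' a) m m'' :=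
  ⟨fun r hr => (h'.reg r hr).trans (h.reg r hr),
    fun a ha => (h'.arr a fun h => ha (.inr h)).trans (h.arr a fun h => ha (.inl h))⟩

/-- The bounds on `x` and `y` keep the arguments clear of the scratch registers, and `k ≠ 0` keeps
these stores out of the count of weight modifications. -/
theorem rowInsert_run {k x y : ℕ} (hk : k ≠ 0) (hx : x < 6) (hy : y < 6) (m : Mem)
    (h4 : m.reg 4 = 1) :
    let n := m.reg 3
    let X := m.reg x
    let Y := m.reg y
    let d := m.arr (k + 2) X
    let m' := (rowInsert k x y).run m
    m'.arr k = Function.update (m.arr k) (X * n + d) Y ∧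
    m'.arr (k + 1) = Function.update (m.arr (k + 1)) (X * n + Y) (d + 1) ∧
    m'.arr (k + 2) = Function.update (m.arr (k + 2)) X (d + 1) ∧
    Frame (fun a => a = k ∨ a = k + 1 ∨ a = k + 2) m m' ∧ m'.writes = m.writes := by
  have e1 : x ≠ 6 := by omega
  have e2 : x ≠ 7 := by omega
  have e3 : x ≠ 8 := by omega
  have e4 : y ≠ 6 := by omega
  have e5 : y ≠ 7 := by omega
  have e6 : y ≠ 8 := by omega
  refine ⟨?_, ?_, ?_, ⟨fun r hr => ?_, fun a ha => ?_⟩, ?_⟩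
  · simp [rowInsert, Prog.block, Prog.run, ArithOp.eval, e1, e2, e3, e4, e5, e6, h4]
  · simp [rowInsert, Prog.block, Prog.run, ArithOp.eval, e1, e2, e3, e4, e5, e6, h4]
  · simp [rowInsert, Prog.block, Prog.run, ArithOp.eval, e1, e2, e3, e4, e5, e6, h4]
  · have f1 : r ≠ 6 := by omega
    have f2 : r ≠ 7 := by omega
    have f3 : r ≠ 8 := by omega
    simp [rowInsert, Prog.block, Prog.run, f1, f2, f3]
  · obtain ⟨f1, f2, f3⟩ : a ≠ k ∧ a ≠ k + 1 ∧ a ≠ k + 2 := by simpa [not_or] using ha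
    simp [rowInsert, Prog.block, Prog.run, f1, f2, f3]
  · simp [rowInsert, Prog.block, Prog.run, hk]

theorem rowDelete_run {k x y : ℕ} (hk : k ≠ 0) (hx : x < 6) (hy : y < 6) (m : Mem)
    (h4 : m.reg 4 = 1) :
    let n := m.reg 3
    let X := m.reg x
    let Y := m.reg y
    let d := m.arr (k + 2) X - 1
    let j := m.arr (k + 1) (X * n + Y)
    let z := m.arr k (X * n + d)
    let m' := (rowDelete k x y).run m
    m'.arr k = Function.update (m.arr k) (X * n + j - 1) z ∧
    m'.arr (k + 1) = Function.update (m.arr (k + 1)) (X * n + z) j ∧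
    m'.arr (k + 2) = Function.update (m.arr (k + 2)) X d ∧
    Frame (fun a => a = k ∨ a = k + 1 ∨ a = k + 2) m m' ∧ m'.writes = m.writes := by
  have e1 : x ≠ 6 := by omega
  have e2 : x ≠ 7 := by omega
  have e3 : x ≠ 8 := by omega
  have e4 : y ≠ 6 := by omega
  have e5 : y ≠ 7 := by omega
  have e6 : y ≠ 8 := by omega
  have e7 : x ≠ 9 := by omega
  have e8 : x ≠ 10 := by omega
  have e9 : x ≠ 11 := by omega
  refine ⟨?_, ?_, ?_, ⟨fun r hr => ?_, fun a ha => ?_⟩, ?_⟩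
  · simp [rowDelete, Prog.block, Prog.run, ArithOp.eval, e1, e4, e5, h4]
  · simp [rowDelete, Prog.block, Prog.run, ArithOp.eval, e1, e4, e5, h4]
  · simp [rowDelete, Prog.block, Prog.run, ArithOp.eval, e1, e2, e3, e7, e8, e9, h4]
  · have f1 : r ≠ 6 := by omega
    have f2 : r ≠ 7 := by omega
    have f3 : r ≠ 8 := by omega
    have f4 : r ≠ 9 := by omega
    have f5 : r ≠ 10 := by omega
    have f6 : r ≠ 11 := by omega
    simp [rowDelete, Prog.block, Prog.run, f1, f2, f3, f4, f5, f6]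
  · obtain ⟨f1, f2, f3⟩ : a ≠ k ∧ a ≠ k + 1 ∧ a ≠ k + 2 := by simpa [not_or] using ha
    simp [rowDelete, Prog.block, Prog.run, f1, f2, f3]
  · simp [rowDelete, Prog.block, Prog.run, hk]

theorem rowInsert_safe {n k x y : ℕ} (hx : x < 6) (hy : y < 6) {m : Mem}
    (h3 : m.reg 3 = n) (h4 : m.reg 4 = 1) (hX : m.reg x < n) (hY : m.reg y < n)
    (hd : m.arr (k + 2) (m.reg x) < n) : (rowInsert k x y).Safe ((n + 1) ^ 2) m := by
  have e1 : x ≠ 6 := by omega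
  have e4 : y ≠ 6 := by omega
  have e5 : y ≠ 7 := by omega
  have e6 : y ≠ 8 := by omega
  have b0 := addr_le hX (Nat.zero_le n)
  have b1 := addr_le hX hd.le
  have b2 := addr_le hX hY.le
  have b3 : n ≤ (n + 1) ^ 2 := by nlinarith
  simp [rowInsert, Prog.block, Prog.run, Prog.Safe, ArithOp.eval, e1, e4, e5, e6, h3, h4]
  omega

theorem rowDelete_safe {n k x y : ℕ} (hx : x < 6) (hy : y < 6) {m : Mem}
    (h3 : m.reg 3 = n) (h4 : m.reg 4 = 1) (hX : m.reg x < n) (hY : m.reg y < n)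
    (hd : m.arr (k + 2) (m.reg x) ≤ n) (hp : m.arr (k + 1) (m.reg x * n + m.reg y) ≤ n)
    (hz : m.arr k (m.reg x * n + (m.arr (k + 2) (m.reg x) - 1)) < n) :
    (rowDelete k x y).Safe ((n + 1) ^ 2) m := by
  have e1 : x ≠ 6 := by omega
  have e4 : y ≠ 6 := by omega
  have e5 : y ≠ 7 := by omega
  have e6 : y ≠ 8 := by omega
  have b0 := addr_le hX (Nat.zero_le n)
  have b1 := addr_le hX (show m.arr (k + 2) (m.reg x) - 1 ≤ n by omega)
  have b2 := addr_le hX hY.le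
  have b3 : n ≤ (n + 1) ^ 2 := by nlinarith
  have b4 := addr_le hX hp
  have b5 := addr_le hX hz.le
  simp [rowDelete, Prog.block, Prog.run, Prog.Safe, ArithOp.eval, e1, e4, e5, h3, h4]
  omega

/-- Effect of `rowInsert` on the sets represented by the rows. -/
theorem rowInsert_spec {n k x y : ℕ} (hk : k ≠ 0) (hx : x < 6) (hy : y < 6) {m : Mem}
    (h3 : m.reg 3 = n) (h4 : m.reg 4 = 1) (hX : m.reg x < n) (hY : m.reg y < n)
    {S : Finset ℕ} (hS : S ⊆ Finset.range n) (hrow : RowRep n m.arr k (m.reg x) S)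
    (hmem : m.reg y ∉ S) :
    (rowInsert k x y).Safe ((n + 1) ^ 2) m ∧
    RowRep n ((rowInsert k x y).run m).arr k (m.reg x) (insert (m.reg y) S) ∧
    (∀ x' S', x' ≠ m.reg x → S' ⊆ Finset.range n → RowRep n m.arr k x' S' →
      RowRep n ((rowInsert k x y).run m).arr k x' S') ∧
    Frame (fun a => a = k ∨ a = k + 1 ∨ a = k + 2) m ((rowInsert k x y).run m) ∧
    ((rowInsert k x y).run m).writes = m.writes := by
  have hcard : (insert (m.reg y) S).card = S.card + 1 := Finset.card_insert_of_notMem hmem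
  have hlt : S.card < n := by
    have : (insert (m.reg y) S).card ≤ n := card_le_of_subset_range (by
      intro z hz
      rcases Finset.mem_insert.1 hz with rfl | hz
      · simpa using hY
      · exact hS hz)
    omega
  obtain ⟨ha, hb, hc, hf, hw⟩ := rowInsert_run hk hx hy m h4
  simp only [h3] at ha hb hc
  have hd := hrow.1
  rw [hd] at ha hb hc
  refine ⟨rowInsert_safe hx hy h3 h4 hX hY (by rw [hd]; exact hlt), ⟨?_, ?_⟩, ?_, hf, hw⟩
  · rw [hc, hcard]; simp
  · intro i hi
    rw [hcard] at hi
    rw [ha, hb]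
    rcases Nat.lt_succ_iff_lt_or_eq.1 hi with h | rfl
    · obtain ⟨h1, h2⟩ := hrow.2 i h
      have hne : m.reg x * n + i ≠ m.reg x * n + S.card := by omega
      rw [Function.update_of_ne hne]
      refine ⟨Finset.mem_insert_of_mem h1, ?_⟩
      rw [Function.update_of_ne, h2]
      intro h
      exact hmem (by rw [← Nat.add_left_cancel h]; exact h1)
    · simp
  · rintro x' S' hx' hS' ⟨h1, h2⟩
    have hS'n := card_le_of_subset_range hS'
    refine ⟨by rw [hc, Function.update_of_ne hx', h1], fun i hi => ?_⟩
    obtain ⟨h5, h6⟩ := h2 i hi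
    rw [ha, hb, Function.update_of_ne (fun h => hx' (addr_inj (by omega) hlt h).1)]
    refine ⟨h5, ?_⟩
    rw [Function.update_of_ne, h6]
    exact fun h => hx' (addr_inj (by simpa using hS' h5) hY h).1

/-- Effect of `rowDelete` on the sets represented by the rows. -/
theorem rowDelete_spec {n k x y : ℕ} (hk : k ≠ 0) (hx : x < 6) (hy : y < 6) {m : Mem}
    (h3 : m.reg 3 = n) (h4 : m.reg 4 = 1) (hX : m.reg x < n)
    {S : Finset ℕ} (hS : S ⊆ Finset.range n) (hrow : RowRep n m.arr k (m.reg x) S)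
    (hmem : m.reg y ∈ S) :
    (rowDelete k x y).Safe ((n + 1) ^ 2) m ∧
    RowRep n ((rowDelete k x y).run m).arr k (m.reg x) (S.erase (m.reg y)) ∧
    (∀ x' S', x' ≠ m.reg x → S' ⊆ Finset.range n → RowRep n m.arr k x' S' →
      RowRep n ((rowDelete k x y).run m).arr k x' S') ∧
    Frame (fun a => a = k ∨ a = k + 1 ∨ a = k + 2) m ((rowDelete k x y).run m) ∧
    ((rowDelete k x y).run m).writes = m.writes := by
  have hpos : 0 < S.card := Finset.card_pos.2 ⟨_, hmem⟩
  have hcard : (S.erase (m.reg y)).card = S.card - 1 := Finset.card_erase_of_mem hmem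
  have hle := card_le_of_subset_range hS
  obtain ⟨ha, hb, hc, hf, hw⟩ := rowDelete_run hk hx hy m h4
  simp only [h3] at ha hb hc
  have hd := hrow.1
  rw [hd] at ha hb hc
  obtain ⟨j, hj, hjy⟩ := hrow.exists_index hmem
  have hpj := (hrow.2 j hj).2
  rw [hjy] at hpj
  obtain ⟨hz, hpz⟩ := hrow.2 (S.card - 1) (by omega)
  -- The last element moves into the gap. It may be the deleted element itself; then the moves
  -- rewrite what is already there, and the shorter length drops it.
  set z := m.arr k (m.reg x * n + (S.card - 1)) with hzdef
  have hzn : z < n := by simpa using hS hz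
  have haddr : m.reg x * n + (j + 1) - 1 = m.reg x * n + j := by omega
  rw [hpj] at ha hb
  rw [haddr] at ha
  have hYn : m.reg y < n := by simpa using hS hmem
  refine ⟨rowDelete_safe hx hy h3 h4 hX hYn (by omega) (by rw [hpj]; omega)
    (by rw [hd]; exact hzn), ⟨?_, ?_⟩, ?_, hf, hw⟩
  · rw [hc, hcard]; simp
  · intro i hi
    rw [hcard] at hi
    rw [ha, hb]
    by_cases hij : i = j
    · subst hij
      -- The gap lies before the new end of the list, so the deleted element was not the last one.
      have hzy : z ≠ m.reg y := by
        intro h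
        rw [h, hpj] at hpz
        omega
      simp [hz, hzy]
    · obtain ⟨h1, h2⟩ := hrow.2 i (by omega)
      have hne : m.reg x * n + i ≠ m.reg x * n + j := by omega
      rw [Function.update_of_ne hne]
      refine ⟨Finset.mem_erase.2 ⟨?_, h1⟩, ?_⟩
      · intro h
        rw [h, hpj] at h2
        omega
      · rw [Function.update_of_ne, h2]
        intro h
        rw [Nat.add_left_cancel h, hpz] at h2
        omega
  · rintro x' S' hx' hS' ⟨h1, h2⟩
    have hS'n := card_le_of_subset_range hS'
    refine ⟨by rw [hc, Function.update_of_ne hx', h1], fun i hi => ?_⟩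
    obtain ⟨h5, h6⟩ := h2 i hi
    rw [ha, hb, Function.update_of_ne (fun h => hx' (addr_inj (by omega) (by omega) h).1)]
    refine ⟨h5, ?_⟩
    rw [Function.update_of_ne, h6]
    exact fun h => hx' (addr_inj (by simpa using hS' h5) hzn h).1

/-! ### Changing edge weights -/

/-- The weight between the vertices with codes in registers `x` and `y` (the smaller one first)
is changed by the amount in register `11`. -/
def bumpAt (o : ArithOp) (x y : ℕ) : Prog := .block [
  .arith .sub 8 x 4,
  .arith .sub 9 y 4,
  .arith .mul 8 8 3,
  .arith .add 8 8 9,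
  .load 10 0 8,
  .arith o 10 10 11,
  .store 0 8 10]

/-- The weight between the vertices with codes in registers `6` and `7` is changed by the amount in
register `11`, if they are different. -/
def bump (o : ArithOp) : Prog := .ifLt 6 7 (bumpAt o 6 7) (.ifLt 7 6 (bumpAt o 7 6) .skip)

/-- The result of `bump`. -/
theorem bump_spec (o : ArithOp) {n A B : ℕ} {m : Mem}
    (h3 : m.reg 3 = n) (h4 : m.reg 4 = 1) (h6 : m.reg 6 = A + 1) (h7 : m.reg 7 = B + 1)
    (hA : A < n) (hB : B < n)
    (hle : A ≠ B → o.eval (m.arr 0 (min A B * n + max A B)) (m.reg 11) ≤ (n + 1) ^ 2) :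
    (bump o).Safe ((n + 1) ^ 2) m ∧
    (∀ r, r < 8 ∨ 10 < r → ((bump o).run m).reg r = m.reg r) ∧
    (∀ a, a ≠ 0 → ((bump o).run m).arr a = m.arr a) ∧
    (∀ i, ((bump o).run m).arr 0 i =
      if A ≠ B ∧ i = min A B * n + max A B then o.eval (m.arr 0 i) (m.reg 11) else m.arr 0 i) ∧
    ((bump o).run m).writes ≤ m.writes + 1 := by
  have b3 : n ≤ (n + 1) ^ 2 := by nlinarith
  have hAl := addr_le hA hB.le
  have hBl := addr_le hB hA.le
  rcases lt_trichotomy A B with h | h | h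
  · have e1 : min A B = A := by omega
    have e2 : max A B = B := by omega
    have hne : A ≠ B := by omega
    rw [e1, e2] at hle ⊢
    have hle := hle hne
    have hif : m.reg 6 < m.reg 7 := by omega
    have hrun : (bump o).run m = (bumpAt o 6 7).run m := by simp [bump, Prog.run, hif]
    rw [hrun]
    refine ⟨?_, ?_, ?_, ?_, ?_⟩
    · refine ⟨fun _ => ?_, fun h => absurd hif h⟩
      simp [bumpAt, Prog.block, Prog.run, Prog.Safe, ArithOp.eval, h3, h4, h6, h7] at hle ⊢
      refine ⟨by omega, by omega, ?_, hAl, hle⟩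
      omega
    · intro r hr
      have f1 : r ≠ 8 := by omega
      have f2 : r ≠ 9 := by omega
      have f3 : r ≠ 10 := by omega
      simp [bumpAt, Prog.block, Prog.run, f1, f2, f3]
    · intro a ha
      simp [bumpAt, Prog.block, Prog.run, ha]
    · intro i
      simp only [bumpAt, Prog.block, Prog.run, ArithOp.eval]
      by_cases hi : i = A * n + B
      · simp [hi, hne, h3, h4, h6, h7]
      · simp [hi, h3, h4, h6, h7]
    · simp [bumpAt, Prog.block, Prog.run]
  · subst h
    have hrun : (bump o).run m = m := by simp [bump, Prog.run, h6, h7]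
    rw [hrun]
    refine ⟨?_, fun _ _ => rfl, fun _ _ => rfl, fun i => by simp, by omega⟩
    simp [bump, Prog.Safe, h6, h7]
  · have e1 : min A B = B := by omega
    have e2 : max A B = A := by omega
    have hne : A ≠ B := by omega
    rw [e1, e2] at hle ⊢
    have hle := hle hne
    have hif : ¬ m.reg 6 < m.reg 7 := by omega
    have hif' : m.reg 7 < m.reg 6 := by omega
    have hrun : (bump o).run m = (bumpAt o 7 6).run m := by simp [bump, Prog.run, hif, hif']
    rw [hrun]
    refine ⟨?_, ?_, ?_, ?_, ?_⟩
    · refine ⟨fun h => absurd h hif, fun _ => ⟨fun _ => ?_, fun h => absurd hif' h⟩⟩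
      simp [bumpAt, Prog.block, Prog.run, Prog.Safe, ArithOp.eval, h3, h4, h6, h7] at hle ⊢
      refine ⟨by omega, by omega, ?_, hBl, hle⟩
      omega
    · intro r hr
      have f1 : r ≠ 8 := by omega
      have f2 : r ≠ 9 := by omega
      have f3 : r ≠ 10 := by omega
      simp [bumpAt, Prog.block, Prog.run, f1, f2, f3]
    · intro a ha
      simp [bumpAt, Prog.block, Prog.run, ha]
    · intro i
      simp only [bumpAt, Prog.block, Prog.run, ArithOp.eval]
      by_cases hi : i = B * n + A
      · simp [hi, hne, h3, h4, h6, h7]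
      · simp [hi, h3, h4, h6, h7]
    · simp [bumpAt, Prog.block, Prog.run]

/-- Count the next neighbor at its code. -/
def countBody : Prog := .block [
  .load 15 2 14,
  .load 16 1 15,
  .load 17 8 16,
  .arith .add 17 17 4,
  .store 8 16 17,
  .arith .add 14 14 4]

/-- Transfer the count at the code of the next neighbor, unless this was done before. -/
def applyBody (o : ArithOp) : Prog := .block [
  .load 15 2 14,
  .load 7 1 15,
  .load 11 8 7,
  .ifLt 5 11 (.block [.store 8 7 5, .ifLt 5 7 (bump o) .skip]) .skip,
  .arith .add 14 14 4]

/-- All edges at the vertex in register `0`, whose code is in register `6`, are added to or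
subtracted from the weights, with one write for each pair of vertices of the contraction. -/
def shift (o : ArithOp) : Prog := .block [
  .load 12 4 0,
  .arith .mul 13 0 3,
  .arith .add 14 13 5,
  .loop 12 countBody,
  .arith .add 14 13 5,
  .loop 12 (applyBody o)]

theorem countBody_run (m : Mem) (h4 : m.reg 4 = 1) :
    let y := m.arr 1 (m.arr 2 (m.reg 14))
    (∀ r, r < 14 ∨ 17 < r → (countBody.run m).reg r = m.reg r) ∧
    (countBody.run m).reg 14 = m.reg 14 + 1 ∧
    (∀ a, a ≠ 8 → (countBody.run m).arr a = m.arr a) ∧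
    (countBody.run m).arr 8 = Function.update (m.arr 8) y (m.arr 8 y + 1) ∧
    (countBody.run m).writes = m.writes := by
  refine ⟨fun r hr => ?_, ?_, fun a ha => ?_, ?_, ?_⟩
  · have f1 : r ≠ 14 := by omega
    have f2 : r ≠ 15 := by omega
    have f3 : r ≠ 16 := by omega
    have f4 : r ≠ 17 := by omega
    simp [countBody, Prog.block, Prog.run, f1, f2, f3, f4]
  · simp [countBody, Prog.block, Prog.run, ArithOp.eval, h4]
  · simp [countBody, Prog.block, Prog.run, ha]
  · simp [countBody, Prog.block, Prog.run, ArithOp.eval, h4]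
  · simp [countBody, Prog.block, Prog.run]

/-- The loop of `shift` that counts. -/
theorem countLoop_spec {n D : ℕ} {m : Mem} (hok : m.Ok ((n + 1) ^ 2)) (hu : m.reg 0 < n)
    (h4 : m.reg 4 = 1) (h12 : m.reg 12 = D) (h14 : m.reg 14 = m.reg 0 * n) (hD : D ≤ n)
    (h8 : ∀ y, m.arr 8 y = 0) :
    (Prog.loop 12 countBody).Safe ((n + 1) ^ 2) m ∧
    (∀ r, r < 14 ∨ 17 < r → ((Prog.loop 12 countBody).run m).reg r = m.reg r) ∧
    (∀ a, a ≠ 8 → ((Prog.loop 12 countBody).run m).arr a = m.arr a) ∧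
    (∀ y, ((Prog.loop 12 countBody).run m).arr 8 y =
      ((Finset.range D).filter fun j => m.arr 1 (m.arr 2 (m.reg 0 * n + j)) = y).card) ∧
    ((Prog.loop 12 countBody).run m).writes = m.writes := by
  have b3 : n ≤ (n + 1) ^ 2 := by nlinarith
  have key := Prog.loop_inv (M := (n + 1) ^ 2) (P := countBody) (m := m) (x := 12)
    (fun i t => (∀ r, r < 14 ∨ 17 < r → t.reg r = m.reg r) ∧ t.reg 14 = m.reg 0 * n + i ∧
      (∀ a, a ≠ 8 → t.arr a = m.arr a) ∧
      (∀ y, t.arr 8 y =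
        ((Finset.range i).filter fun j => m.arr 1 (m.arr 2 (m.reg 0 * n + j)) = y).card) ∧
      t.writes = m.writes) hok
    ⟨fun _ _ => rfl, by simpa using h14, fun _ _ => rfl, fun y => by simp [h8], rfl⟩ ?_
  · obtain ⟨h1, h2, -, h3, h5, h6⟩ := key
    rw [h12] at h5
    exact ⟨h1, h2, h3, h5, h6⟩
  · rintro i hi t - ⟨h1, h2, h3, h5, h6⟩
    have ht4 : t.reg 4 = 1 := by rw [h1 4 (by omega), h4]
    obtain ⟨g1, g2, g3, g4, g5⟩ := countBody_run t ht4
    have hcnt : ∀ y, t.arr 8 y ≤ i := fun y => by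
      rw [h5]
      exact (Finset.card_filter_le _ _).trans (by simp)
    refine ⟨?_, fun r hr => by rw [g1 r hr, h1 r hr], by rw [g2, h2]; ring,
      fun a ha => by rw [g3 a ha, h3 a ha], fun y => ?_, by rw [g5, h6]⟩
    · have := hcnt (t.arr 1 (t.arr 2 (t.reg 14)))
      have b1 := addr_le hu (show i + 1 ≤ n by omega)
      simp only [h2] at this
      simp [countBody, Prog.block, Prog.run, Prog.Safe, ArithOp.eval, ht4, h2]
      omega
    · rw [g4, h2, h3 1 (by omega), h3 2 (by omega), Finset.range_add_one, Finset.filter_insert]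
      by_cases hy : m.arr 1 (m.arr 2 (m.reg 0 * n + i)) = y
      · subst hy
        simp [h5]
      · rw [if_neg hy, Function.update_of_ne (Ne.symm hy), h5]

/-- A count is reset as soon as it is transferred. A later neighbor with the same code then finds
zero and causes no second write, and after all neighbors the counters are clean for the next use.
Code `0` stands for unmapped neighbors: their counter is reset, but no weight changes. The
hypothesis `ho` lets a zero count act as no change. -/
theorem applyBody_spec (o : ArithOp) (ho : ∀ w, o.eval w 0 = w) {n A : ℕ} {m : Mem}
    (h3 : m.reg 3 = n) (h4 : m.reg 4 = 1)
    (h5 : m.reg 5 = 0) (h6 : m.reg 6 = A + 1) (hA : A < n)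
    (hy : m.arr 1 (m.arr 2 (m.reg 14)) ≤ n) (h14 : m.reg 14 + 1 ≤ (n + 1) ^ 2)
    (hle : ∀ B, m.arr 1 (m.arr 2 (m.reg 14)) = B + 1 → A ≠ B → 0 < m.arr 8 (B + 1) →
      o.eval (m.arr 0 (min A B * n + max A B)) (m.arr 8 (B + 1)) ≤ (n + 1) ^ 2) :
    let y := m.arr 1 (m.arr 2 (m.reg 14))
    (applyBody o).Safe ((n + 1) ^ 2) m ∧
    (∀ r, r < 7 ∨ (11 < r ∧ r < 14) ∨ 15 < r → ((applyBody o).run m).reg r = m.reg r) ∧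
    ((applyBody o).run m).reg 14 = m.reg 14 + 1 ∧
    (∀ a, a ≠ 0 → a ≠ 8 → ((applyBody o).run m).arr a = m.arr a) ∧
    ((applyBody o).run m).arr 8 = Function.update (m.arr 8) y 0 ∧
    (∀ i, ((applyBody o).run m).arr 0 i =
      if 0 < y ∧ A ≠ y - 1 ∧ i = min A (y - 1) * n + max A (y - 1)
        then o.eval (m.arr 0 i) (m.arr 8 y) else m.arr 0 i) ∧
    ((applyBody o).run m).writes ≤ m.writes + if 0 < y ∧ 0 < m.arr 8 y then 1 else 0 := by
  intro y
  set m₁ : Mem := (Prog.block [.load 15 2 14, .load 7 1 15, .load 11 8 7]).run m with hm₁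
  have r7 : m₁.reg 7 = y := by simp [hm₁, Prog.block, Prog.run, y]
  have r11 : m₁.reg 11 = m.arr 8 y := by simp [hm₁, Prog.block, Prog.run, y]
  have rr : ∀ r, r < 7 ∨ (11 < r ∧ r < 15) ∨ 15 < r → m₁.reg r = m.reg r := by
    intro r hr
    have f1 : r ≠ 7 := by omega
    have f2 : r ≠ 11 := by omega
    have f3 : r ≠ 15 := by omega
    simp [hm₁, Prog.block, Prog.run, f1, f2, f3]
  have ra : m₁.arr = m.arr := by simp [hm₁, Prog.block, Prog.run]
  have rw' : m₁.writes = m.writes := by simp [hm₁, Prog.block, Prog.run]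
  set Q : Prog := .ifLt 5 11 (.block [.store 8 7 5, .ifLt 5 7 (bump o) .skip]) .skip with hQ
  have hrun : (applyBody o).run m = (Prog.arith .add 14 14 4).run (Q.run m₁) := rfl
  suffices h : Q.Safe ((n + 1) ^ 2) m₁ ∧
      (∀ r, r < 8 ∨ 10 < r → (Q.run m₁).reg r = m₁.reg r) ∧
      (∀ a, a ≠ 0 → a ≠ 8 → (Q.run m₁).arr a = m.arr a) ∧
      (Q.run m₁).arr 8 = Function.update (m.arr 8) y 0 ∧
      (∀ i, (Q.run m₁).arr 0 i =
        if 0 < y ∧ A ≠ y - 1 ∧ i = min A (y - 1) * n + max A (y - 1)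
          then o.eval (m.arr 0 i) (m.arr 8 y) else m.arr 0 i) ∧
      (Q.run m₁).writes ≤ m.writes + if 0 < y ∧ 0 < m.arr 8 y then 1 else 0 by
    obtain ⟨g1, g2, g3, g4, g5, g6⟩ := h
    have hr4 : (Q.run m₁).reg 4 = 1 := by rw [g2 4 (by omega), rr 4 (by omega), h4]
    have hr14 : (Q.run m₁).reg 14 = m.reg 14 := by rw [g2 14 (by omega), rr 14 (by omega)]
    refine ⟨⟨trivial, trivial, trivial, g1, ?_, trivial⟩, fun r hr => ?_, ?_, g3, g4, g5, g6⟩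
    · change (Q.run m₁).reg 14 + (Q.run m₁).reg 4 ≤ _
      rw [hr4, hr14]; exact h14
    · have f1 : r ≠ 14 := by omega
      rw [hrun]
      simp only [Prog.run, Function.update_of_ne f1]
      rcases lt_or_ge r 8 with h8 | h8
      · rw [g2 r (by omega), rr r (by omega)]
      · rw [g2 r (by omega), rr r (by omega)]
    · rw [hrun]
      simp [Prog.run, ArithOp.eval, hr4, hr14]
  have hr5 : m₁.reg 5 = 0 := by rw [rr 5 (by omega), h5]
  by_cases hc : 0 < m.arr 8 y
  · have hif : m₁.reg 5 < m₁.reg 11 := by omega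
    set m₂ : Mem := (Prog.store 8 7 5).run m₁ with hm₂
    have s8 : m₂.arr 8 = Function.update (m.arr 8) y 0 := by
      simp [hm₂, Prog.run, r7, hr5, ra]
    have sa : ∀ a, a ≠ 8 → m₂.arr a = m.arr a := fun a ha => by simp [hm₂, Prog.run, ha, ra]
    have sr : m₂.reg = m₁.reg := rfl
    have sw : m₂.writes = m.writes := by simp [hm₂, Prog.run, rw']
    by_cases hy0 : 0 < y
    · have hif2 : m₂.reg 5 < m₂.reg 7 := by rw [sr]; omega
      have hQr : Q.run m₁ = (bump o).run m₂ := (if_pos hif).trans (if_pos hif2)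
      obtain ⟨B, hB⟩ : ∃ B, y = B + 1 := ⟨y - 1, by omega⟩
      have hb := bump_spec o (n := n) (A := A) (B := B) (m := m₂)
        (by rw [sr, rr 3 (by omega), h3]) (by rw [sr, rr 4 (by omega), h4])
        (by rw [sr, rr 6 (by omega), h6]) (by rw [sr, r7, hB]) hA (by omega)
        (fun hAB => by
          rw [sr, r11, sa 0 (by omega), hB]
          exact hle B hB hAB (hB ▸ hc))
      obtain ⟨g1, g2, g3, g4, g5⟩ := hb
      have hy1 : y - 1 = B := by omega
      rw [hQr, hy1]
      refine ⟨⟨fun _ => ⟨trivial, ⟨fun _ => g1, fun _ => trivial⟩, trivial⟩, fun _ => trivial⟩,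
        fun r hr => by rw [g2 r hr, sr], fun a ha ha' => by rw [g3 a ha, sa a ha'],
        by rw [g3 8 (by omega), s8], fun i => ?_, ?_⟩
      · rw [g4 i, sa 0 (by omega), sr, r11]
        simp [hy0]
      · simp only [hy0, hc, and_self, ↓reduceIte]
        rw [sw] at g5
        exact g5
    · have hif2 : ¬ m₂.reg 5 < m₂.reg 7 := by rw [sr]; omega
      have hQr : Q.run m₁ = m₂ := (if_pos hif).trans (if_neg hif2)
      rw [hQr]
      refine ⟨⟨fun _ => ⟨trivial, ⟨fun h => absurd h hif2, fun _ => trivial⟩, trivial⟩,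
        fun _ => trivial⟩, fun r _ => by rw [sr], fun a ha ha' => sa a ha', s8, fun i => ?_, ?_⟩
      · simp [hy0, sa 0]
      · rw [sw]; omega
  · have hif : ¬ m₁.reg 5 < m₁.reg 11 := by omega
    have hc0 : m.arr 8 y = 0 := by omega
    have hQr : Q.run m₁ = m₁ := by simp [hQ, Prog.run, hif]
    rw [hQr]
    refine ⟨⟨fun h => absurd h hif, fun _ => trivial⟩, fun _ _ => rfl, fun a _ _ => by rw [ra],
      ?_, fun i => ?_, ?_⟩
    · rw [ra, ← hc0, Function.update_eq_self]
    · rw [ra, hc0, ho]; simp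
    · rw [rw']; omega

/-- The amount by which the weight between `X` and `Y` changes, where `A` is the vertex of the
contraction to which edges are added, `Z` is the set of codes treated and `c` counts the edges for
every code. -/
def shiftAmount (A : ℕ) (Z : Finset ℕ) (c : ℕ → ℕ) (X Y : ℕ) : ℕ :=
  if X = A ∧ Y + 1 ∈ Z then c (Y + 1) else if Y = A ∧ X + 1 ∈ Z then c (X + 1) else 0

/-- The loop of `shift` that changes weights. -/
theorem applyLoop_spec (o : ArithOp) (ho : ∀ w, o.eval w 0 = w) {n A D : ℕ} {m : Mem}
    (hok : m.Ok ((n + 1) ^ 2)) (hu : m.reg 0 < n) (h3 : m.reg 3 = n) (h4 : m.reg 4 = 1)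
    (h5 : m.reg 5 = 0) (h6 : m.reg 6 = A + 1) (hA : A < n) (h12 : m.reg 12 = D)
    (h14 : m.reg 14 = m.reg 0 * n) (hD : D ≤ n)
    (hy : ∀ i < D, m.arr 1 (m.arr 2 (m.reg 0 * n + i)) ≤ n)
    (hle : ∀ X Y y, X < Y → Y < n → o.eval (m.arr 0 (X * n + Y)) (m.arr 8 y) ≤ (n + 1) ^ 2) :
    let Z := fun i => (Finset.range i).image fun j => m.arr 1 (m.arr 2 (m.reg 0 * n + j))
    let m' := (Prog.loop 12 (applyBody o)).run m
    (Prog.loop 12 (applyBody o)).Safe ((n + 1) ^ 2) m ∧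
    (∀ r, r < 7 ∨ 15 < r → m'.reg r = m.reg r) ∧
    (∀ a, a ≠ 0 → a ≠ 8 → m'.arr a = m.arr a) ∧
    (∀ y, m'.arr 8 y = if y ∈ Z D then 0 else m.arr 8 y) ∧
    (∀ X Y, X < Y → Y < n → m'.arr 0 (X * n + Y) =
      o.eval (m.arr 0 (X * n + Y)) (shiftAmount A (Z D) (m.arr 8) X Y)) ∧
    m'.writes ≤ m.writes + ((Z D).erase 0).card := by
  intro Z m'
  have key := Prog.loop_inv (M := (n + 1) ^ 2) (P := applyBody o) (m := m) (x := 12)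
    (fun i t => (∀ r, r < 7 ∨ (11 < r ∧ r < 14) ∨ 15 < r → t.reg r = m.reg r) ∧
      t.reg 14 = m.reg 0 * n + i ∧
      (∀ a, a ≠ 0 → a ≠ 8 → t.arr a = m.arr a) ∧
      (∀ y, t.arr 8 y = if y ∈ Z i then 0 else m.arr 8 y) ∧
      (∀ X Y, X < Y → Y < n → t.arr 0 (X * n + Y) =
        o.eval (m.arr 0 (X * n + Y)) (shiftAmount A (Z i) (m.arr 8) X Y)) ∧
      t.writes ≤ m.writes + ((Z i).erase 0).card) hok
    ⟨fun _ _ => rfl, by simpa using h14, fun _ _ _ => rfl, fun y => by simp [Z],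
      fun X Y _ _ => by simp [Z, shiftAmount, ho], by simp [Z]⟩ ?_
  · obtain ⟨g1, g2, -, g3, g4, g5, g6⟩ := key
    rw [h12] at g4 g5 g6
    exact ⟨g1, fun r hr => g2 r (by omega), g3, g4, g5, g6⟩
  · rintro i hi t - ⟨g1, g2, g3, g4, g5, g6⟩
    rw [h12] at hi
    have hyt : t.arr 1 (t.arr 2 (t.reg 14)) = m.arr 1 (m.arr 2 (m.reg 0 * n + i)) := by
      rw [g2, g3 1 (by omega) (by omega), g3 2 (by omega) (by omega)]
    have hZ : Z (i + 1) = insert (m.arr 1 (m.arr 2 (m.reg 0 * n + i))) (Z i) := by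
      simp only [Z, Finset.range_add_one, Finset.image_insert]
    have hyn := hy i hi
    set y := m.arr 1 (m.arr 2 (m.reg 0 * n + i)) with hydef
    have hb := applyBody_spec o ho (n := n) (A := A) (m := t) (by rw [g1 3 (by omega), h3])
      (by rw [g1 4 (by omega), h4]) (by rw [g1 5 (by omega), h5]) (by rw [g1 6 (by omega), h6]) hA
      (by rw [hyt]; exact hyn) (by
        rw [g2]
        exact addr_le hu (show i + 1 ≤ n by omega))
      (by
        intro B hB hAB hpos
        rw [hyt] at hB
        have hBZ : B + 1 ∉ Z i := by
          intro h
          rw [g4, if_pos h] at hpos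
          exact absurd hpos (lt_irrefl 0)
        rw [g4, if_neg hBZ, g5 _ _ (by omega) (by omega)]
        -- A code met for the first time has not yet changed the weight of its pair, so the bound
        -- assumed for the original table applies.
        have : shiftAmount A (Z i) (m.arr 8) (min A B) (max A B) = 0 := by
          rcases lt_or_gt_of_ne hAB with h | h
          · rw [min_eq_left h.le, max_eq_right h.le]
            simp [shiftAmount, hBZ, hAB.symm]
          · rw [min_eq_right h.le, max_eq_left h.le]
            simp [shiftAmount, hBZ, hAB.symm]
        rw [this, ho]
        exact hle _ _ _ (by omega) (by omega))
    obtain ⟨k1, k2, k3, k4, k5, k6, k7⟩ := hb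
    rw [hyt] at k5 k6 k7
    refine ⟨k1, fun r hr => by rw [k2 r hr, g1 r hr], by rw [k3, g2]; ring,
      fun a ha ha' => by rw [k4 a ha ha', g3 a ha ha'], fun z => ?_, fun X Y hXY hY => ?_, ?_⟩
    · rw [k5, hZ]
      by_cases hz : z = y
      · simp [hz]
      · rw [Function.update_of_ne hz, g4]
        simp [hz]
    · rw [k6, g5 X Y hXY hY, hZ, g4]
      -- If the code was treated before, its counter is zero and the weights stay. Otherwise exactly
      -- one pair changes, and injectivity of addresses tells which.
      by_cases hyZ : y ∈ Z i
      · rw [if_pos hyZ, ho, Finset.insert_eq_of_mem hyZ]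
        simp
      · rw [if_neg hyZ]
        by_cases hc : 0 < y ∧ A ≠ y - 1 ∧ X * n + Y = min A (y - 1) * n + max A (y - 1)
        · rw [if_pos hc]
          obtain ⟨c1, c2, c3⟩ := hc
          obtain ⟨d1, d2⟩ := addr_inj hY (by omega) c3
          have hy1 : y - 1 + 1 = y := by omega
          rcases lt_or_gt_of_ne c2 with h | h
          · rw [min_eq_left h.le] at d1
            rw [max_eq_right h.le] at d2
            have : Y ≠ A := by omega
            rw [← hy1, ← d2] at hyZ ⊢
            simp [shiftAmount, d1, hyZ, ho, this]
          · rw [min_eq_right h.le] at d1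
            rw [max_eq_left h.le] at d2
            have : X ≠ A := by omega
            rw [← hy1, ← d1] at hyZ ⊢
            simp [shiftAmount, this, d2, hyZ, ho]
        · rw [if_neg hc]
          congr 1
          unfold shiftAmount
          simp only [Finset.mem_insert]
          have q1 : X = A → Y + 1 ≠ y := by
            intro hX hYy
            have : y - 1 = Y := by omega
            exact hc ⟨by omega, by omega, by rw [this, ← hX, min_eq_left hXY.le, max_eq_right hXY.le]⟩
          have q2 : Y = A → X + 1 ≠ y := by
            intro hYA hXy
            have : y - 1 = X := by omega
            exact hc ⟨by omega, by omega, by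
              rw [this, ← hYA, min_eq_right hXY.le, max_eq_left hXY.le]⟩
          by_cases hX : X = A
          · have hYA : Y ≠ A := by omega
            simp [hX, hYA, q1 hX]
          · by_cases hYA : Y = A
            · simp [hX, hYA, q2 hYA]
            · simp [hX, hYA]
    · rw [hZ]
      rw [g4] at k7
      by_cases hyZ : y ∈ Z i
      · rw [Finset.insert_eq_of_mem hyZ]
        simp [hyZ] at k7
        omega
      · by_cases hy0 : 0 < y
        · have : ((insert y (Z i)).erase 0).card = ((Z i).erase 0).card + 1 := by
            rw [Finset.erase_insert_of_ne (by omega), Finset.card_insert_of_notMem]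
            simp [hyZ]
          rw [this]
          refine k7.trans ?_
          split_ifs <;> omega
        · have hy0 : y = 0 := by omega
          rw [hy0]
          simp [hy0] at k7 ⊢
          omega

theorem countBody_flat : countBody.Flat := by simp [countBody, Prog.block, Prog.Flat]

theorem bump_flat (o : ArithOp) : (bump o).Flat := by simp [bump, bumpAt, Prog.block, Prog.Flat]

theorem applyBody_flat (o : ArithOp) : (applyBody o).Flat := by
  simp [applyBody, Prog.block, Prog.Flat, bump_flat]

theorem bump_det (o : ArithOp) : (bump o).Det := by simp [bump, bumpAt, Prog.block, Prog.Det]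

theorem shift_det (o : ArithOp) : (shift o).Det := by
  simp [shift, countBody, applyBody, bump_det, Prog.block, Prog.Det]

theorem rowInsert_det (k x y : ℕ) : (rowInsert k x y).Det := by
  simp [rowInsert, Prog.block, Prog.Det]

theorem rowDelete_det (k x y : ℕ) : (rowDelete k x y).Det := by
  simp [rowDelete, Prog.block, Prog.Det]

/-- The effect of `shift`: with `S` the set of neighbors and `A` the vertex of the contraction into
which the vertex in register `0` is contracted, the weight between `A` and any other vertex `B`
changes by the number of neighbors with code `B + 1`. -/
theorem shift_spec (o : ArithOp) (ho : ∀ w, o.eval w 0 = w) {n A : ℕ} {m : Mem} {S : Finset ℕ}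
    (hok : m.Ok ((n + 1) ^ 2)) (hu : m.reg 0 < n) (h3 : m.reg 3 = n) (h4 : m.reg 4 = 1)
    (h5 : m.reg 5 = 0) (h6 : m.reg 6 = A + 1) (hA : A < n) (hS : S ⊆ Finset.range n)
    (hrow : RowRep n m.arr 2 (m.reg 0) S) (hγ : ∀ z < n, m.arr 1 z ≤ n)
    (h8 : ∀ y, m.arr 8 y = 0)
    (hle : ∀ X Y c, X < Y → Y < n → c ≤ n → o.eval (m.arr 0 (X * n + Y)) c ≤ (n + 1) ^ 2) :
    let m' := (shift o).run m
    (shift o).Safe ((n + 1) ^ 2) m ∧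
    (∀ r, r < 6 ∨ 17 < r → m'.reg r = m.reg r) ∧
    (∀ a, a ≠ 0 → m'.arr a = m.arr a) ∧
    (∀ X Y, X < Y → Y < n → m'.arr 0 (X * n + Y) = o.eval (m.arr 0 (X * n + Y))
      (if X = A then (S.filter fun z => m.arr 1 z = Y + 1).card
        else if Y = A then (S.filter fun z => m.arr 1 z = X + 1).card else 0)) ∧
    m'.writes ≤ m.writes + ((S.image (m.arr 1)).erase 0).card ∧
    (shift o).steps m ≤ 6 + 31 * S.card := by
  intro m'
  have hd := hrow.1
  have hcard := card_le_of_subset_range hS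
  have b0 := addr_le hu (Nat.zero_le n)
  set m₁ : Mem := (Prog.block [.load 12 4 0, .arith .mul 13 0 3, .arith .add 14 13 5]).run m
    with hm₁
  have a1 : m₁.arr = m.arr := rfl
  have w1 : m₁.writes = m.writes := rfl
  have r12 : m₁.reg 12 = S.card := by simp [hm₁, Prog.block, Prog.run, hd]
  have r13 : m₁.reg 13 = m.reg 0 * n := by simp [hm₁, Prog.block, Prog.run, ArithOp.eval, h3]
  have r14 : m₁.reg 14 = m.reg 0 * n := by simp [hm₁, Prog.block, Prog.run, ArithOp.eval, h3, h5]
  have rr : ∀ r, r < 12 ∨ 14 < r → m₁.reg r = m.reg r := by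
    intro r hr
    have f1 : r ≠ 12 := by omega
    have f2 : r ≠ 13 := by omega
    have f3 : r ≠ 14 := by omega
    simp [hm₁, Prog.block, Prog.run, f1, f2, f3]
  have safe1 : (Prog.block [.load 12 4 0, .arith .mul 13 0 3, .arith .add 14 13 5]).Safe
      ((n + 1) ^ 2) m := by
    simp [Prog.block, Prog.run, Prog.Safe, ArithOp.eval, h3, h5]
    omega
  have hok1 : m₁.Ok ((n + 1) ^ 2) := hok.run safe1
  obtain ⟨c1, c2, c3, c4, c5⟩ := countLoop_spec (n := n) hok1 (by rwa [rr 0 (by omega)])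
    (by rw [rr 4 (by omega), h4]) r12 (by rw [r14, rr 0 (by omega)]) hcard (by rwa [a1])
  set m₂ := (Prog.loop 12 countBody).run m₁ with hm₂
  have hok2 : m₂.Ok ((n + 1) ^ 2) := hok1.run c1
  -- The loop counts positions in the list; as the list has no repetitions, this counts neighbors.
  have hcount : ∀ y, m₂.arr 8 y = (S.filter fun z => m.arr 1 z = y).card := by
    intro y
    rw [c4, a1, rr 0 (by omega)]
    conv_rhs => rw [← hrow.image_range, Finset.filter_image]
    rw [Finset.card_image_of_injOn]
    exact hrow.injOn.mono (Finset.coe_subset.2 (Finset.filter_subset _ _))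
  set m₃ := (Prog.arith .add 14 13 5).run m₂ with hm₃
  have r3 : ∀ r, r < 12 ∨ 17 < r → m₃.reg r = m.reg r := by
    intro r hr
    have : r ≠ 14 := by omega
    rw [← rr r (by omega), ← c2 r (by omega)]
    simp [hm₃, Prog.run, this]
  have r12' : m₃.reg 12 = S.card := by
    rw [← r12, ← c2 12 (by omega)]
    simp [hm₃, Prog.run]
  have e13 : m₂.reg 13 = m.reg 0 * n := by rw [c2 13 (by omega), r13]
  have e5 : m₂.reg 5 = 0 := by rw [c2 5 (by omega), rr 5 (by omega), h5]
  have r14' : m₃.reg 14 = m.reg 0 * n := by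
    simp [hm₃, Prog.run, ArithOp.eval, e13, e5]
  have a3 : m₃.arr = m₂.arr := rfl
  have aa : ∀ a, a ≠ 8 → m₃.arr a = m.arr a := fun a ha => by rw [a3, c3 a ha, a1]
  have safe3 : (Prog.arith .add 14 13 5).Safe ((n + 1) ^ 2) m₂ := by
    change m₂.reg 13 + m₂.reg 5 ≤ _
    omega
  have hok3 : m₃.Ok ((n + 1) ^ 2) := hok2.run safe3
  obtain ⟨d1, d2, d3, d4, d5, d6⟩ := applyLoop_spec o ho (n := n) (A := A) (D := S.card) hok3
    (by rwa [r3 0 (by omega)]) (by rw [r3 3 (by omega), h3]) (by rw [r3 4 (by omega), h4])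
    (by rw [r3 5 (by omega), h5]) (by rw [r3 6 (by omega), h6]) hA r12'
    (by rw [r14', r3 0 (by omega)]) hcard
    (fun i hi => by
      rw [aa 1 (by omega), aa 2 (by omega), r3 0 (by omega)]
      exact hγ _ (by simpa using hS (hrow.2 i hi).1))
    (fun X Y y hXY hY => by
      rw [aa 0 (by omega), a3, hcount]
      exact hle X Y _ hXY hY ((Finset.card_filter_le _ _).trans hcard))
  have hZ : ((Finset.range S.card).image fun j => m₃.arr 1 (m₃.arr 2 (m₃.reg 0 * n + j))) =
      S.image (m.arr 1) := by
    rw [aa 1 (by omega), aa 2 (by omega), r3 0 (by omega)]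
    conv_rhs => rw [← hrow.image_range, Finset.image_image]
    rfl
  simp only [hZ] at d4 d5 d6
  -- A code that never occurs has count zero, so the restriction to treated codes in `shiftAmount`
  -- can be dropped.
  have hzero : ∀ y, y ∉ S.image (m.arr 1) → (S.filter fun z => m.arr 1 z = y).card = 0 := by
    intro y hy
    rw [Finset.card_eq_zero, Finset.filter_eq_empty_iff]
    intro z hz h
    exact hy (Finset.mem_image.2 ⟨z, hz, h⟩)
  have hm' : m' = (Prog.loop 12 (applyBody o)).run m₃ := rfl
  rw [hm']
  refine ⟨?_, fun r hr => by rw [d2 r (by omega), r3 r (by omega)], fun a ha => ?_,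
    fun X Y hXY hY => ?_, ?_, ?_⟩
  · exact ⟨safe1.1, safe1.2.1, safe1.2.2.1, c1, safe3, d1, trivial⟩
  · by_cases ha8 : a = 8
    · subst ha8
      funext y
      rw [d4, h8]
      split_ifs with hy
      · rfl
      · rw [a3, hcount, hzero y hy]
    · rw [d3 a ha ha8, aa a ha8]
  · rw [d5 X Y hXY hY, aa 0 (by omega), a3]
    congr 1
    unfold shiftAmount
    rw [hcount, hcount]
    by_cases hX : X = A
    · have hYA : Y ≠ A := by omega
      simp only [hX, hYA, true_and, false_and, if_false, if_true]
      split_ifs with h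
      · rfl
      · rw [hzero _ h]
    · by_cases hYA : Y = A
      · simp only [hX, hYA, true_and, false_and, if_false, if_true]
        split_ifs with h
        · rfl
        · rw [hzero _ h]
      · simp [hX, hYA]
  · have : m₃.writes = m.writes := c5.trans w1
    rw [← this]
    exact d6
  · have s1 := Prog.steps_loop_le 12 countBody m₁ countBody_flat
    have s2 := Prog.steps_loop_le 12 (applyBody o) m₃ (applyBody_flat o)
    rw [r12] at s1
    rw [r12'] at s2
    -- The factor `31` is `(1 + 6) + (1 + 23)`: one round of each loop per neighbor, with the loop's
    -- own charge.
    have l1 : countBody.len = 6 := rfl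
    have l2 : (applyBody o).len = 23 := rfl
    rw [l1] at s1
    rw [l2] at s2
    have : (shift o).steps m = 1 + (1 + (1 + ((Prog.loop 12 countBody).steps m₁ +
      (1 + ((Prog.loop 12 (applyBody o)).steps m₃ + 0))))) := rfl
    rw [this]
    omega

/-! ### Graphs and weights in terms of codes -/

section Graph

variable {n : ℕ}

open Classical in
/-- The neighbors of `x`, as natural numbers. -/
noncomputable def nb (G : SimpleGraph (Fin n)) (x : ℕ) : Finset ℕ :=
  (Finset.range n).filter fun y => ∃ (hx : x < n) (hy : y < n), G.Adj ⟨x, hx⟩ ⟨y, hy⟩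

theorem nb_subset (G : SimpleGraph (Fin n)) (x : ℕ) : nb G x ⊆ Finset.range n := by
  classical exact Finset.filter_subset _ _

theorem mem_nb {G : SimpleGraph (Fin n)} {x y : ℕ} :
    y ∈ nb G x ↔ ∃ (hx : x < n) (hy : y < n), G.Adj ⟨x, hx⟩ ⟨y, hy⟩ := by
  simp only [nb, Finset.mem_filter, Finset.mem_range, and_iff_right_iff_imp]
  exact fun ⟨_, h, _⟩ => h

theorem mem_nb_fin {G : SimpleGraph (Fin n)} {x y : Fin n} : (y : ℕ) ∈ nb G x ↔ G.Adj x y := by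
  simp [mem_nb]

theorem notMem_nb_self {G : SimpleGraph (Fin n)} {x : ℕ} : x ∉ nb G x := by
  rw [mem_nb]
  rintro ⟨_, _, h⟩
  exact h.ne rfl

open Classical in
theorem nb_eq_map (G : SimpleGraph (Fin n)) (x : Fin n) :
    nb G x = (G.neighborFinset x).map Fin.valEmbedding := by
  ext y
  simp only [Finset.mem_map, SimpleGraph.mem_neighborFinset, Fin.valEmbedding_apply]
  constructor
  · intro h
    obtain ⟨_, hy, h⟩ := mem_nb.1 h
    exact ⟨⟨y, hy⟩, h, rfl⟩
  · rintro ⟨y, h, rfl⟩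
    exact mem_nb_fin.2 h

open Classical in
theorem card_nb (G : SimpleGraph (Fin n)) (x : Fin n) : (nb G x).card = G.degree x := by
  rw [nb_eq_map, Finset.card_map, SimpleGraph.card_neighborFinset_eq_degree]

open Classical in
/-- The number of edges between vertices with codes `X + 1` and `Y + 1`. -/
noncomputable def wt (G : SimpleGraph (Fin n)) (γ : ℕ → ℕ) (X Y : ℕ) : ℕ :=
  (Finset.univ.filter fun q : Fin n × Fin n =>
    G.Adj q.1 q.2 ∧ γ q.1 = X + 1 ∧ γ q.2 = Y + 1).card

/-- Counting all ordered pairs is crude, but `n ^ 2` leaves room below the machine bound `(n + 1) ^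
2` for adding up to `n` edges at once. -/
theorem wt_le (G : SimpleGraph (Fin n)) (γ : ℕ → ℕ) (X Y : ℕ) : wt G γ X Y ≤ n ^ 2 := by
  classical exact (Finset.card_filter_le _ _).trans (by simp [sq])

/-- `H'` arises from `H` by inserting the edge `uv`. -/
structure AddEdge (H H' : SimpleGraph (Fin n)) (u v : Fin n) : Prop where
  ne : u ≠ v
  not : ¬ H.Adj u v
  adj : ∀ x y, H'.Adj x y ↔ H.Adj x y ∨ (x = u ∧ y = v) ∨ (x = v ∧ y = u)

variable {H H' : SimpleGraph (Fin n)} {u v : Fin n}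

theorem AddEdge.symm (h : AddEdge H H' u v) : AddEdge H H' v u :=
  ⟨h.ne.symm, fun h' => h.not h'.symm, fun x y => by rw [h.adj]; tauto⟩

theorem AddEdge.nb_left (h : AddEdge H H' u v) : nb H' u = insert (v : ℕ) (nb H u) := by
  ext y
  simp only [Finset.mem_insert, mem_nb, h.adj, Fin.is_lt, exists_true_left]
  constructor
  · rintro ⟨hy, h1 | ⟨_, h1⟩ | ⟨h1, _⟩⟩
    · exact .inr ⟨hy, h1⟩
    · exact .inl (congrArg Fin.val h1)
    · exact absurd h1 h.ne
  · rintro (rfl | ⟨hy, h1⟩)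
    · exact ⟨v.2, by simp⟩
    · exact ⟨hy, .inl h1⟩

theorem AddEdge.notMem (h : AddEdge H H' u v) : (v : ℕ) ∉ nb H u := fun h' => h.not (mem_nb_fin.1 h')

theorem AddEdge.nb_erase (h : AddEdge H H' u v) : nb H u = (nb H' u).erase v := by
  rw [h.nb_left, Finset.erase_insert h.notMem]

theorem AddEdge.nb_of_ne (h : AddEdge H H' u v) {x : ℕ} (hu : x ≠ u) (hv : x ≠ v) :
    nb H' x = nb H x := by
  ext y
  simp only [mem_nb, h.adj]
  constructor
  · rintro ⟨hx, hy, h1 | ⟨h1, _⟩ | ⟨h1, _⟩⟩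
    · exact ⟨hx, hy, h1⟩
    · exact absurd (congrArg Fin.val h1) hu
    · exact absurd (congrArg Fin.val h1) hv
  · rintro ⟨hx, hy, h1⟩
    exact ⟨hx, hy, .inl h1⟩

/-- The weight counts oriented edges. As `X ≠ Y`, at most one of the two orientations of the new
edge has its ends coded in the right order, so the edge counts once. -/
theorem AddEdge.wt_eq (h : AddEdge H H' u v) (γ : ℕ → ℕ) {X Y : ℕ} (hXY : X ≠ Y) :
    wt H' γ X Y = wt H γ X Y +
      if (γ u = X + 1 ∧ γ v = Y + 1) ∨ (γ v = X + 1 ∧ γ u = Y + 1) then 1 else 0 := by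
  classical
  have hne : (u, v) ≠ (v, u) := fun h' => h.ne (congrArg Prod.fst h')
  have key : (Finset.univ.filter fun q : Fin n × Fin n =>
      H'.Adj q.1 q.2 ∧ γ q.1 = X + 1 ∧ γ q.2 = Y + 1) =
      (Finset.univ.filter fun q : Fin n × Fin n =>
        H.Adj q.1 q.2 ∧ γ q.1 = X + 1 ∧ γ q.2 = Y + 1) ∪
      (({(u, v), (v, u)} : Finset (Fin n × Fin n)).filter fun q =>
        γ q.1 = X + 1 ∧ γ q.2 = Y + 1) := by
    ext ⟨a, b⟩
    simp only [Finset.mem_filter, Finset.mem_univ, true_and, h.adj, Finset.mem_union,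
      Finset.mem_insert, Finset.mem_singleton, Prod.mk.injEq]
    tauto
  have hdisj : Disjoint (Finset.univ.filter fun q : Fin n × Fin n =>
        H.Adj q.1 q.2 ∧ γ q.1 = X + 1 ∧ γ q.2 = Y + 1)
      (({(u, v), (v, u)} : Finset (Fin n × Fin n)).filter fun q =>
        γ q.1 = X + 1 ∧ γ q.2 = Y + 1) := by
    rw [Finset.disjoint_left]
    rintro ⟨a, b⟩ h1 h2
    simp only [Finset.mem_filter, Finset.mem_insert, Finset.mem_singleton, Prod.mk.injEq] at h1 h2
    rcases h2.1 with ⟨rfl, rfl⟩ | ⟨rfl, rfl⟩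
    · exact h.not h1.2.1
    · exact h.not h1.2.1.symm
  have hw : wt H' γ X Y = wt H γ X Y + (({(u, v), (v, u)} : Finset (Fin n × Fin n)).filter fun q =>
        γ q.1 = X + 1 ∧ γ q.2 = Y + 1).card := by
    unfold wt
    rw [← Finset.card_union_of_disjoint hdisj, ← key]
  rw [hw]
  congr 1
  rw [Finset.filter_insert, Finset.filter_singleton]
  simp only
  by_cases h1 : γ u = X + 1 ∧ γ v = Y + 1
  · have h2 : ¬ (γ v = X + 1 ∧ γ u = Y + 1) := by omega
    simp [h1, hXY.symm]
  · by_cases h2 : γ v = X + 1 ∧ γ u = Y + 1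
    · simp [h2, hXY.symm]
    · simp [h1, h2]

/-- The number of edges at `u` that are mapped to `XY` when `u` is contracted into `A`. -/
noncomputable def amount (G : SimpleGraph (Fin n)) (γ : ℕ → ℕ) (u A X Y : ℕ) : ℕ :=
  if X = A then ((nb G u).filter fun z => γ z = Y + 1).card
  else if Y = A then ((nb G u).filter fun z => γ z = X + 1).card else 0

/-- Giving `u` the code zero removes from the count exactly the pairs that involve `u`. As `X ≠ Y`,
a vertex coded `A + 1` can only be on the side of `A`, and such a pair is then determined by its
other end. -/
theorem wt_eq_add_amount (G : SimpleGraph (Fin n)) (γ : ℕ → ℕ) (u : Fin n) {A X Y : ℕ}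
    (hXY : X ≠ Y) (hA : γ u = A + 1) :
    wt G γ X Y = wt G (Function.update γ u 0) X Y + amount G γ u A X Y := by
  classical
  set U := Finset.univ.filter fun q : Fin n × Fin n =>
      G.Adj q.1 q.2 ∧ γ q.1 = X + 1 ∧ γ q.2 = Y + 1 with hU
  have hsplit := Finset.card_filter_add_card_filter_not (s := U)
    (fun q => q.1 ≠ u ∧ q.2 ≠ u)
  have h1 : U.filter (fun q => q.1 ≠ u ∧ q.2 ≠ u) = Finset.univ.filter fun q : Fin n × Fin n =>
      G.Adj q.1 q.2 ∧ Function.update γ u 0 q.1 = X + 1 ∧ Function.update γ u 0 q.2 = Y + 1 := by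
    ext ⟨a, b⟩
    simp only [hU, Finset.mem_filter, Finset.mem_univ, true_and, Function.update_apply, Fin.val_inj]
    by_cases ha : a = u <;> by_cases hb : b = u <;> simp [ha, hb]
  have h2 : (U.filter (fun q => ¬ (q.1 ≠ u ∧ q.2 ≠ u))).card = amount G γ u A X Y := by
    unfold amount
    split_ifs with hX hY
    · refine Finset.card_bij (fun q _ => (q.2 : ℕ)) ?_ ?_ ?_
      · rintro ⟨a, b⟩ hq
        simp only [hU, Finset.mem_filter, Finset.mem_univ, true_and] at hq ⊢
        obtain ⟨⟨q1, q2, q3⟩, q4⟩ := hq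
        by_cases hau : a = u
        · subst hau
          exact ⟨mem_nb_fin.2 q1, q3⟩
        · have : b = u := by tauto
          subst this
          omega
      · rintro ⟨a, b⟩ hq ⟨a', b'⟩ hq' hbb
        simp only [hU, Finset.mem_filter, Finset.mem_univ, true_and] at hq hq' hbb
        have hb : b ≠ u := by rintro rfl; omega
        have hb' : b' ≠ u := by rintro rfl; omega
        have ha : a = u := by tauto
        have ha' : a' = u := by tauto
        rw [ha, ha', Fin.val_injective hbb]
      · intro z hz
        obtain ⟨hz1, hz2⟩ := Finset.mem_filter.1 hz
        obtain ⟨_, hzn, hadj⟩ := mem_nb.1 hz1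
        exact ⟨(u, ⟨z, hzn⟩), by simp [hU, hadj, hA, hX, hz2], rfl⟩
    · refine Finset.card_bij (fun q _ => (q.1 : ℕ)) ?_ ?_ ?_
      · rintro ⟨a, b⟩ hq
        simp only [hU, Finset.mem_filter, Finset.mem_univ, true_and] at hq ⊢
        obtain ⟨⟨q1, q2, q3⟩, q4⟩ := hq
        by_cases hau : b = u
        · subst hau
          exact ⟨mem_nb_fin.2 q1.symm, q2⟩
        · have : a = u := by tauto
          subst this
          omega
      · rintro ⟨a, b⟩ hq ⟨a', b'⟩ hq' hbb
        simp only [hU, Finset.mem_filter, Finset.mem_univ, true_and] at hq hq' hbb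
        have hb : a ≠ u := by rintro rfl; omega
        have hb' : a' ≠ u := by rintro rfl; omega
        have ha : b = u := by tauto
        have ha' : b' = u := by tauto
        rw [ha, ha', Fin.val_injective hbb]
      · intro z hz
        obtain ⟨hz1, hz2⟩ := Finset.mem_filter.1 hz
        obtain ⟨_, hzn, hadj⟩ := mem_nb.1 hz1
        exact ⟨(⟨z, hzn⟩, u), by simp [hU, hadj.symm, hA, hY, hz2], rfl⟩
    · rw [Finset.card_eq_zero, Finset.filter_eq_empty_iff]
      rintro ⟨a, b⟩ hq
      simp only [hU, Finset.mem_filter, Finset.mem_univ, true_and] at hq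
      simp only [not_not]
      constructor
      · rintro rfl; omega
      · rintro rfl; omega
  rw [h1, h2] at hsplit
  unfold wt
  rw [hsplit]

end Graph

/-! ### The update program -/

/-- Registers `3`, `4`, `5` hold `n`, `1`, `0`, and all numbers are at most `(n + 1) ^ 2`. -/
structure Base (n : ℕ) (m : Mem) : Prop where
  ok : m.Ok ((n + 1) ^ 2)
  r3 : m.reg 3 = n
  r4 : m.reg 4 = 1
  r5 : m.reg 5 = 0

theorem Base.of_eq {n : ℕ} {m m' : Mem} (h : Base n m) (hok : m'.Ok ((n + 1) ^ 2))
    (hr : ∀ r, r < 6 → m'.reg r = m.reg r) : Base n m' :=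
  ⟨hok, by rw [hr 3 (by omega), h.r3], by rw [hr 4 (by omega), h.r4], by rw [hr 5 (by omega), h.r5]⟩

/-- `shift`, unless register `6` holds zero. -/
def shiftIf (o : ArithOp) : Prog := .ifLt 5 6 (shift o) .skip

/-- Removal and addition of the edges at `u` share this statement: `w` is the weight table to be
reached, and the two hypotheses on it relate it to the present table according to whether `u` is
mapped. -/
theorem shiftIf_spec (o : ArithOp) (ho : ∀ w, o.eval w 0 = w) {n : ℕ} {G : SimpleGraph (Fin n)}
    {u : Fin n} {m : Mem} (hb : Base n m) (h0 : m.reg 0 = u) (h6 : m.reg 6 = m.arr 1 u)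
    (hrow : RowRep n m.arr 2 u (nb G u)) (hγ : ∀ z < n, m.arr 1 z ≤ n) (h8 : ∀ y, m.arr 8 y = 0)
    {w : ℕ → ℕ → ℕ}
    (hle : ∀ X Y c, X < Y → Y < n → c ≤ n → o.eval (m.arr 0 (X * n + Y)) c ≤ (n + 1) ^ 2)
    (hw0 : m.arr 1 u = 0 → ∀ X Y, X < Y → Y < n → m.arr 0 (X * n + Y) = w X Y)
    (hw : ∀ A, m.arr 1 u = A + 1 → ∀ X Y, X < Y → Y < n →
      o.eval (m.arr 0 (X * n + Y)) (amount G (m.arr 1) u A X Y) = w X Y) :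
    let m' := (shiftIf o).run m
    (shiftIf o).Safe ((n + 1) ^ 2) m ∧
    (∀ r, r < 6 ∨ 17 < r → m'.reg r = m.reg r) ∧
    (∀ a, a ≠ 0 → m'.arr a = m.arr a) ∧
    (∀ X Y, X < Y → Y < n → m'.arr 0 (X * n + Y) = w X Y) ∧
    m'.writes ≤ m.writes + (((nb G u).image (m.arr 1)).erase 0).card ∧
    (shiftIf o).steps m ≤ 7 + 31 * (nb G u).card := by
  intro m'
  by_cases hc : m.reg 5 < m.reg 6
  · have hrun : m' = (shift o).run m := if_pos hc
    rw [hb.r5, h6] at hc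
    obtain ⟨A, hA⟩ : ∃ A, m.arr 1 u = A + 1 := ⟨m.arr 1 u - 1, by omega⟩
    have hAn : A < n := by have := hγ u u.2; omega
    obtain ⟨g1, g2, g3, g4, g5, g6⟩ := shift_spec o ho (n := n) (A := A) (S := nb G u) hb.ok
      (by rw [h0]; exact u.2) hb.r3 hb.r4 hb.r5 (by rw [h6, hA]) hAn (nb_subset _ _)
      (by rwa [h0]) hγ h8 hle
    rw [hrun]
    refine ⟨⟨fun _ => g1, fun _ => trivial⟩, g2, g3, fun X Y hXY hY => ?_, g5, ?_⟩
    · rw [g4 X Y hXY hY, ← hw A hA X Y hXY hY]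
      rfl
    · simp only [shiftIf, Prog.steps]
      split_ifs <;> omega
  · have hrun : m' = m := if_neg hc
    rw [hrun]
    have hz : m.arr 1 u = 0 := by rw [hb.r5, h6] at hc; omega
    refine ⟨⟨fun h => absurd h hc, fun _ => trivial⟩, fun _ _ => rfl, fun _ _ => rfl, hw0 hz,
      by omega, ?_⟩
    simp only [shiftIf, Prog.steps, if_neg hc]
    omega

/-- Contract the vertex in register `0` anew, into the vertex with the code in register `21`. -/
def recontract : Prog := .block [
  .load 6 1 0,
  shiftIf .sub,
  .store 1 0 21,
  .arith .add 6 21 5,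
  shiftIf .add]

/-- The intermediate state is the contraction in which `u` is unmapped: its edges are first
subtracted under the old code, exactly and without truncation by `wt_eq_add_amount`, and then added
under the new one. As `u` is not its own neighbor, both passes see the same neighbor codes, whence
the factor two in the writes. -/
theorem recontract_spec {n : ℕ} {G : SimpleGraph (Fin n)} {u : Fin n} {m : Mem} (hb : Base n m)
    (h0 : m.reg 0 = u) (hrow : RowRep n m.arr 2 u (nb G u)) (hγ : ∀ z < n, m.arr 1 z ≤ n)
    (h8 : ∀ y, m.arr 8 y = 0) (h21 : m.reg 21 ≤ n)
    (hw : ∀ X Y, X < Y → Y < n → m.arr 0 (X * n + Y) = wt G (m.arr 1) X Y) :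
    let m' := recontract.run m
    recontract.Safe ((n + 1) ^ 2) m ∧
    (∀ r, r < 6 ∨ 17 < r → m'.reg r = m.reg r) ∧
    m'.arr 1 = Function.update (m.arr 1) u (m.reg 21) ∧
    (∀ a, a ≠ 0 → a ≠ 1 → m'.arr a = m.arr a) ∧
    (∀ X Y, X < Y → Y < n → m'.arr 0 (X * n + Y) = wt G (m'.arr 1) X Y) ∧
    m'.writes ≤ m.writes + 2 * (((nb G u).image (m.arr 1)).erase 0).card ∧
    recontract.steps m ≤ 17 + 62 * (nb G u).card := by
  intro m'
  have b3 : n ≤ (n + 1) ^ 2 := by nlinarith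
  set m₁ := (Prog.load 6 1 0).run m with hm₁
  have r1 : ∀ r, r ≠ 6 → m₁.reg r = m.reg r := fun r hr => by simp [hm₁, Prog.run, hr]
  have a1 : m₁.arr = m.arr := rfl
  have hok1 : m₁.Ok ((n + 1) ^ 2) := hb.ok.run (P := .load 6 1 0) trivial
  have hb1 : Base n m₁ := hb.of_eq hok1 fun r hr => r1 r (by omega)
  obtain ⟨c1, c2, c3, c4, c5, c6⟩ := shiftIf_spec .sub (fun w => rfl) (G := G) (u := u)
    (w := wt G (Function.update (m.arr 1) u 0)) hb1 (by rw [r1 0 (by omega), h0])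
    (by simp [hm₁, Prog.run, h0]) hrow hγ h8
    (fun X Y c hXY hY _ => (Nat.sub_le _ _).trans (hb.ok.2 _ _))
    (fun hz X Y hXY hY => by
      rw [a1] at hz
      rw [a1, hw X Y hXY hY, ← hz, Function.update_eq_self])
    (fun A hA X Y hXY hY => by
      change _ - _ = _
      rw [a1] at hA ⊢
      rw [hw X Y hXY hY, wt_eq_add_amount G _ u hXY.ne hA, Nat.add_sub_cancel])
  set m₂ := (shiftIf .sub).run m₁ with hm₂
  have hok2 : m₂.Ok ((n + 1) ^ 2) := hok1.run c1
  set m₃ := (Prog.block [.store 1 0 21, .arith .add 6 21 5]).run m₂ with hm₃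
  have r2 : ∀ r, r < 6 ∨ 17 < r → m₂.reg r = m.reg r := fun r hr => by
    rw [c2 r hr, r1 r (by omega)]
  have r3 : ∀ r, r < 6 ∨ 17 < r → m₃.reg r = m.reg r := fun r hr => by
    rw [← r2 r hr]
    have : r ≠ 6 := by omega
    simp [hm₃, Prog.block, Prog.run, this]
  have e5 : m₂.reg 5 = 0 := by rw [r2 5 (by omega), hb.r5]
  have e0 : m₂.reg 0 = u := by rw [r2 0 (by omega), h0]
  have e21 : m₂.reg 21 = m.reg 21 := r2 21 (by omega)
  have safe3 : (Prog.block [.store 1 0 21, .arith .add 6 21 5]).Safe ((n + 1) ^ 2) m₂ := by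
    simp [Prog.block, Prog.run, Prog.Safe, ArithOp.eval, e5, e21]
    omega
  have hok3 : m₃.Ok ((n + 1) ^ 2) := hok2.run safe3
  have a3 : ∀ a, a ≠ 0 → a ≠ 1 → m₃.arr a = m.arr a := fun a ha ha' => by
    rw [← a1, ← c3 a ha]
    simp [hm₃, Prog.block, Prog.run, ha']
  have a30 : m₃.arr 0 = m₂.arr 0 := by simp [hm₃, Prog.block, Prog.run]
  have a31 : m₃.arr 1 = Function.update (m.arr 1) u (m.reg 21) := by
    rw [← a1, ← c3 1 (by omega)]
    simp [hm₃, Prog.block, Prog.run, e0, e21]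
  have hb3 : Base n m₃ := hb.of_eq hok3 fun r hr => r3 r (by omega)
  have hupd : Function.update (m₃.arr 1) u 0 = Function.update (m.arr 1) u 0 := by
    rw [a31, Function.update_idem]
  obtain ⟨d1, d2, d3, d4, d5, d6⟩ := shiftIf_spec .add (fun w => rfl) (G := G) (u := u)
    (w := wt G (m₃.arr 1)) hb3 (by rw [r3 0 (by omega), h0])
    (by
      rw [a31]
      simp [hm₃, Prog.block, Prog.run, ArithOp.eval, e5, e21])
    (hrow.congr (a3 2 (by omega) (by omega)) (a3 3 (by omega) (by omega))
      (a3 4 (by omega) (by omega)))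
    (fun z hz => by
      rw [a31]
      by_cases hzu : z = u
      · simpa [hzu] using h21
      · simpa [hzu] using hγ z hz)
    (by rw [a3 8 (by omega) (by omega)]; exact h8)
    (fun X Y c hXY hY hc => by
      change _ + _ ≤ _
      rw [a30, c4 X Y hXY hY]
      have := wt_le G (Function.update (m.arr 1) u 0) X Y
      nlinarith)
    (fun hz X Y hXY hY => by
      rw [a30, c4 X Y hXY hY, ← hupd, ← hz, Function.update_eq_self])
    (fun A hA X Y hXY hY => by
      change _ + _ = _
      rw [a30, c4 X Y hXY hY, ← hupd, wt_eq_add_amount G _ u hXY.ne hA])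
  have hm' : m' = (shiftIf .add).run m₃ := rfl
  rw [hm']
  have himg : (nb G u).image (m₃.arr 1) = (nb G u).image (m.arr 1) := by
    apply Finset.image_congr
    intro z hz
    have : z ≠ u := by
      rintro rfl
      exact notMem_nb_self hz
    rw [a31, Function.update_of_ne this]
  have w3 : m₃.writes = m₂.writes := by simp [hm₃, Prog.block, Prog.run]
  refine ⟨⟨trivial, c1, trivial, safe3.2.1, d1, trivial⟩, fun r hr => by rw [d2 r hr, r3 r hr],
    by rw [d3 1 (by omega), a31], fun a ha ha' => by rw [d3 a ha, a3 a ha ha'],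
    fun X Y hXY hY => by rw [d4 X Y hXY hY, d3 1 (by omega)], ?_, ?_⟩
  · rw [himg, w3] at d5
    rw [a1] at c5
    have : m₁.writes = m.writes := rfl
    omega
  · have : recontract.steps m = 1 + ((shiftIf .sub).steps m₁ + (1 + (1 +
      ((shiftIf .add).steps m₃ + 0)))) := rfl
    omega

/-- Change by one the weight of the pair to which the edge between the vertices in registers `0` and
`1` is mapped, if it is mapped. -/
def countEdge (o : ArithOp) : Prog := .block [
  .load 6 1 0,
  .load 7 1 1,
  .arith .add 11 4 5,
  .ifLt 5 6 (.ifLt 5 7 (bump o) .skip) .skip]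

/-- The write is bounded by zero when the first end is unmapped, not just by one. Thus a write
occurs only if there is a center, and it can be charged to the number of centers. -/
theorem countEdge_spec (o : ArithOp) (ho : ∀ w, o.eval w 0 = w) {n : ℕ} {u v : ℕ} {m : Mem}
    (hb : Base n m) (h0 : m.reg 0 = u) (h1 : m.reg 1 = v) (hu : m.arr 1 u ≤ n)
    (hv : m.arr 1 v ≤ n)
    (hle : ∀ X Y, X < Y → Y < n → o.eval (m.arr 0 (X * n + Y)) 1 ≤ (n + 1) ^ 2) :
    let m' := (countEdge o).run m
    (countEdge o).Safe ((n + 1) ^ 2) m ∧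
    Frame (· = 0) m m' ∧
    (∀ X Y, X < Y → Y < n → m'.arr 0 (X * n + Y) = o.eval (m.arr 0 (X * n + Y))
      (if (m.arr 1 u = X + 1 ∧ m.arr 1 v = Y + 1) ∨ (m.arr 1 v = X + 1 ∧ m.arr 1 u = Y + 1)
        then 1 else 0)) ∧
    m'.writes ≤ m.writes + if m.arr 1 u = 0 then 0 else 1 := by
  intro m'
  set m₁ := (Prog.block [.load 6 1 0, .load 7 1 1, .arith .add 11 4 5]).run m with hm₁
  have r6 : m₁.reg 6 = m.arr 1 u := by simp [hm₁, Prog.block, Prog.run, h0]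
  have r7 : m₁.reg 7 = m.arr 1 v := by simp [hm₁, Prog.block, Prog.run, h1]
  have r11 : m₁.reg 11 = 1 := by simp [hm₁, Prog.block, Prog.run, ArithOp.eval, hb.r4, hb.r5]
  have rr : ∀ r, r < 6 ∨ (7 < r ∧ r < 11) ∨ 11 < r → m₁.reg r = m.reg r := by
    intro r hr
    have f1 : r ≠ 6 := by omega
    have f2 : r ≠ 7 := by omega
    have f3 : r ≠ 11 := by omega
    simp [hm₁, Prog.block, Prog.run, f1, f2, f3]
  have safe1 : (Prog.arith .add 11 4 5).Safe ((n + 1) ^ 2)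
      ((Prog.load 7 1 1).run ((Prog.load 6 1 0).run m)) := by
    simp [Prog.run, Prog.Safe, ArithOp.eval, hb.r4, hb.r5]
    nlinarith
  set Q : Prog := .ifLt 5 6 (.ifLt 5 7 (bump o) .skip) .skip with hQ
  have hm' : m' = Q.run m₁ := rfl
  have r5 : m₁.reg 5 = 0 := by rw [rr 5 (by omega), hb.r5]
  by_cases hc : m.arr 1 u ≠ 0 ∧ m.arr 1 v ≠ 0
  · obtain ⟨A, hA⟩ : ∃ A, m.arr 1 u = A + 1 := ⟨m.arr 1 u - 1, by omega⟩
    obtain ⟨B, hB⟩ : ∃ B, m.arr 1 v = B + 1 := ⟨m.arr 1 v - 1, by omega⟩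
    have i1 : m₁.reg 5 < m₁.reg 6 := by omega
    have i2 : m₁.reg 5 < m₁.reg 7 := by omega
    have hrun : m' = (bump o).run m₁ := (if_pos i1).trans (if_pos i2)
    obtain ⟨g1, g2, g3, g4, g5⟩ := bump_spec o (n := n) (A := A) (B := B) (m := m₁)
      (by rw [rr 3 (by omega), hb.r3]) (by rw [rr 4 (by omega), hb.r4]) (by omega) (by omega)
      (by omega) (by omega) (fun hAB => by
        rw [r11]
        exact hle _ _ (by omega) (by omega))
    rw [hrun]
    refine ⟨⟨trivial, trivial, safe1, ⟨fun _ => ⟨fun _ => g1, fun _ => trivial⟩, fun _ => trivial⟩,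
      trivial⟩, ⟨fun r hr => by rw [g2 r (by omega), rr r (by omega)], fun a ha => g3 a ha⟩,
      fun X Y hXY hY => ?_, ?_⟩
    · rw [g4, r11]
      have ha : m₁.arr 0 = m.arr 0 := rfl
      rw [ha]
      by_cases hcond : A ≠ B ∧ X * n + Y = min A B * n + max A B
      · rw [if_pos hcond, if_pos]
        obtain ⟨q1, q2⟩ := addr_inj hY (by omega) hcond.2
        rcases lt_or_gt_of_ne hcond.1 with h | h
        · left; omega
        · right; omega
      · rw [if_neg hcond, if_neg, ho]
        rintro (⟨q1, q2⟩ | ⟨q1, q2⟩)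
        · have e1 : A = X := by omega
          have e2 : B = Y := by omega
          subst e1 e2
          exact hcond ⟨by omega, by rw [min_eq_left hXY.le, max_eq_right hXY.le]⟩
        · have e1 : B = X := by omega
          have e2 : A = Y := by omega
          subst e1 e2
          exact hcond ⟨by omega, by rw [min_eq_right hXY.le, max_eq_left hXY.le]⟩
    · rw [if_neg hc.1]
      exact g5
  · have hrun : m' = m₁ := by
      rw [hm', hQ]
      simp only [Prog.run]
      split_ifs with i1 i2
      · exfalso; omega
      · rfl
      · rfl
    rw [hrun]
    refine ⟨⟨trivial, trivial, safe1, ⟨fun i1 => ⟨fun i2 => ?_, fun _ => trivial⟩,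
      fun _ => trivial⟩, trivial⟩, ⟨fun r hr => rr r (by omega), fun a _ => rfl⟩,
      fun X Y hXY hY => ?_, ?_⟩
    · have i1 : m₁.reg 5 < m₁.reg 6 := i1
      have i2 : m₁.reg 5 < m₁.reg 7 := i2
      exfalso; omega
    · rw [if_neg (by omega), ho]
      rfl
    · have : m₁.writes = m.writes := rfl
      omega

/-- The arrays represent the graph, the flags of centers, the map and its weights. -/
structure Rep {n : ℕ} (G : SimpleGraph (Fin n)) (A : ℕ → ℕ → ℕ) : Prop where
  wts : ∀ X Y, X < Y → Y < n → A 0 (X * n + Y) = wt G (A 1) X Y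
  adj : ∀ x < n, RowRep n A 2 x (nb G x)
  flag : ∀ x < n, A 9 x = if A 1 x = x + 1 then 1 else 0
  code : ∀ x < n, ∀ y, A 1 x = y + 1 → y < n ∧ A 9 y = 1
  cnt : ∀ y, A 8 y = 0

theorem Rep.code_le {n : ℕ} {G : SimpleGraph (Fin n)} {A : ℕ → ℕ → ℕ} (h : Rep G A) {x : ℕ}
    (hx : x < n) : A 1 x ≤ n := by
  by_contra hc
  have := (h.code x hx (A 1 x - 1) (by omega)).1
  omega

/-! ### Inserting and deleting an edge in the stored graph -/

def insertEdge : Prog := .block [countEdge .add, rowInsert 2 0 1, rowInsert 2 1 0]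

def deleteEdge : Prog := .block [countEdge .sub, rowDelete 2 0 1, rowDelete 2 1 0]

/-- The arrays of the adjacency lists and the weights. -/
def EdgeArr (a : ℕ) : Prop := a = 0 ∨ a = 2 ∨ a = 3 ∨ a = 4

theorem insertEdge_spec {n : ℕ} {G G' : SimpleGraph (Fin n)} {u v : Fin n} {m : Mem}
    (hG : AddEdge G G' u v) (hb : Base n m) (hR : Rep G m.arr) (h0 : m.reg 0 = u)
    (h1 : m.reg 1 = v) :
    insertEdge.Safe ((n + 1) ^ 2) m ∧ Frame EdgeArr m (insertEdge.run m) ∧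
    Rep G' (insertEdge.run m).arr ∧
    (insertEdge.run m).writes ≤ m.writes + if m.arr 1 u = 0 then 0 else 1 := by
  obtain ⟨c1, c2, c3, c4⟩ := countEdge_spec .add (fun _ => rfl) hb h0 h1 (hR.code_le u.2)
    (hR.code_le v.2) (fun X Y hXY hY => by
      change _ + _ ≤ _
      rw [hR.wts X Y hXY hY]
      have := wt_le G (m.arr 1) X Y
      nlinarith)
  set m₁ := (countEdge .add).run m with hm₁
  have hok1 : m₁.Ok ((n + 1) ^ 2) := hb.ok.run c1
  have hb1 : Base n m₁ := hb.of_eq hok1 fun r hr => c2.reg r (by omega)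
  have row1 : ∀ x < n, RowRep n m₁.arr 2 x (nb G x) := fun x hx =>
    (hR.adj x hx).congr (c2.arr 2 (by omega)) (c2.arr 3 (by omega)) (c2.arr 4 (by omega))
  have e0 : m₁.reg 0 = u := by rw [c2.reg 0 (by omega), h0]
  have e1 : m₁.reg 1 = v := by rw [c2.reg 1 (by omega), h1]
  obtain ⟨d1, d2, d3, d4, d5⟩ := rowInsert_spec (n := n) (k := 2) (x := 0) (y := 1) (m := m₁)
    (by omega) (by omega) (by omega) hb1.r3 hb1.r4 (by rw [e0]; exact u.2) (by rw [e1]; exact v.2)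
    (nb_subset G u) (by rw [e0]; exact row1 u u.2) (by rw [e1]; exact hG.notMem)
  set m₂ := (rowInsert 2 0 1).run m₁ with hm₂
  have hok2 : m₂.Ok ((n + 1) ^ 2) := hok1.run d1
  have hb2 : Base n m₂ := hb1.of_eq hok2 fun r hr => d4.reg r (by omega)
  have f0 : m₂.reg 0 = u := by rw [d4.reg 0 (by omega), e0]
  have f1 : m₂.reg 1 = v := by rw [d4.reg 1 (by omega), e1]
  have hne : (v : ℕ) ≠ u := fun h => hG.ne (Fin.val_injective h).symm
  rw [e0] at d2 d3
  rw [e1] at d2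
  obtain ⟨g1, g2, g3, g4, g5⟩ := rowInsert_spec (n := n) (k := 2) (x := 1) (y := 0) (m := m₂)
    (by omega) (by omega) (by omega) hb2.r3 hb2.r4 (by rw [f1]; exact v.2) (by rw [f0]; exact u.2)
    (nb_subset G v) (by rw [f1]; exact d3 v _ hne (nb_subset _ _) (row1 v v.2))
    (by rw [f0]; exact hG.symm.notMem)
  set m₃ := (rowInsert 2 1 0).run m₂ with hm₃
  have hm' : insertEdge.run m = m₃ := rfl
  rw [f1] at g2 g3
  rw [f0] at g2
  have hf := (c2.trans d4).trans g4
  have ha : ∀ a, a ≠ 0 → a ≠ 2 → a ≠ 3 → a ≠ 4 → m₃.arr a = m.arr a := fun a _ _ _ _ =>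
    hf.arr a (by omega)
  rw [hm']
  refine ⟨⟨c1, d1, g1, trivial⟩, ⟨hf.reg, fun a ha => hf.arr a (by unfold EdgeArr at ha; omega)⟩,
    ⟨fun X Y hXY hY => ?_, fun x hx => ?_, ?_, ?_, ?_⟩, ?_⟩
  · rw [g4.arr 0 (by omega), d4.arr 0 (by omega), ha 1 (by omega) (by omega) (by omega) (by omega),
      c3 X Y hXY hY, hR.wts X Y hXY hY, hG.wt_eq _ hXY.ne]
    rfl
  · by_cases hxv : x = v
    · rw [hxv, hG.symm.nb_left]
      exact g2
    · refine g3 x _ hxv (nb_subset _ _) ?_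
      by_cases hxu : x = u
      · rw [hxu, hG.nb_left]
        exact d2
      · rw [hG.nb_of_ne hxu hxv]
        exact d3 x _ hxu (nb_subset _ _) (row1 x hx)
  · rw [ha 9 (by omega) (by omega) (by omega) (by omega),
      ha 1 (by omega) (by omega) (by omega) (by omega)]
    exact hR.flag
  · rw [ha 9 (by omega) (by omega) (by omega) (by omega),
      ha 1 (by omega) (by omega) (by omega) (by omega)]
    exact hR.code
  · rw [ha 8 (by omega) (by omega) (by omega) (by omega)]
    exact hR.cnt
  · rw [g5, d5]
    exact c4

theorem deleteEdge_spec {n : ℕ} {G G' : SimpleGraph (Fin n)} {u v : Fin n} {m : Mem}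
    (hG : AddEdge G' G u v) (hb : Base n m) (hR : Rep G m.arr) (h0 : m.reg 0 = u)
    (h1 : m.reg 1 = v) :
    deleteEdge.Safe ((n + 1) ^ 2) m ∧ Frame EdgeArr m (deleteEdge.run m) ∧
    Rep G' (deleteEdge.run m).arr ∧
    (deleteEdge.run m).writes ≤ m.writes + if m.arr 1 u = 0 then 0 else 1 := by
  obtain ⟨c1, c2, c3, c4⟩ := countEdge_spec .sub (fun _ => rfl) hb h0 h1 (hR.code_le u.2)
    (hR.code_le v.2) (fun X Y hXY hY => (Nat.sub_le _ _).trans (hb.ok.2 _ _))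
  set m₁ := (countEdge .sub).run m with hm₁
  have hok1 : m₁.Ok ((n + 1) ^ 2) := hb.ok.run c1
  have hb1 : Base n m₁ := hb.of_eq hok1 fun r hr => c2.reg r (by omega)
  have row1 : ∀ x < n, RowRep n m₁.arr 2 x (nb G x) := fun x hx =>
    (hR.adj x hx).congr (c2.arr 2 (by omega)) (c2.arr 3 (by omega)) (c2.arr 4 (by omega))
  have e0 : m₁.reg 0 = u := by rw [c2.reg 0 (by omega), h0]
  have e1 : m₁.reg 1 = v := by rw [c2.reg 1 (by omega), h1]
  obtain ⟨d1, d2, d3, d4, d5⟩ := rowDelete_spec (n := n) (k := 2) (x := 0) (y := 1) (m := m₁)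
    (by omega) (by omega) (by omega) hb1.r3 hb1.r4 (by rw [e0]; exact u.2)
    (nb_subset G u) (by rw [e0]; exact row1 u u.2) (by rw [e1, hG.nb_left]; simp)
  set m₂ := (rowDelete 2 0 1).run m₁ with hm₂
  have hok2 : m₂.Ok ((n + 1) ^ 2) := hok1.run d1
  have hb2 : Base n m₂ := hb1.of_eq hok2 fun r hr => d4.reg r (by omega)
  have f0 : m₂.reg 0 = u := by rw [d4.reg 0 (by omega), e0]
  have f1 : m₂.reg 1 = v := by rw [d4.reg 1 (by omega), e1]
  have hne : (v : ℕ) ≠ u := fun h => hG.ne (Fin.val_injective h).symm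
  rw [e0] at d2 d3
  rw [e1] at d2
  obtain ⟨g1, g2, g3, g4, g5⟩ := rowDelete_spec (n := n) (k := 2) (x := 1) (y := 0) (m := m₂)
    (by omega) (by omega) (by omega) hb2.r3 hb2.r4 (by rw [f1]; exact v.2)
    (nb_subset G v) (by rw [f1]; exact d3 v _ hne (nb_subset _ _) (row1 v v.2))
    (by rw [f0, hG.symm.nb_left]; simp)
  set m₃ := (rowDelete 2 1 0).run m₂ with hm₃
  have hm' : deleteEdge.run m = m₃ := rfl
  rw [f1] at g2 g3
  rw [f0] at g2
  have hf := (c2.trans d4).trans g4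
  have ha : ∀ a, a ≠ 0 → a ≠ 2 → a ≠ 3 → a ≠ 4 → m₃.arr a = m.arr a := fun a _ _ _ _ =>
    hf.arr a (by omega)
  rw [hm']
  refine ⟨⟨c1, d1, g1, trivial⟩, ⟨hf.reg, fun a ha => hf.arr a (by unfold EdgeArr at ha; omega)⟩,
    ⟨fun X Y hXY hY => ?_, fun x hx => ?_, ?_, ?_, ?_⟩, ?_⟩
  · rw [g4.arr 0 (by omega), d4.arr 0 (by omega), ha 1 (by omega) (by omega) (by omega) (by omega),
      c3 X Y hXY hY, hR.wts X Y hXY hY, hG.wt_eq _ hXY.ne]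
    -- Here the old graph is the larger one, so its weight is the new weight plus what is
    -- subtracted, and the truncated subtraction is exact.
    exact Nat.add_sub_cancel _ _
  · by_cases hxv : x = v
    · rw [hxv, hG.symm.nb_erase]
      exact g2
    · refine g3 x _ hxv (nb_subset _ _) ?_
      by_cases hxu : x = u
      · rw [hxu, hG.nb_erase]
        exact d2
      · rw [← hG.nb_of_ne hxu hxv]
        exact d3 x _ hxu (nb_subset _ _) (row1 x hx)
  · rw [ha 9 (by omega) (by omega) (by omega) (by omega),
      ha 1 (by omega) (by omega) (by omega) (by omega)]
    exact hR.flag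
  · rw [ha 9 (by omega) (by omega) (by omega) (by omega),
      ha 1 (by omega) (by omega) (by omega) (by omega)]
    exact hR.code
  · rw [ha 8 (by omega) (by omega) (by omega) (by omega)]
    exact hR.cnt
  · rw [g5, d5]
    exact c4

def swapEnds : Prog := .block [
  .arith .add 26 0 5,
  .arith .add 0 1 5,
  .arith .add 1 26 5,
  .arith .add 26 24 5,
  .arith .add 24 25 5,
  .arith .add 25 26 5]

/-- Orient the edge towards a center, if there is one, and insert or delete it. -/
def changeEdge : Prog := .block [
  .load 24 9 0,
  .load 25 9 1,
  .ifLt 25 24 swapEnds .skip,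
  .ifLt 5 2 insertEdge deleteEdge]

/-- Insert or delete the center in register `1` in the list of the vertex in register `0`, and
prepare the choice of a random element of this list. -/
def changeCenters : Prog := .block [
  .ifLt 5 2 (rowInsert 5 0 1) (rowDelete 5 0 1),
  .load 18 7 0,
  .arith .sub 19 18 4]

/-- The code of the chosen center neighbor. -/
def chosenCode : Prog := .block [
  .const 21 0,
  .ifLt 5 18 (.block [
    .arith .mul 22 0 3,
    .arith .add 22 22 20,
    .load 21 5 22,
    .arith .add 21 21 4]) .skip]

/-- Contract the vertex in register `0` into the chosen center, if this is the inserted one or if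
the vertex was contracted along the deleted edge. -/
def useChoice : Prog := .block [
  chosenCode,
  .ifLt 5 2 (.arith .add 22 21 5) (.load 22 1 0),
  .arith .add 23 1 4,
  .ifLt 22 23 .skip (.ifLt 23 22 .skip recontract)]

def updateProg : Prog :=
  .seq changeEdge (.ifLt 24 25 (.seq changeCenters (.seq (.rand 20 19) useChoice)) .skip)

/-- `G'` arises from `G` by inserting or deleting the edge `uv`. -/
def Change {n : ℕ} (ins : Bool) (G G' : SimpleGraph (Fin n)) (u v : Fin n) : Prop :=
  if ins = true then AddEdge G G' u v else AddEdge G' G u v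

theorem Change.symm {n : ℕ} {ins : Bool} {G G' : SimpleGraph (Fin n)} {u v : Fin n}
    (h : Change ins G G' u v) : Change ins G G' v u := by
  unfold Change at *
  split_ifs with hi
  · rw [if_pos hi] at h; exact h.symm
  · rw [if_neg hi] at h; exact h.symm

theorem Change.nb_of_ne {n : ℕ} {ins : Bool} {G G' : SimpleGraph (Fin n)} {u v : Fin n}
    (h : Change ins G G' u v) {x : ℕ} (hu : x ≠ u) (hv : x ≠ v) : nb G' x = nb G x := by
  unfold Change at h
  split_ifs at h with hi
  · exact h.nb_of_ne hu hv
  · exact (h.nb_of_ne hu hv).symm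

theorem Change.ne {n : ℕ} {ins : Bool} {G G' : SimpleGraph (Fin n)} {u v : Fin n}
    (h : Change ins G G' u v) : u ≠ v := by
  unfold Change at h
  split_ifs at h with hi
  · exact h.ne
  · exact h.ne

/-- Both kinds of update become the relation between a graph and the same graph with one more edge,
a deletion being this relation read backwards. Unlike `Update`, it is symmetric in the ends of the
edge, so the edge may be oriented freely. -/
theorem Update.change {n : ℕ} {e : Update n} {G : SimpleGraph (Fin n)} (h : e.Valid G) :
    Change e.ins G (e.apply G) e.u e.v := by
  unfold Change Update.apply
  unfold Update.Valid at h
  split_ifs at h ⊢ with hi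
  · refine ⟨h.1, h.2, fun x y => ?_⟩
    rw [SimpleGraph.sup_adj, SimpleGraph.edge_adj]
    constructor
    · rintro (h1 | ⟨h1, -⟩)
      · exact .inl h1
      · tauto
    · rintro (h1 | ⟨rfl, rfl⟩ | ⟨rfl, rfl⟩)
      · exact .inl h1
      · exact .inr ⟨by simp, h.1⟩
      · exact .inr ⟨by simp, h.1.symm⟩
  · refine ⟨h.ne, by simp, fun x y => ?_⟩
    rw [SimpleGraph.deleteEdges_adj, Set.mem_singleton_iff, Sym2.eq_iff]
    constructor
    · intro h1
      by_cases h2 : (x = e.u ∧ y = e.v) ∨ (x = e.v ∧ y = e.u)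
      · exact .inr h2
      · exact .inl ⟨h1, h2⟩
    · rintro (⟨h1, -⟩ | ⟨rfl, rfl⟩ | ⟨rfl, rfl⟩)
      · exact h1
      · exact h
      · exact h.symm

/-- After a possible swap the second end is a center whenever any end is. So what follows has to act
only when the first end is a non-center and the second a center. -/
theorem changeEdge_spec {n : ℕ} {ins : Bool} {G G' : SimpleGraph (Fin n)} {u v : Fin n} {m : Mem}
    (hG : Change ins G G' u v) (hb : Base n m) (hR : Rep G m.arr) (h0 : m.reg 0 = u)
    (h1 : m.reg 1 = v) (h2 : m.reg 2 = if ins = true then 1 else 0) :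
    let m' := changeEdge.run m
    changeEdge.Safe ((n + 1) ^ 2) m ∧
    ∃ u' v' : Fin n, ((u' = u ∧ v' = v) ∨ (u' = v ∧ v' = u)) ∧ m.arr 9 u' ≤ m.arr 9 v' ∧
      m'.reg 0 = u' ∧ m'.reg 1 = v' ∧ m'.reg 2 = m.reg 2 ∧ m'.reg 24 = m.arr 9 u' ∧
      m'.reg 25 = m.arr 9 v' ∧ Base n m' ∧ Rep G' m'.arr ∧
      (∀ a, ¬ EdgeArr a → m'.arr a = m.arr a) ∧
      m'.writes ≤ m.writes + if m.arr 1 u' = 0 then 0 else 1 := by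
  intro m'
  set P : Prog := .block [.load 24 9 0, .load 25 9 1, .ifLt 25 24 swapEnds .skip] with hP
  set m₁ := P.run m with hm₁
  have b3 : n ≤ (n + 1) ^ 2 := by nlinarith
  have hflag : ∀ x : Fin n, m.arr 9 x ≤ 1 := fun x => by
    rw [hR.flag x x.2]
    split_ifs <;> omega
  have hmid : P.Safe ((n + 1) ^ 2) m ∧ m₁.arr = m.arr ∧ m₁.writes = m.writes ∧
      (∀ r, 2 ≤ r → r < 6 → m₁.reg r = m.reg r) ∧
      ∃ u' v' : Fin n, ((u' = u ∧ v' = v) ∨ (u' = v ∧ v' = u)) ∧ m.arr 9 u' ≤ m.arr 9 v' ∧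
        m₁.reg 0 = u' ∧ m₁.reg 1 = v' ∧ m₁.reg 24 = m.arr 9 u' ∧ m₁.reg 25 = m.arr 9 v' := by
    have fu := hflag u
    have fv := hflag v
    have un := u.2
    have vn := v.2
    by_cases hc : m.arr 9 v < m.arr 9 u
    · have hrun : m₁ = swapEnds.run ((Prog.block [.load 24 9 0, .load 25 9 1]).run m) := by
        simp [hm₁, hP, Prog.block, Prog.run, h0, h1, hc]
      rw [hrun]
      refine ⟨?_, ?_, ?_, ?_, v, u, .inr ⟨rfl, rfl⟩, hc.le, ?_, ?_, ?_, ?_⟩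
      · refine ⟨trivial, trivial, ⟨fun _ => ?_, fun _ => trivial⟩, trivial⟩
        simp [swapEnds, Prog.block, Prog.run, Prog.Safe, ArithOp.eval, h0, h1, hb.r5]
        omega
      · simp [swapEnds, Prog.block, Prog.run]
      · simp [swapEnds, Prog.block, Prog.run]
      · intro r hr hr'
        have f1 : r ≠ 0 := by omega
        have f2 : r ≠ 1 := by omega
        have f3 : r ≠ 24 := by omega
        have f4 : r ≠ 25 := by omega
        have f5 : r ≠ 26 := by omega
        simp [swapEnds, Prog.block, Prog.run, f1, f2, f3, f4, f5]
      all_goals simp [swapEnds, Prog.block, Prog.run, ArithOp.eval, h0, h1, hb.r5]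
    · have hrun : m₁ = (Prog.block [.load 24 9 0, .load 25 9 1]).run m := by
        simp [hm₁, hP, Prog.block, Prog.run, h0, h1, hc]
      rw [hrun]
      refine ⟨?_, rfl, rfl, ?_, u, v, .inl ⟨rfl, rfl⟩, by omega, ?_, ?_, ?_, ?_⟩
      · refine ⟨trivial, trivial, ⟨fun h => ?_, fun _ => trivial⟩, trivial⟩
        simp [Prog.run, h0, h1] at h
        exact absurd h hc
      · intro r hr hr'
        have f3 : r ≠ 24 := by omega
        have f4 : r ≠ 25 := by omega
        simp [Prog.block, Prog.run, f3, f4]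
      all_goals simp [Prog.block, Prog.run, h0, h1]
  obtain ⟨safe1, a1, w1, r1, u', v', huv, hle, e0, e1, e24, e25⟩ := hmid
  have hok1 : m₁.Ok ((n + 1) ^ 2) := hb.ok.run safe1
  have hb1 : Base n m₁ := ⟨hok1, by rw [r1 3 (by omega) (by omega), hb.r3],
    by rw [r1 4 (by omega) (by omega), hb.r4], by rw [r1 5 (by omega) (by omega), hb.r5]⟩
  have hG1 : Change ins G G' u' v' := by
    rcases huv with ⟨rfl, rfl⟩ | ⟨rfl, rfl⟩
    · exact hG
    · exact hG.symm
  have hr2 : m₁.reg 2 = if ins = true then 1 else 0 := by rw [r1 2 le_rfl (by omega), h2]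
  set Q : Prog := .ifLt 5 2 insertEdge deleteEdge with hQ
  have hm' : m' = Q.run m₁ := rfl
  have key : Q.Safe ((n + 1) ^ 2) m₁ ∧ Frame EdgeArr m₁ (Q.run m₁) ∧ Rep G' (Q.run m₁).arr ∧
      (Q.run m₁).writes ≤ m₁.writes + if m₁.arr 1 u' = 0 then 0 else 1 := by
    unfold Change at hG1
    by_cases hi : ins = true
    · rw [if_pos hi] at hG1 hr2
      have hc : m₁.reg 5 < m₁.reg 2 := by rw [hb1.r5, hr2]; omega
      have hrun : Q.run m₁ = insertEdge.run m₁ := if_pos hc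
      rw [hrun]
      obtain ⟨g1, g2, g3, g4⟩ := insertEdge_spec hG1 hb1 (by rwa [a1]) e0 e1
      exact ⟨⟨fun _ => g1, fun h => absurd hc h⟩, g2, g3, g4⟩
    · rw [if_neg hi] at hG1 hr2
      have hc : ¬ m₁.reg 5 < m₁.reg 2 := by rw [hb1.r5, hr2]; omega
      have hrun : Q.run m₁ = deleteEdge.run m₁ := if_neg hc
      rw [hrun]
      obtain ⟨g1, g2, g3, g4⟩ := deleteEdge_spec hG1 hb1 (by rwa [a1]) e0 e1
      exact ⟨⟨fun h => absurd h hc, fun _ => g1⟩, g2, g3, g4⟩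
  obtain ⟨g1, g2, g3, g4⟩ := key
  rw [hm']
  refine ⟨⟨safe1.1, safe1.2.1, safe1.2.2.1, g1, trivial⟩, u', v', huv, hle, ?_, ?_, ?_, ?_, ?_,
    hb1.of_eq (hok1.run g1) fun r hr => g2.reg r (by omega), g3, fun a ha => ?_, ?_⟩
  · rw [g2.reg 0 (by omega), e0]
  · rw [g2.reg 1 (by omega), e1]
  · rw [g2.reg 2 (by omega), r1 2 le_rfl (by omega)]
  · rw [g2.reg 24 (by omega), e24]
  · rw [g2.reg 25 (by omega), e25]
  · rw [g2.arr a ha, a1]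
  · rw [a1, w1] at g4
    exact g4

/-- The centers among the neighbors of `x`. -/
noncomputable def centerNb {n : ℕ} (G : SimpleGraph (Fin n)) (A : ℕ → ℕ → ℕ) (x : ℕ) : Finset ℕ :=
  (nb G x).filter fun y => A 9 y = 1

theorem centerNb_subset {n : ℕ} (G : SimpleGraph (Fin n)) (A : ℕ → ℕ → ℕ) (x : ℕ) :
    centerNb G A x ⊆ Finset.range n :=
  (Finset.filter_subset _ _).trans (nb_subset G x)

/-- As `v` is a center, it enters or leaves the list of `u` together with the edge. Register `19`
holds the cardinality minus one because the random instruction includes its upper end; for an empty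
list the truncated value is zero and the draw will be ignored. -/
theorem changeCenters_spec {n : ℕ} {ins : Bool} {G G' : SimpleGraph (Fin n)} {u v : Fin n}
    {m : Mem} (hG : Change ins G G' u v) (hb : Base n m) (h0 : m.reg 0 = u)
    (h1 : m.reg 1 = v) (h2 : m.reg 2 = if ins = true then 1 else 0) (hv : m.arr 9 v = 1)
    (hrow : RowRep n m.arr 5 u (centerNb G m.arr u)) :
    let m' := changeCenters.run m
    changeCenters.Safe ((n + 1) ^ 2) m ∧
    (∀ r, r < 6 → m'.reg r = m.reg r) ∧ Base n m' ∧
    (∀ a, a ≠ 5 → a ≠ 6 → a ≠ 7 → m'.arr a = m.arr a) ∧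
    RowRep n m'.arr 5 u (centerNb G' m.arr u) ∧
    (∀ (x : ℕ) S, x ≠ u → S ⊆ Finset.range n → RowRep n m.arr 5 x S → RowRep n m'.arr 5 x S) ∧
    m'.writes = m.writes ∧ m'.reg 18 = (centerNb G' m.arr u).card ∧
    m'.reg 19 = (centerNb G' m.arr u).card - 1 := by
  intro m'
  set Q : Prog := .ifLt 5 2 (rowInsert 5 0 1) (rowDelete 5 0 1) with hQ
  have key : Q.Safe ((n + 1) ^ 2) m ∧ RowRep n (Q.run m).arr 5 u (centerNb G' m.arr u) ∧
      (∀ (x : ℕ) S, x ≠ u → S ⊆ Finset.range n → RowRep n m.arr 5 x S →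
        RowRep n (Q.run m).arr 5 x S) ∧
      Frame (fun a => a = 5 ∨ a = 5 + 1 ∨ a = 5 + 2) m (Q.run m) ∧
      (Q.run m).writes = m.writes := by
    unfold Change at hG
    by_cases hi : ins = true
    · rw [if_pos hi] at hG h2
      have hc : m.reg 5 < m.reg 2 := by rw [hb.r5, h2]; omega
      have hrun : Q.run m = (rowInsert 5 0 1).run m := if_pos hc
      rw [hrun]
      obtain ⟨g1, g2, g3, g4, g5⟩ := rowInsert_spec (n := n) (k := 5) (x := 0) (y := 1) (m := m)
        (by omega) (by omega) (by omega) hb.r3 hb.r4 (by rw [h0]; exact u.2)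
        (by rw [h1]; exact v.2) (centerNb_subset G m.arr u) (by rwa [h0])
        (by rw [h1]; exact fun h => hG.notMem (Finset.mem_filter.1 h).1)
      rw [h0] at g2 g3
      rw [h1] at g2
      refine ⟨⟨fun _ => g1, fun h => absurd hc h⟩, ?_, g3, g4, g5⟩
      have : centerNb G' m.arr u = insert (v : ℕ) (centerNb G m.arr u) := by
        unfold centerNb
        rw [hG.nb_left, Finset.filter_insert, if_pos hv]
      rwa [this]
    · rw [if_neg hi] at hG h2
      have hc : ¬ m.reg 5 < m.reg 2 := by rw [hb.r5, h2]; omega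
      have hrun : Q.run m = (rowDelete 5 0 1).run m := if_neg hc
      rw [hrun]
      obtain ⟨g1, g2, g3, g4, g5⟩ := rowDelete_spec (n := n) (k := 5) (x := 0) (y := 1) (m := m)
        (by omega) (by omega) (by omega) hb.r3 hb.r4 (by rw [h0]; exact u.2)
        (centerNb_subset G m.arr u) (by rwa [h0])
        (by rw [h1]; exact Finset.mem_filter.2 ⟨by rw [hG.nb_left]; simp, hv⟩)
      rw [h0] at g2 g3
      rw [h1] at g2
      refine ⟨⟨fun h => absurd h hc, fun _ => g1⟩, ?_, g3, g4, g5⟩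
      have : centerNb G' m.arr u = (centerNb G m.arr u).erase v := by
        unfold centerNb
        rw [hG.nb_erase, Finset.filter_erase]
      rwa [this]
  obtain ⟨g1, g2, g3, g4, g5⟩ := key
  set m₁ := Q.run m with hm₁
  have hm' : m' = (Prog.block [.load 18 7 0, .arith .sub 19 18 4]).run m₁ := rfl
  have e0 : m₁.reg 0 = u := by rw [g4.reg 0 (by omega), h0]
  have e4 : m₁.reg 4 = 1 := by rw [g4.reg 4 (by omega), hb.r4]
  have hd : m₁.arr 7 u = (centerNb G' m.arr u).card := g2.1
  have hok1 := hb.ok.run g1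
  have safe2 : (Prog.block [.load 18 7 0, .arith .sub 19 18 4]).Safe ((n + 1) ^ 2) m₁ := by
    have : m₁.arr 7 u ≤ (n + 1) ^ 2 := hok1.2 7 u
    rw [hd] at this
    simp [Prog.block, Prog.run, Prog.Safe, ArithOp.eval, e0, e4, hd]
    omega
  have ha : m'.arr = m₁.arr := rfl
  have rr : ∀ r, r < 6 → m'.reg r = m.reg r := by
    intro r hr
    have f1 : r ≠ 18 := by omega
    have f2 : r ≠ 19 := by omega
    rw [← g4.reg r (by omega), hm']
    simp [Prog.block, Prog.run, f1, f2]
  refine ⟨⟨g1, trivial, safe2.2.1, trivial⟩, rr, hb.of_eq (hok1.run safe2) rr,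
    fun a h5 h6 h7 => by rw [ha, g4.arr a (by omega)], by rw [ha]; exact g2, by rw [ha]; exact g3,
    g5, ?_, ?_⟩
  · rw [hm']
    simp [Prog.block, Prog.run, e0, hd]
  · rw [hm']
    simp [Prog.block, Prog.run, ArithOp.eval, e0, hd, e4]

/-- The code of the `k`-th element of the list of center neighbors of `u` (zero if it is empty). -/
def choiceCode (n : ℕ) (A : ℕ → ℕ → ℕ) (u d k : ℕ) : ℕ := if 0 < d then A 5 (u * n + k) + 1 else 0

/-- `T` is the event that `u` moves: the drawn center is the new one after an insertion, or `u` was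
contracted along the deleted edge. Code `0` for the choice means that no center neighbor is left, so
`u` becomes unmapped. Outside `T` the cost is constant; inside it is linear in the degree. -/
theorem useChoice_spec {n : ℕ} {G : SimpleGraph (Fin n)} {u v : Fin n} {d k b : ℕ} {m : Mem}
    (hb : Base n m) (hR : Rep G m.arr) (h0 : m.reg 0 = u) (h1 : m.reg 1 = v)
    (h2 : m.reg 2 = b) (h18 : m.reg 18 = d) (h20 : m.reg 20 = k) (hk : 0 < d → k < n)
    (hlt : 0 < d → m.arr 5 (u * n + k) < n) :
    let m' := useChoice.run m
    let y := choiceCode n m.arr u d k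
    let T := (if 0 < b then y else m.arr 1 u) = v + 1
    useChoice.Safe ((n + 1) ^ 2) m ∧ Base n m' ∧
    (∀ a, a ≠ 0 → a ≠ 1 → m'.arr a = m.arr a) ∧
    (T → m'.arr 1 = Function.update (m.arr 1) u y) ∧ (¬ T → m'.arr 1 = m.arr 1) ∧
    (∀ X Y, X < Y → Y < n → m'.arr 0 (X * n + Y) = wt G (m'.arr 1) X Y) ∧
    (T → m'.writes ≤ m.writes + 2 * (((nb G u).image (m.arr 1)).erase 0).card) ∧
    (¬ T → m'.writes = m.writes) ∧
    (T → useChoice.steps m ≤ 30 + 62 * (nb G u).card) ∧ (¬ T → useChoice.steps m ≤ 30) := by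
  intro m' y T
  have un := u.2
  have vn := v.2
  have b3 : n + 1 ≤ (n + 1) ^ 2 := by nlinarith
  have hy : y ≤ n := by
    simp only [y, choiceCode]
    split_ifs with h
    · exact hlt h
    · omega
  have hmid : chosenCode.Safe ((n + 1) ^ 2) m ∧ (chosenCode.run m).arr = m.arr ∧
      (chosenCode.run m).writes = m.writes ∧ (chosenCode.run m).reg 21 = y ∧
      ∀ r, r ≠ 21 → r ≠ 22 → (chosenCode.run m).reg r = m.reg r := by
    by_cases hd : 0 < d
    · have hkn := hk hd
      have b1 := addr_le un hkn.le
      have b0 := addr_le un (Nat.zero_le n)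
      have b2 := hlt hd
      refine ⟨?_, ?_, ?_, ?_, fun r f1 f2 => ?_⟩
      · simp [chosenCode, Prog.block, Prog.run, Prog.Safe, ArithOp.eval, h0, h18, h20, hd, hb.r3,
          hb.r4, hb.r5]
        omega
      · simp [chosenCode, Prog.block, Prog.run, hd, h18, hb.r5]
      · simp [chosenCode, Prog.block, Prog.run, hd, h18, hb.r5]
      · simp [chosenCode, Prog.block, Prog.run, ArithOp.eval, hd, h0, h18, h20, hb.r3, hb.r4, hb.r5,
          y, choiceCode]
      · simp [chosenCode, Prog.block, Prog.run, f1, f2, hd, h18, hb.r5]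
    · refine ⟨?_, ?_, ?_, ?_, fun r f1 f2 => ?_⟩
      · simp [chosenCode, Prog.block, Prog.run, Prog.Safe, h18, hd, hb.r5]
      · simp [chosenCode, Prog.block, Prog.run, hd, h18, hb.r5]
      · simp [chosenCode, Prog.block, Prog.run, hd, h18, hb.r5]
      · simp [chosenCode, Prog.block, Prog.run, hd, h18, hb.r5, y, choiceCode]
      · simp [chosenCode, Prog.block, Prog.run, f1, hd, h18, hb.r5]
  obtain ⟨s1, a1, w1, e21, rr1⟩ := hmid
  set m₁ := chosenCode.run m with hm₁
  have hok1 := hb.ok.run s1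
  set x := if 0 < b then y else m.arr 1 u with hx
  set Q : Prog := .block [.ifLt 5 2 (.arith .add 22 21 5) (.load 22 1 0), .arith .add 23 1 4]
    with hQ
  have hmid2 : Q.Safe ((n + 1) ^ 2) m₁ ∧ (Q.run m₁).arr = m₁.arr ∧
      (Q.run m₁).writes = m₁.writes ∧ (Q.run m₁).reg 22 = x ∧ (Q.run m₁).reg 23 = v + 1 ∧
      ∀ r, r ≠ 22 → r ≠ 23 → (Q.run m₁).reg r = m₁.reg r := by
    have e0 : m₁.reg 0 = u := by rw [rr1 0 (by omega) (by omega), h0]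
    have e1 : m₁.reg 1 = v := by rw [rr1 1 (by omega) (by omega), h1]
    have e2 : m₁.reg 2 = b := by rw [rr1 2 (by omega) (by omega), h2]
    have e4 : m₁.reg 4 = 1 := by rw [rr1 4 (by omega) (by omega), hb.r4]
    have e5 : m₁.reg 5 = 0 := by rw [rr1 5 (by omega) (by omega), hb.r5]
    by_cases hb0 : 0 < b
    · refine ⟨?_, ?_, ?_, ?_, ?_, fun r f1 f2 => ?_⟩
      · simp [hQ, Prog.block, Prog.run, Prog.Safe, ArithOp.eval, e1, e2, e4, e5, hb0, e21]
        omega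
      · simp [hQ, Prog.block, Prog.run, e2, e5, hb0]
      · simp [hQ, Prog.block, Prog.run, e2, e5, hb0]
      · simp [hQ, Prog.block, Prog.run, ArithOp.eval, e2, e5, hb0, e21, hx]
      · simp [hQ, Prog.block, Prog.run, ArithOp.eval, e1, e2, e4, e5, hb0]
      · simp [hQ, Prog.block, Prog.run, e2, e5, hb0, f1, f2]
    · refine ⟨?_, ?_, ?_, ?_, ?_, fun r f1 f2 => ?_⟩
      · simp [hQ, Prog.block, Prog.run, Prog.Safe, ArithOp.eval, e1, e2, e4, e5, hb0]
        omega
      · simp [hQ, Prog.block, Prog.run, e2, e5, hb0]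
      · simp [hQ, Prog.block, Prog.run, e2, e5, hb0]
      · simp [hQ, Prog.block, Prog.run, e0, e2, e5, hb0, hx, a1]
      · simp [hQ, Prog.block, Prog.run, ArithOp.eval, e1, e2, e4, e5, hb0]
      · simp [hQ, Prog.block, Prog.run, e2, e5, hb0, f1, f2]
  obtain ⟨s2, a2, w2, e22, e23, rr2⟩ := hmid2
  set m₂ := Q.run m₁ with hm₂
  have hok2 := hok1.run s2
  have r2 : ∀ r, r < 6 → m₂.reg r = m.reg r := fun r hr => by
    rw [rr2 r (by omega) (by omega), rr1 r (by omega) (by omega)]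
  have hb2 : Base n m₂ := hb.of_eq hok2 r2
  have aa : m₂.arr = m.arr := a2.trans a1
  have ww : m₂.writes = m.writes := w2.trans w1
  set F : Prog := .ifLt 22 23 .skip (.ifLt 23 22 .skip recontract) with hF
  have hm' : m' = F.run m₂ := rfl
  have hst : useChoice.steps m = chosenCode.steps m + ((Prog.ifLt 5 2 (.arith .add 22 21 5)
      (.load 22 1 0)).steps m₁ + (1 + (F.steps m₂ + 0))) := rfl
  have st1 := Prog.steps_le_len chosenCode m (by simp [chosenCode, Prog.block, Prog.Flat])
  have st2 := Prog.steps_le_len (.ifLt 5 2 (.arith .add 22 21 5) (.load 22 1 0)) m₁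
    (by simp [Prog.Flat])
  have l1 : chosenCode.len = 6 := rfl
  have l2 : (Prog.ifLt 5 2 (.arith .add 22 21 5) (.load 22 1 0)).len = 3 := rfl
  rw [l1] at st1
  rw [l2] at st2
  by_cases hT : T
  · have hxv : x = v + 1 := hT
    have c1 : ¬ m₂.reg 22 < m₂.reg 23 := by omega
    have c2 : ¬ m₂.reg 23 < m₂.reg 22 := by omega
    have hrun : m' = recontract.run m₂ := (if_neg c1).trans (if_neg c2)
    have e21' : m₂.reg 21 = y := by rw [rr2 21 (by omega) (by omega), e21]
    obtain ⟨g1, g2, g3, g4, g5, g6, g7⟩ := recontract_spec (G := G) (u := u) hb2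
      (by rw [r2 0 (by omega), h0]) (by rw [aa]; exact hR.adj u u.2)
      (by rw [aa]; exact fun z hz => hR.code_le hz) (by rw [aa]; exact hR.cnt)
      (by rw [e21']; exact hy) (by rw [aa]; exact hR.wts)
    rw [hrun]
    have hF : F.steps m₂ = 1 + (1 + recontract.steps m₂) := by simp [hF, Prog.steps, c1, c2]
    rw [aa, e21'] at g3
    rw [aa, ww] at g6
    refine ⟨⟨s1, s2.1, s2.2.1, ⟨fun h => absurd h c1, fun _ => ⟨fun h => absurd h c2,
      fun _ => g1⟩⟩, trivial⟩, hb2.of_eq (hok2.run g1) fun r hr => g2 r (by omega),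
      fun a ha ha' => by rw [g4 a ha ha', aa], fun _ => g3, fun h => absurd hT h, g5,
      fun _ => g6, fun h => absurd hT h, fun _ => by omega, fun h => absurd hT h⟩
  · have hxv : x ≠ v + 1 := hT
    have hrun : m' = m₂ := by
      rw [hm', hF]
      simp only [Prog.run]
      split_ifs with c1 c2
      · rfl
      · rfl
      · omega
    have hF : F.Safe ((n + 1) ^ 2) m₂ := by
      refine ⟨fun _ => trivial, fun c1 => ⟨fun _ => trivial, fun c2 => ?_⟩⟩
      exfalso; omega
    have hFs : F.steps m₂ ≤ 2 := by
      simp only [F, Prog.steps]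
      split_ifs with c1 c2
      · omega
      · omega
      · omega
    rw [hrun]
    refine ⟨⟨s1, s2.1, s2.2.1, hF, trivial⟩, hb2, fun a _ _ => by rw [aa], fun h => absurd h hT,
      fun _ => by rw [aa], by rw [aa]; exact hR.wts, fun h => absurd h hT, fun _ => ww,
      fun h => absurd h hT, fun _ => by omega⟩

/-! ### The distribution of one update -/

theorem bind_congr_support {α β : Type*} {p : PMF α} {f g : α → PMF β}
    (h : ∀ a ∈ p.support, f a = g a) : p.bind f = p.bind g := by
  ext b
  rw [PMF.bind_apply, PMF.bind_apply]
  refine tsum_congr fun a => ?_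
  by_cases ha : p a = 0
  · simp [ha]
  · rw [h a ha]

theorem map_congr_support {α β : Type*} {p : PMF α} {f g : α → β}
    (h : ∀ a ∈ p.support, f a = g a) : p.map f = p.map g :=
  bind_congr_support fun a ha => congrArg PMF.pure (h a ha)

theorem map_uniformOfFinset {α β : Type*} [DecidableEq β] {s : Finset α} (hs : s.Nonempty)
    {t : Finset β} (ht : t.Nonempty) {f : α → β} (hf : Set.InjOn f s) (hst : s.image f = t) :
    (PMF.uniformOfFinset s hs).map f = PMF.uniformOfFinset t ht := by
  ext b
  rw [PMF.map_apply, PMF.uniformOfFinset_apply]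
  split_ifs with hb
  · rw [← hst] at hb
    obtain ⟨a, ha, rfl⟩ := Finset.mem_image.1 hb
    rw [tsum_eq_single a]
    · rw [if_pos rfl, PMF.uniformOfFinset_apply_of_mem hs ha, ← hst,
        Finset.card_image_of_injOn hf]
    · intro a' ha'
      split_ifs with h
      · apply PMF.uniformOfFinset_apply_of_notMem
        exact fun h' => ha' (hf h' ha h.symm)
      · rfl
  · rw [ENNReal.tsum_eq_zero]
    intro a
    split_ifs with h
    · apply PMF.uniformOfFinset_apply_of_notMem
      rintro ha
      exact hb (hst ▸ h ▸ Finset.mem_image_of_mem f ha)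
    · rfl

/-! ### Random choice of a center neighbor, and its coding in the memory -/

section Kernel

variable {n : ℕ}

/-- A uniformly random element of `S`, if there is one. -/
noncomputable def choiceLaw {β : Type*} (S : Finset β) : PMF (Option β) :=
  open Classical in if h : S.Nonempty then (PMF.uniformOfFinset S h).map some else PMF.pure none

open Classical in
/-- The neighbors of `v` in `R`. -/
noncomputable def centersAt (G : SimpleGraph (Fin n)) (R : Finset (Fin n)) (v : Fin n) :
    Finset (Fin n) :=
  Finset.univ.filter fun w => G.Adj v w ∧ w ∈ R

/-- The vertex into which `v` is contracted, given the set of centers. -/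
noncomputable def vertexLaw (G : SimpleGraph (Fin n)) (R : Finset (Fin n)) (v : Fin n) :
    PMF (Option (Fin n)) :=
  if v ∈ R then PMF.pure (some v) else choiceLaw (centersAt G R v)

/-- Replacement of the contraction target `x` by a random element of `S`, if this is the vertex `v`
(after an insertion) or if `x` is the vertex `v` (after a deletion). -/
noncomputable def resample (S : Finset (Fin n)) (ins : Bool) (v : Fin n) (x : Option (Fin n)) :
    PMF (Option (Fin n)) :=
  (choiceLaw S).map fun y => if (if ins = true then y else x) = some v then y else x

/-- Centers and contraction map. -/
abbrev Config (n : ℕ) := Finset (Fin n) × (Fin n → Option (Fin n))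

noncomputable def resampleAt (G : SimpleGraph (Fin n)) (ins : Bool) (u v : Fin n) (o : Config n) :
    PMF (Config n) :=
  (resample (centersAt G o.1 u) ins v (o.2 u)).map fun z => (o.1, Function.update o.2 u z)

/-- The effect of one update on centers and contraction map, where `G` is the graph after it. -/
noncomputable def updateKernel (G : SimpleGraph (Fin n)) (ins : Bool) (u v : Fin n) (o : Config n) :
    PMF (Config n) :=
  if u ∉ o.1 ∧ v ∈ o.1 then resampleAt G ins u v o
  else if u ∈ o.1 ∧ v ∉ o.1 then resampleAt G ins v u o
  else PMF.pure o

def decode (n c : ℕ) : Option (Fin n) :=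
  if h : 0 < c ∧ c ≤ n then some ⟨c - 1, by omega⟩ else none

theorem decode_zero : decode n 0 = none := by simp [decode]

theorem decode_succ {x : ℕ} (hx : x < n) : decode n (x + 1) = some ⟨x, hx⟩ := by
  have : x + 1 ≤ n := hx
  simp [decode, this]

theorem decode_eq_some {c : ℕ} {v : Fin n} (hc : c ≤ n) : decode n c = some v ↔ c = v + 1 := by
  rcases Nat.eq_zero_or_pos c with rfl | h
  · simp [decode_zero]
  · obtain ⟨x, rfl⟩ : ∃ x, c = x + 1 := ⟨c - 1, by omega⟩
    rw [decode_succ (by omega), Option.some_inj, Fin.ext_iff]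
    simp

/-- Centers and contraction map stored in the arrays. -/
def configOf (n : ℕ) (A : ℕ → ℕ → ℕ) : Config n :=
  (Finset.univ.filter fun x : Fin n => A 9 x = 1, fun v => decode n (A 1 v))

theorem mem_configOf {A : ℕ → ℕ → ℕ} {x : Fin n} : x ∈ (configOf n A).1 ↔ A 9 x = 1 := by
  simp [configOf]

theorem outMap_eq (s : State) : s.outMap n = (configOf n s.arr).2 := rfl

/-- The arrays represent the graph and a contraction along its edges into the centers. -/
structure FullRep (G : SimpleGraph (Fin n)) (A : ℕ → ℕ → ℕ) : Prop extends Rep G A where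
  centers : ∀ x < n, A 9 x = 0 → RowRep n A 5 x (centerNb G A x)
  along : ∀ x < n, ∀ y, A 1 x = y + 1 → x = y ∨ y ∈ nb G x

/-- The state of the machine between updates. -/
structure StateRep (G : SimpleGraph (Fin n)) (s : State) : Prop where
  reg_le : ∀ r, 3 ≤ r → s.reg r ≤ (n + 1) ^ 2
  arr_le : ∀ a i, s.arr a i ≤ (n + 1) ^ 2
  r3 : s.reg 3 = n
  r4 : s.reg 4 = 1
  r5 : s.reg 5 = 0
  rep : FullRep G s.arr

theorem Base.stateRep {G : SimpleGraph (Fin n)} {s : State} (h : Base n s.mem)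
    (hr : FullRep G s.arr) : StateRep G s :=
  ⟨fun r _ => h.ok.1 r, h.ok.2, h.r3, h.r4, h.r5, hr⟩

theorem Rep.flag_le {G : SimpleGraph (Fin n)} {A : ℕ → ℕ → ℕ} (h : Rep G A) {x : ℕ} (hx : x < n) :
    A 9 x ≤ 1 := by
  rw [h.flag x hx]
  split_ifs <;> omega

theorem centerNb_eq_map (G : SimpleGraph (Fin n)) (A : ℕ → ℕ → ℕ) (u : Fin n) :
    centerNb G A u = (centersAt G (configOf n A).1 u).map Fin.valEmbedding := by
  ext y
  simp only [centerNb, Finset.mem_filter, Finset.mem_map, centersAt, Finset.mem_univ, true_and,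
    mem_configOf, Fin.valEmbedding_apply]
  constructor
  · rintro ⟨h1, h2⟩
    obtain ⟨_, hy, h⟩ := mem_nb.1 h1
    exact ⟨⟨y, hy⟩, ⟨h, h2⟩, rfl⟩
  · rintro ⟨y, ⟨h1, h2⟩, rfl⟩
    exact ⟨mem_nb_fin.2 h1, h2⟩

/-- A random index in the list of center neighbors yields a random center neighbor. -/
theorem map_choiceCode {G : SimpleGraph (Fin n)} {A : ℕ → ℕ → ℕ} {u : Fin n} {R : Finset (Fin n)}
    {S : Finset ℕ} (hS : S = (centersAt G R u).map Fin.valEmbedding) (hrow : RowRep n A 5 u S)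
    (hne : (Finset.range (S.card - 1 + 1)).Nonempty) :
    (PMF.uniformOfFinset (Finset.range (S.card - 1 + 1)) hne).map
      (fun k => decode n (choiceCode n A u S.card k)) = choiceLaw (centersAt G R u) := by
  classical
  unfold choiceLaw
  by_cases h : (centersAt G R u).Nonempty
  · have hpos : 0 < S.card := by rw [hS, Finset.card_map]; exact Finset.card_pos.2 h
    have hr : Finset.range (S.card - 1 + 1) = Finset.range S.card := by
      rw [Nat.sub_add_cancel hpos]
    have hlt : ∀ k < S.card, A 5 (u * n + k) < n := fun k hk => by
      have := (hrow.2 k hk).1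
      rw [hS] at this
      obtain ⟨w, _, hw⟩ := Finset.mem_map.1 this
      rw [← hw]
      exact w.2
    have hcode : ∀ k < S.card, ∀ w : Fin n,
        decode n (choiceCode n A u S.card k) = some w ↔ A 5 (u * n + k) = w := fun k hk w => by
      rw [choiceCode, if_pos hpos, decode_eq_some (hlt k hk)]
      omega
    have himg : (Finset.range (S.card - 1 + 1)).image
        (fun k => decode n (choiceCode n A u S.card k)) = (centersAt G R u).image some := by
      rw [hr]
      ext z
      simp only [Finset.mem_image, Finset.mem_range]
      constructor
      · rintro ⟨k, hk, rfl⟩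
        have h1 := (hrow.2 k hk).1
        rw [hS] at h1
        obtain ⟨w, hw, hw'⟩ := Finset.mem_map.1 h1
        exact ⟨w, hw, ((hcode k hk w).2 hw'.symm).symm⟩
      · rintro ⟨w, hw, rfl⟩
        obtain ⟨k, hk, hk'⟩ := hrow.exists_index (y := (w : ℕ))
          (by rw [hS]; exact Finset.mem_map_of_mem Fin.valEmbedding hw)
        exact ⟨k, hk, (hcode k hk w).2 hk'⟩
    rw [dif_pos h, map_uniformOfFinset hne (t := (centersAt G R u).image some) (h.image _) _ himg,
      map_uniformOfFinset h (h.image _) (Option.some_injective _).injOn rfl]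
    rw [hr]
    intro k hk l hl hkl
    have hk : k < S.card := by simpa using hk
    have hl : l < S.card := by simpa using hl
    apply hrow.injOn (by simpa using hk) (by simpa using hl)
    have h1 := (hcode k hk ⟨_, hlt k hk⟩).2 rfl
    have h2 := (hcode l hl ⟨_, hlt k hk⟩).1 (by rw [← h1]; exact hkl.symm)
    exact h2.symm
  -- For an empty list the index is drawn from a one-element range and not used.
  · have h0 : S.card = 0 := by
      rw [hS, Finset.card_map, Finset.card_eq_zero]
      exact Finset.not_nonempty_iff_eq_empty.1 h
    rw [dif_neg h]
    have : (fun k => decode n (choiceCode n A u S.card k)) = Function.const _ none := by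
      funext k
      simp [choiceCode, h0, decode_zero]
    rw [this, PMF.map_const]

end Kernel

/-! ### One update: the law of its result and its cost -/

section Step

variable {n : ℕ} {ins : Bool} {G G' : SimpleGraph (Fin n)} {u v : Fin n}

/-- The number of edges to be mapped anew in an update of `uv`, for the contraction map `g`. -/
noncomputable def changeCost (H : SimpleGraph (Fin n)) (u v : Fin n) (g : Fin n → Option (Fin n)) :
    ℕ :=
  (if g u = some v then (nb H u).card else 0) + if g v = some u then (nb H v).card else 0

theorem changeCost_comm (H : SimpleGraph (Fin n)) (u v : Fin n) (g : Fin n → Option (Fin n)) :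
    changeCost H u v g = changeCost H v u g := add_comm _ _

theorem le_changeCost {H : SimpleGraph (Fin n)} {u v : Fin n} {g : Fin n → Option (Fin n)}
    (h : g u = some v) : (nb H u).card ≤ changeCost H u v g := by
  simp [changeCost, h]

theorem updateKernel_comm (G : SimpleGraph (Fin n)) (ins : Bool) (u v : Fin n) (o : Config n) :
    updateKernel G ins u v o = updateKernel G ins v u o := by
  unfold updateKernel
  split_ifs <;> first | rfl | tauto

theorem Change.centerNb_eq (h : Change ins G G' u v) {A : ℕ → ℕ → ℕ} (hv : A 9 v ≠ 1) :
    centerNb G' A u = centerNb G A u := by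
  unfold Change at h
  unfold centerNb
  split_ifs at h
  · rw [h.nb_left, Finset.filter_insert, if_neg hv]
  · rw [h.nb_left, Finset.filter_insert, if_neg hv]

theorem Change.mem_nb (h : Change ins G G' u v) {x y : ℕ} (hy : y ∈ nb G x) :
    y ∈ nb G' x ∨ (ins = false ∧ ((x = u ∧ y = v) ∨ (x = v ∧ y = u))) := by
  unfold Change at h
  obtain ⟨hx, hy, hadj⟩ := DynStar.mem_nb.1 hy
  split_ifs at h with hi
  · exact .inl (DynStar.mem_nb.2 ⟨hx, hy, (h.adj _ _).2 (.inl hadj)⟩)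
  · rcases (h.adj _ _).1 hadj with h1 | h1 | h1
    · exact .inl (DynStar.mem_nb.2 ⟨hx, hy, h1⟩)
    · exact .inr ⟨by simpa using hi, .inl ⟨congrArg Fin.val h1.1, congrArg Fin.val h1.2⟩⟩
    · exact .inr ⟨by simpa using hi, .inr ⟨congrArg Fin.val h1.1, congrArg Fin.val h1.2⟩⟩

/-- A target is lost only if its vertex was contracted along the deleted edge. A vertex contracted
into another one has flag zero and its target has flag one, so the order of the flags excludes the
direction from `v` to `u`. -/
theorem FullRep.along_of_change {A : ℕ → ℕ → ℕ} (hR : FullRep G A) (hG : Change ins G G' u v)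
    (hle : A 9 u ≤ A 9 v) {x y : ℕ} (hx : x < n) (hxy : A 1 x = y + 1) :
    x = y ∨ y ∈ nb G' x ∨ (ins = false ∧ x = u ∧ y = v ∧ A 9 u < A 9 v) := by
  rcases hR.along x hx y hxy with h | h
  · exact .inl h
  have hne : (u : ℕ) ≠ v := fun h => hG.ne (Fin.val_injective h)
  have fu := hR.flag u u.2
  have fv := hR.flag v v.2
  have hy := (hR.code x hx y hxy).2
  rcases hG.mem_nb h with h | ⟨h1, ⟨rfl, rfl⟩ | ⟨rfl, rfl⟩⟩
  · exact .inr (.inl h)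
  · refine .inr (.inr ⟨h1, rfl, rfl, ?_⟩)
    rw [hxy, if_neg (by omega)] at fu
    omega
  · rw [hxy, if_neg (by omega)] at fv
    omega

/-- Nonzero codes are codes of centers. This bounds the writes of one pass over the edges at a
vertex by the number of centers, whatever the degree. -/
theorem Rep.image_card_le {A : ℕ → ℕ → ℕ} (hR : Rep G A) {S : Finset ℕ} (hS : S ⊆ Finset.range n) :
    ((S.image (A 1)).erase 0).card ≤ (configOf n A).1.card := by
  have : (S.image (A 1)).erase 0 ⊆ (configOf n A).1.image fun x : Fin n => (x : ℕ) + 1 := by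
    intro c hc
    obtain ⟨hc0, hc⟩ := Finset.mem_erase.1 hc
    obtain ⟨z, hz, rfl⟩ := Finset.mem_image.1 hc
    have hzn : z < n := by simpa using hS hz
    obtain ⟨h1, h2⟩ := hR.code z hzn (A 1 z - 1) (by omega)
    exact Finset.mem_image.2 ⟨⟨_, h1⟩, mem_configOf.2 h2, by simp only; omega⟩
  exact (Finset.card_le_card this).trans Finset.card_image_le

theorem Rep.card_pos {A : ℕ → ℕ → ℕ} (hR : Rep G A) {x : ℕ} (hx : x < n) (h : A 1 x ≠ 0) :
    0 < (configOf n A).1.card := by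
  obtain ⟨h1, h2⟩ := hR.code x hx (A 1 x - 1) (by omega)
  exact Finset.card_pos.2 ⟨⟨_, h1⟩, mem_configOf.2 h2⟩

theorem image_card_le_nb (A : ℕ → ℕ) (S : Finset ℕ) : ((S.image A).erase 0).card ≤ S.card :=
  (Finset.card_erase_le).trans Finset.card_image_le

theorem changeEdge_det : changeEdge.Det := by
  simp [changeEdge, swapEnds, insertEdge, deleteEdge, countEdge, bump_det, rowInsert_det,
    rowDelete_det, Prog.block, Prog.Det]

theorem changeEdge_flat : changeEdge.Flat := by
  simp [changeEdge, swapEnds, insertEdge, deleteEdge, countEdge, bump_flat, rowInsert,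
    rowDelete, Prog.block, Prog.Flat]

theorem changeCenters_det : changeCenters.Det := by
  simp [changeCenters, rowInsert_det, rowDelete_det, Prog.block, Prog.Det]

theorem changeCenters_flat : changeCenters.Flat := by
  simp [changeCenters, rowInsert, rowDelete, Prog.block, Prog.Flat]

theorem useChoice_det : useChoice.Det := by
  simp [useChoice, chosenCode, recontract, shiftIf, shift_det, Prog.block, Prog.Det]

/-- What is guaranteed of every possible result `t` of an update of `uv` from the state `s`. -/
structure StepBound (ins : Bool) (G G' : SimpleGraph (Fin n)) (u v : Fin n) (s t : State) :
    Prop where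
  rep : StateRep G' t
  flags : t.arr 9 = s.arr 9
  writes_le : t.writes ≤ 3 * (configOf n s.arr).1.card
  cost : ∃ k, t.time ≤ (200 + 62 * k) * unitCost ((n + 1) ^ 2) ∧ t.writes ≤ 1 + 2 * k ∧
    k ≤ changeCost (if ins = true then G' else G) u v
      (if ins = true then (configOf n t.arr).2 else (configOf n s.arr).2)

theorem StepBound.comm {s t : State} (h : StepBound ins G G' u v s t) :
    StepBound ins G G' v u s t :=
  ⟨h.rep, h.flags, h.writes_le, by simpa only [changeCost_comm] using h.cost⟩

/-- The part of the update that follows `changeEdge`, where the edge is oriented. -/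
def updateRest : Prog := .ifLt 24 25 (.seq changeCenters (.seq (.rand 20 19) useChoice)) .skip

set_option maxHeartbeats 2000000 in
-- The draw is the only randomness: for each drawn index the remaining program is deterministic, so
-- the law of the result is the image of the uniform law on indices, and the bounds are checked
-- index by index. If the flags of the two ends agree, no list of center neighbors of a non-center
-- changes and nothing is done.
theorem updateRest_spec {s t : State} (hG : Change ins G G' u v) (hR : FullRep G s.arr)
    (hle : s.arr 9 u ≤ s.arr 9 v) (h0 : t.reg 0 = u) (h1 : t.reg 1 = v)
    (h2 : t.reg 2 = if ins = true then 1 else 0) (h24 : t.reg 24 = s.arr 9 u)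
    (h25 : t.reg 25 = s.arr 9 v) (hb : Base n t.mem) (hR' : Rep G' t.arr)
    (harr : ∀ a, ¬ EdgeArr a → t.arr a = s.arr a)
    (hw : t.writes ≤ if s.arr 1 u = 0 then 0 else 1)
    (htime : t.time ≤ 100 * unitCost ((n + 1) ^ 2)) :
    (updateRest.exec t).map (fun r => configOf n r.arr) =
      updateKernel G' ins u v (configOf n s.arr) ∧
    ∀ r ∈ (updateRest.exec t).support, StepBound ins G G' u v s r := by
  have a1 : t.arr 1 = s.arr 1 := harr 1 (by unfold EdgeArr; omega)
  have a5 : t.arr 5 = s.arr 5 := harr 5 (by unfold EdgeArr; omega)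
  have a6 : t.arr 6 = s.arr 6 := harr 6 (by unfold EdgeArr; omega)
  have a7 : t.arr 7 = s.arr 7 := harr 7 (by unfold EdgeArr; omega)
  have a9 : t.arr 9 = s.arr 9 := harr 9 (by unfold EdgeArr; omega)
  have hconf : configOf n t.arr = configOf n s.arr := by unfold configOf; rw [a1, a9]
  have hcn : ∀ (H : SimpleGraph (Fin n)) x, centerNb H t.arr x = centerNb H s.arr x := by
    intro H x; unfold centerNb; rw [a9]
  have hne : (u : ℕ) ≠ v := fun h => hG.ne (Fin.val_injective h)
  -- A mapped vertex has a center as target. So the single write for the edge itself is also at most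
  -- the number of centers, and together with the two passes of a recontraction this gives the
  -- factor three.
  have hw3 : (if s.arr 1 u = 0 then 0 else 1) ≤ (configOf n s.arr).1.card := by
    split_ifs with h
    · omega
    · exact hR.toRep.card_pos u.2 h
  have hf1 := hR.toRep.flag_le u.2
  have hf2 := hR.toRep.flag_le v.2
  set L := unitCost ((n + 1) ^ 2) with hL
  set c := 1 + (t.reg 24).size + (t.reg 25).size with hc
  have hcL : c ≤ L := by
    have e1 := Nat.size_le_size (hb.ok.1 24)
    have e2 := Nat.size_le_size (hb.ok.1 25)
    simp only [State.mem_reg] at e1 e2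
    simp only [hc, hL, unitCost]
    omega
  by_cases hlt : t.reg 24 < t.reg 25
  · have hexec : updateRest.exec t = (changeCenters.exec (t.charge c)).bind fun r =>
        ((Prog.rand 20 19).exec r).bind fun r => useChoice.exec r := if_pos hlt
    have hfu : s.arr 9 u = 0 := by omega
    have hfv : s.arr 9 v = 1 := by omega
    have huR : u ∉ (configOf n s.arr).1 := by rw [mem_configOf]; omega
    have hvR : v ∈ (configOf n s.arr).1 := mem_configOf.2 hfv
    have hrow : RowRep n t.arr 5 u (centerNb G t.arr u) := by
      rw [hcn]
      exact (hR.centers u u.2 hfu).congr a5 a6 a7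
    obtain ⟨c1, c2, c3, c4, c5, c6, c7, c8, c9⟩ := changeCenters_spec (m := t.mem) hG hb h0 h1 h2
      (by rw [State.mem_arr, a9]; exact hfv) hrow
    obtain ⟨r, hr1, hr2, hr3⟩ := exec_eq_pure (s := t.charge c) changeCenters_det hb.ok c1
    rw [State.mem_charge] at hr2 hr3
    rw [← hr2] at c2 c3 c4 c5 c6 c7 c8 c9
    simp only [State.mem_reg, State.mem_arr, State.mem_writes] at c2 c4 c5 c6 c7 c8 c9
    rw [hcn] at c5 c8 c9
    set S := centerNb G' s.arr u with hSdef
    have hSmap : S = (centersAt G' (configOf n s.arr).1 u).map Fin.valEmbedding :=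
      centerNb_eq_map G' s.arr u
    have hSn : S ⊆ Finset.range n := centerNb_subset _ _ _
    have hScard := card_le_of_subset_range hSn
    have hst : changeCenters.steps t.mem ≤ 24 := Prog.steps_le_len _ _ changeCenters_flat
    have hrtime : r.time ≤ 125 * L := by
      have : (t.charge c).time = t.time + c := rfl
      have h3 : changeCenters.steps t.mem * L ≤ 24 * L := Nat.mul_le_mul_right _ hst
      rw [← hL] at hr3
      omega
    have hRr : Rep G' r.arr := by
      refine ⟨?_, fun x hx => ?_, ?_, ?_, ?_⟩
      · rw [c4 0 (by omega) (by omega) (by omega), c4 1 (by omega) (by omega) (by omega)]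
        exact hR'.wts
      · exact (hR'.adj x hx).congr (c4 2 (by omega) (by omega) (by omega))
          (c4 3 (by omega) (by omega) (by omega)) (c4 4 (by omega) (by omega) (by omega))
      · rw [c4 9 (by omega) (by omega) (by omega), c4 1 (by omega) (by omega) (by omega)]
        exact hR'.flag
      · rw [c4 9 (by omega) (by omega) (by omega), c4 1 (by omega) (by omega) (by omega)]
        exact hR'.code
      · rw [c4 8 (by omega) (by omega) (by omega)]
        exact hR'.cnt
    have b1 : r.arr 1 = s.arr 1 := by rw [c4 1 (by omega) (by omega) (by omega), a1]
    have b9 : r.arr 9 = s.arr 9 := by rw [c4 9 (by omega) (by omega) (by omega), a9]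
    have hSlt : ∀ k < S.card, r.arr 5 (u * n + k) ∈ S := fun k hk => (c5.2 k hk).1
    -- the result for a given random number
    have key : ∀ k ∈ Finset.range (r.reg 19 + 1), ∃ q,
        useChoice.exec ((r.setReg 20 k).charge (1 + (r.reg 19).size + k.size)) = PMF.pure q ∧
        configOf n q.arr = ((configOf n s.arr).1, Function.update (configOf n s.arr).2 u
          (if (if ins = true then decode n (choiceCode n r.arr u S.card k)
              else (configOf n s.arr).2 u) = some v
            then decode n (choiceCode n r.arr u S.card k) else (configOf n s.arr).2 u)) ∧
        StepBound ins G G' u v s q := by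
      intro k hk
      rw [c9] at hk
      have hk' : 0 < S.card → k < S.card := by
        intro h
        have := Finset.mem_range.1 hk
        omega
      set q₀ := (r.setReg 20 k).charge (1 + (r.reg 19).size + k.size) with hq₀
      have hkM : k ≤ (n + 1) ^ 2 := by
        have := Finset.mem_range.1 hk
        have : k ≤ n + 1 := by omega
        nlinarith
      have hq₀r : ∀ x, x ≠ 20 → q₀.reg x = r.reg x := fun x hx => by
        simp [hq₀, State.charge, State.setReg, hx]
      have hq₀a : q₀.arr = r.arr := rfl
      have hq₀b : Base n q₀.mem := c3.of_eq ⟨update_le c3.ok.1 20 hkM, c3.ok.2⟩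
        fun x hx => hq₀r x (by omega)
      obtain ⟨d1, d2, d3, d4, d5, d6, d7, d8, d9, d10⟩ := useChoice_spec (m := q₀.mem) (G := G')
        (u := u) (v := v) (d := S.card) (k := k) (b := if ins = true then 1 else 0) hq₀b hRr
        (by rw [State.mem_reg, hq₀r 0 (by omega), c2 0 (by omega), h0])
        (by rw [State.mem_reg, hq₀r 1 (by omega), c2 1 (by omega), h1])
        (by rw [State.mem_reg, hq₀r 2 (by omega), c2 2 (by omega), h2])
        (by rw [State.mem_reg, hq₀r 18 (by omega), c8])
        (by simp [hq₀, State.charge, State.setReg]) (fun h => by have := hk' h; omega)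
        (fun h => Finset.mem_range.1 (hSn (hSlt k (hk' h))))
      obtain ⟨q, hq1, hq2, hq3⟩ := exec_eq_pure (s := q₀) useChoice_det hq₀b.ok d1
      rw [← hq2] at d2 d3 d4 d5 d6 d7 d8
      simp only [State.mem_arr, State.mem_writes, hq₀a] at d3 d4 d5 d6 d7 d8 d9 d10
      set y := choiceCode n r.arr u S.card k with hy
      have hyS : ∀ z, y = z + 1 → z ∈ S := by
        intro z hz
        simp only [hy, choiceCode] at hz
        split_ifs at hz with hpos
        rw [← Nat.succ_injective hz]
        exact hSlt k (hk' hpos)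
      have hyn : y ≤ n := by
        by_contra hcon
        have := hSn (hyS (y - 1) (by omega))
        rw [Finset.mem_range] at this
        omega
      -- The list contains no `u`, so the new code of `u` is never its own, and `u` keeps looking
      -- like a non-center.
      have hyu : y ≠ u + 1 := by
        intro h
        have := hyS u h
        exact notMem_nb_self (Finset.mem_filter.1 this).1
      have hun := hR.toRep.code_le u.2
      -- the decision in terms of options
      have hT : ((if ins = true then decode n y else (configOf n s.arr).2 u) = some v) ↔
          ((if 0 < (if ins = true then 1 else 0) then y else r.arr 1 u) = (v : ℕ) + 1) := by
        by_cases hi : ins = true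
        · simp only [hi, if_true, zero_lt_one]
          exact decode_eq_some hyn
        · simp only [hi, if_false, lt_irrefl, Bool.false_eq_true]
          rw [b1]
          exact decode_eq_some hun
      have hq9 : q.arr 9 = s.arr 9 := by rw [d3 9 (by omega) (by omega), b9]
      have hq₀time : q₀.time ≤ 126 * L := by
        have e1 := Nat.size_le_size (c3.ok.1 19)
        have e2 := Nat.size_le_size hkM
        simp only [State.mem_reg] at e1
        have : q₀.time = r.time + (1 + (r.reg 19).size + k.size) := rfl
        have hLe : L = 1 + 3 * ((n + 1) ^ 2).size := rfl
        omega
      have hq₀w : q₀.writes = t.writes := c7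
      refine ⟨q, hq1, ?_, ?_⟩
      · unfold configOf
        refine Prod.ext (by simp only [hq9]) ?_
        funext w
        dsimp only
        by_cases hd : (if ins = true then decode n y else (configOf n s.arr).2 u) = some v
        · have hd' := hd
          simp only [configOf] at hd'
          rw [d4 (hT.1 hd), if_pos hd', b1]
          by_cases hwu : w = u
          · subst hwu; simp
          · have : (w : ℕ) ≠ u := fun h => hwu (Fin.val_injective h)
            simp [hwu, this]
        · have hd' := hd
          simp only [configOf] at hd'
          rw [d5 (fun h => hd (hT.2 h)), if_neg hd', b1]
          rw [Function.update_eq_self u (fun v : Fin n => decode n (s.arr 1 v))]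
      · have hqs : ∀ a, a ≠ 0 → a ≠ 1 → q.arr a = r.arr a := d3
        have hrows : ∀ x < n, q.arr 9 x = 0 → RowRep n q.arr 5 x (centerNb G' q.arr x) := by
          intro x hx hx0
          rw [hq9] at hx0
          have hcq : centerNb G' q.arr x = centerNb G' s.arr x := by unfold centerNb; rw [hq9]
          rw [hcq]
          refine RowRep.congr ?_ (hqs 5 (by omega) (by omega)) (hqs 6 (by omega) (by omega))
            (hqs 7 (by omega) (by omega))
          by_cases hxu : x = u
          · rw [hxu]; exact c5
          · have hxv : x ≠ v := by rintro rfl; omega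
            refine c6 x _ hxu (centerNb_subset _ _ _) ?_
            have : centerNb G' s.arr x = centerNb G s.arr x := by
              unfold centerNb; rw [hG.nb_of_ne hxu hxv]
            rw [this]
            exact (hR.centers x hx hx0).congr a5 a6 a7
        have hadj : ∀ x < n, RowRep n q.arr 2 x (nb G' x) := fun x hx =>
          (hRr.adj x hx).congr (hqs 2 (by omega) (by omega)) (hqs 3 (by omega) (by omega))
            (hqs 4 (by omega) (by omega))
        have hcnt : ∀ z, q.arr 8 z = 0 := by rw [hqs 8 (by omega) (by omega)]; exact hRr.cnt
        have hfuu : s.arr 1 u ≠ u + 1 := by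
          intro h
          have := hR.flag u u.2
          rw [if_pos h] at this
          omega
        by_cases hd : (if 0 < (if ins = true then 1 else 0) then y else r.arr 1 u) = (v : ℕ) + 1
        · have hq1' := d4 hd
          rw [b1] at hq1'
          have hrep : FullRep G' q.arr := by
            refine ⟨⟨d6, hadj, fun x hx => ?_, fun x hx z hz => ?_, hcnt⟩, hrows, fun x hx z hz => ?_⟩
            · rw [hq9, hR.flag x hx, hq1']
              by_cases hxu : x = u
              · subst hxu; simp [hfuu, hyu]
              · simp [hxu]
            · rw [hq1'] at hz
              rw [hq9]
              by_cases hxu : x = u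
              · rw [hxu, Function.update_self] at hz
                have := hyS z hz
                exact ⟨by simpa using hSn this, (Finset.mem_filter.1 this).2⟩
              · rw [Function.update_of_ne hxu] at hz
                exact hR.code x hx z hz
            · rw [hq1'] at hz
              by_cases hxu : x = u
              · rw [hxu, Function.update_self] at hz
                rw [hxu]
                exact .inr (Finset.mem_filter.1 (hyS z hz)).1
              · rw [Function.update_of_ne hxu] at hz
                rcases hR.along_of_change hG hle hx hz with h | h | ⟨_, h, _⟩
                · exact .inl h
                · exact .inr h
                · exact absurd h hxu
          have hwr := d7 hd
          rw [b1, hq₀w] at hwr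
          have hstq := d9 hd
          refine ⟨d2.stateRep hrep, hq9, ?_, (nb G' u).card, ?_, ?_, ?_⟩
          · have := hR.toRep.image_card_le (nb_subset G' u)
            omega
          · have : useChoice.steps q₀.mem * L ≤ (30 + 62 * (nb G' u).card) * L :=
              Nat.mul_le_mul_right _ hstq
            rw [← hL] at hq3
            nlinarith
          · have := image_card_le_nb (s.arr 1) (nb G' u)
            have : (if s.arr 1 u = 0 then 0 else 1) ≤ 1 := by split_ifs <;> omega
            omega
          · by_cases hi : ins = true
            · simp only [hi, if_true]
              apply le_changeCost
              simp only [hi, if_true, zero_lt_one] at hd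
              simp only [configOf, hq1', Function.update_self]
              exact (decode_eq_some hyn).2 hd
            · simp only [hi, if_false, Bool.false_eq_true]
              simp only [hi, if_false, Bool.false_eq_true, lt_irrefl] at hd
              refine le_trans (Finset.card_le_card ?_) (le_changeCost (?_ : _ = some v))
              · unfold Change at hG
                rw [if_neg hi] at hG
                rw [hG.nb_left]
                exact Finset.subset_insert _ _
              · rw [b1] at hd
                exact (decode_eq_some hun).2 hd
        · have hq1' := d5 hd
          rw [b1] at hq1'
          have hrep : FullRep G' q.arr := by
            refine ⟨⟨d6, hadj, ?_, ?_, hcnt⟩, hrows, fun x hx z hz => ?_⟩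
            · rw [hq9, hq1']; exact hR.flag
            · rw [hq9, hq1']; exact hR.code
            · rw [hq1'] at hz
              rcases hR.along_of_change hG hle hx hz with h | h | ⟨h, rfl, rfl, _⟩
              · exact .inl h
              · exact .inr h
              -- A vertex contracted along the deleted edge meets the condition for recontraction,
              -- which is excluded in this case.
              · exfalso
                apply hd
                simp [h, b1, hz]
          have hwr := d8 hd
          rw [hq₀w] at hwr
          have hstq := d10 hd
          refine ⟨d2.stateRep hrep, hq9, by omega, 0, ?_, ?_, Nat.zero_le _⟩
          · have : useChoice.steps q₀.mem * L ≤ 30 * L := Nat.mul_le_mul_right _ hstq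
            rw [← hL] at hq3
            omega
          · have : (if s.arr 1 u = 0 then 0 else 1) ≤ 1 := by split_ifs <;> omega
            omega
    -- The result as a total function of the index; indices out of range get the dummy value `t`.
    have key' : ∀ k, ∃ q, k ∈ Finset.range (r.reg 19 + 1) → (
        useChoice.exec ((r.setReg 20 k).charge (1 + (r.reg 19).size + k.size)) = PMF.pure q ∧
        configOf n q.arr = ((configOf n s.arr).1, Function.update (configOf n s.arr).2 u
          (if (if ins = true then decode n (choiceCode n r.arr u S.card k)
              else (configOf n s.arr).2 u) = some v
            then decode n (choiceCode n r.arr u S.card k) else (configOf n s.arr).2 u)) ∧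
        StepBound ins G G' u v s q) := fun k => by
      by_cases hk : k ∈ Finset.range (r.reg 19 + 1)
      · obtain ⟨q, hq⟩ := key k hk
        exact ⟨q, fun _ => hq⟩
      · exact ⟨t, fun h => absurd h hk⟩
    choose f hf using key'
    have hfinal : updateRest.exec t = (PMF.uniformOfFinset (Finset.range (r.reg 19 + 1))
        Finset.nonempty_range_add_one).map f := by
      rw [hexec, hr1, PMF.pure_bind]
      change PMF.bind (PMF.map _ _) _ = _
      rw [PMF.bind_map]
      refine bind_congr_support fun k hk => ?_
      rw [PMF.mem_support_uniformOfFinset_iff] at hk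
      exact (hf k hk).1
    rw [hfinal]
    constructor
    · rw [PMF.map_comp, map_congr_support (g := (fun z => ((configOf n s.arr).1,
          Function.update (configOf n s.arr).2 u z)) ∘
          (fun y => if (if ins = true then y else (configOf n s.arr).2 u) = some v then y
            else (configOf n s.arr).2 u) ∘
          fun k => decode n (choiceCode n r.arr u S.card k)) (fun k hk => by
          rw [PMF.mem_support_uniformOfFinset_iff] at hk
          exact (hf k hk).2.1), ← PMF.map_comp, ← PMF.map_comp]
      have hmc := map_choiceCode hSmap c5 Finset.nonempty_range_add_one
      have hmc' : (PMF.uniformOfFinset (Finset.range (r.reg 19 + 1))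
          Finset.nonempty_range_add_one).map
          (fun k => decode n (choiceCode n r.arr u S.card k)) =
          choiceLaw (centersAt G' (configOf n s.arr).1 u) := by
        rw [← hmc]
        congr 2
        rw [c9]
      rw [hmc']
      unfold updateKernel
      rw [if_pos ⟨huR, hvR⟩]
      rfl
    · intro q hq
      rw [PMF.mem_support_map_iff] at hq
      obtain ⟨k, hk, rfl⟩ := hq
      rw [PMF.mem_support_uniformOfFinset_iff] at hk
      exact (hf k hk).2.2
  · have hexec : updateRest.exec t = PMF.pure (t.charge c) := if_neg hlt
    have hfeq : s.arr 9 u = s.arr 9 v := by omega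
    rw [hexec, PMF.pure_map]
    have hkern : updateKernel G' ins u v (configOf n s.arr) = PMF.pure (configOf n s.arr) := by
      unfold updateKernel
      rw [if_neg, if_neg]
      · rw [mem_configOf, mem_configOf]; omega
      · rw [mem_configOf, mem_configOf]; omega
    refine ⟨by rw [hkern]; exact congrArg _ hconf, fun r hr => ?_⟩
    rw [PMF.mem_support_pure_iff] at hr
    subst hr
    have harr' : (t.charge c).arr = t.arr := rfl
    have hrep : FullRep G' t.arr := by
      refine ⟨hR', fun x hx hx0 => ?_, fun x hx y hxy => ?_⟩
      · rw [hcn]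
        rw [a9] at hx0
        have : centerNb G' s.arr x = centerNb G s.arr x := by
          by_cases hxu : x = u
          · rw [hxu]
            exact hG.centerNb_eq (by rw [← hfeq, ← hxu, hx0]; omega)
          · by_cases hxv : x = v
            · rw [hxv]
              exact hG.symm.centerNb_eq (by rw [hfeq, ← hxv, hx0]; omega)
            · unfold centerNb; rw [hG.nb_of_ne hxu hxv]
        rw [this]
        exact (hR.centers x hx hx0).congr a5 a6 a7
      · rw [a1] at hxy
        rcases hR.along_of_change hG hle hx hxy with h | h | ⟨_, _, _, h⟩
        · exact .inl h
        · exact .inr h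
        · omega
    have htw : (t.charge c).writes = t.writes := rfl
    have htt : (t.charge c).time = t.time + c := rfl
    refine ⟨Base.stateRep (s := t.charge c) hb hrep, a9, by omega, 0, by omega, ?_, Nat.zero_le _⟩
    have : (if s.arr 1 u = 0 then 0 else 1) ≤ 1 := by split_ifs <;> omega
    omega

/-- The distribution and the bounds of one update. -/
theorem updateProg_spec {s : State} (hG : Change ins G G' u v) (hb : Base n s.mem)
    (hR : FullRep G s.arr) (h0 : s.reg 0 = u) (h1 : s.reg 1 = v)
    (h2 : s.reg 2 = if ins = true then 1 else 0) (htime : s.time = 0) (hw : s.writes = 0) :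
    (updateProg.exec s).map (fun r => configOf n r.arr) =
      updateKernel G' ins u v (configOf n s.arr) ∧
    ∀ r ∈ (updateProg.exec s).support, StepBound ins G G' u v s r := by
  obtain ⟨c1, u', v', huv, hle, e0, e1, e2, e24, e25, hb', hR', harr, hwr⟩ :=
    changeEdge_spec (m := s.mem) hG hb hR.toRep h0 h1 h2
  obtain ⟨t, ht1, ht2, ht3⟩ := exec_eq_pure changeEdge_det hb.ok c1
  rw [← ht2] at e0 e1 e2 e24 e25 hb' hR' harr hwr
  simp only [State.mem_reg, State.mem_arr, State.mem_writes] at e0 e1 e2 e24 e25 hR' harr hwr hle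
  have hexec : updateProg.exec s = updateRest.exec t := by
    change (changeEdge.exec s).bind updateRest.exec = _
    rw [ht1, PMF.pure_bind]
  rw [hexec]
  have hst : changeEdge.steps s.mem ≤ 100 :=
    (Prog.steps_le_len _ _ changeEdge_flat).trans (by decide)
  have htt : t.time ≤ 100 * unitCost ((n + 1) ^ 2) := by
    have := Nat.mul_le_mul_right (unitCost ((n + 1) ^ 2)) hst
    omega
  rw [hw, zero_add] at hwr
  rcases huv with ⟨rfl, rfl⟩ | ⟨rfl, rfl⟩
  · exact updateRest_spec hG hR hle e0 e1 (by rw [e2, h2]) e24 e25 hb' hR' harr hwr htt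
  · obtain ⟨q1, q2⟩ := updateRest_spec hG.symm hR hle e0 e1 (by rw [e2, h2]) e24 e25 hb' hR' harr
      hwr htt
    exact ⟨by rw [q1, updateKernel_comm], fun r hr => (q2 r hr).comm⟩

end Step

/-! ### The distribution of centers and contraction map -/

section Product

variable {ι β : Type*} [Fintype ι] [DecidableEq ι] [Fintype β]

theorem sum_prod_apply (f : ι → β → ℝ≥0∞) : ∑ g : ι → β, ∏ i, f i (g i) = ∏ i, ∑ x, f i x := by
  rw [Finset.prod_univ_sum, Fintype.piFinset_univ]

theorem PMF_sum_eq_one (p : PMF β) : ∑ x, p x = 1 := by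
  rw [← tsum_fintype (L := .unconditional _)]
  exact p.tsum_coe

/-- Independent choices. -/
noncomputable def piLaw (ν : ι → PMF β) : PMF (ι → β) :=
  PMF.ofFintype (fun g => ∏ i, ν i (g i)) (by
    rw [sum_prod_apply fun i x => ν i x]
    simp [PMF_sum_eq_one])

theorem piLaw_apply (ν : ι → PMF β) (g : ι → β) : piLaw ν g = ∏ i, ν i (g i) := rfl

variable [DecidableEq β]

/-- If the choice for `u` is changed by a Markov kernel, independent choices result again. -/
theorem piLaw_bind_update (ν : ι → PMF β) (u : ι) (k : β → PMF β) :
    ((piLaw ν).bind fun g => (k (g u)).map fun z => Function.update g u z) =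
      piLaw (Function.update ν u ((ν u).bind k)) := by
  ext g'
  have hk : ∀ x, ((k x).map fun z => Function.update (Function.update g' u x) u z) g' =
      k x (g' u) := by
    intro x
    rw [PMF.map_apply, tsum_eq_single (g' u)]
    · simp
    · intro z hz
      rw [if_neg]
      intro h
      apply hz
      have := congrFun h u
      simpa using this.symm
  rw [PMF.bind_apply, tsum_fintype, piLaw_apply]
  have hinj : Function.Injective fun x => Function.update g' u x := Function.update_injective g' u
  -- Only those `g` contribute that agree with `g'` away from `u`; they are parametrized by their
  -- value at `u`.
  rw [← Finset.sum_subset (Finset.subset_univ (Finset.univ.image fun x => Function.update g' u x)),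
    Finset.sum_image (fun a _ b _ h => hinj h)]
  · simp only [Function.update_self, hk, piLaw_apply]
    rw [← Finset.mul_prod_erase Finset.univ _ (Finset.mem_univ u), Function.update_self,
      PMF.bind_apply, tsum_fintype, Finset.sum_mul]
    refine Finset.sum_congr rfl fun x _ => ?_
    rw [← Finset.mul_prod_erase Finset.univ _ (Finset.mem_univ u), Function.update_self]
    have : ∏ i ∈ Finset.univ.erase u, ν i (Function.update g' u x i) =
        ∏ i ∈ Finset.univ.erase u, Function.update ν u ((ν u).bind k) i (g' i) := by
      refine Finset.prod_congr rfl fun i hi => ?_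
      have hiu := Finset.ne_of_mem_erase hi
      rw [Function.update_of_ne hiu, Function.update_of_ne hiu]
    rw [this]
    ring
  · intro g _ hg
    suffices ((k (g u)).map fun z => Function.update g u z) g' = 0 by rw [this, mul_zero]
    rw [PMF.map_apply, ENNReal.tsum_eq_zero]
    intro z
    rw [if_neg]
    intro h
    apply hg
    refine Finset.mem_image.2 ⟨g u, Finset.mem_univ _, ?_⟩
    rw [h, Function.update_idem, Function.update_eq_self]

/-- Put the indicator of the prescribed value into the factor of `u` and exchange sum and product:
all other factors sum to one. -/
theorem piLaw_map_eval (ν : ι → PMF β) (u : ι) : (piLaw ν).map (fun g => g u) = ν u := by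
  ext x
  rw [PMF.map_apply, tsum_fintype]
  have h := sum_prod_apply fun i y => if i = u then (if x = y then ν i y else 0) else ν i y
  have h1 : ∀ g : ι → β, (if x = g u then piLaw ν g else 0) =
      ∏ i, if i = u then (if x = g i then ν i (g i) else 0) else ν i (g i) := by
    intro g
    split_ifs with hx
    · rw [piLaw_apply]
      refine Finset.prod_congr rfl fun i _ => ?_
      split_ifs with h1 h2
      · rfl
      · subst h1; exact absurd hx h2
      · rfl
    · symm
      apply Finset.prod_eq_zero (Finset.mem_univ u)
      simp [hx]
  refine (Finset.sum_congr rfl fun g _ => ?_).trans (h.trans ?_)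
  · rw [← h1 g]
    split_ifs <;> rfl
  rw [← Finset.mul_prod_erase Finset.univ _ (Finset.mem_univ u)]
  rw [Finset.prod_eq_one, mul_one]
  · simp
  · intro i hi
    simp [Finset.ne_of_mem_erase hi, PMF_sum_eq_one]

end Product

/-! ### Reservoir sampling on a changing set -/

section Choice

variable {β : Type*} [DecidableEq β]

theorem choiceLaw_bind_apply {γ : Type*} (S : Finset β) (F : Option β → PMF γ) (z : γ) :
    (choiceLaw S).bind F z =
      if S = ∅ then F none z else (S.card : ℝ≥0∞)⁻¹ * ∑ a ∈ S, F (some a) z := by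
  unfold choiceLaw
  split_ifs with h1 h2 h2
  · exact absurd h2 h1.ne_empty
  · rw [PMF.bind_map, PMF.bind_apply, tsum_eq_sum (s := S)]
    · rw [Finset.mul_sum]
      refine Finset.sum_congr rfl fun a ha => ?_
      rw [PMF.uniformOfFinset_apply_of_mem h1 ha]
      rfl
    · intro a ha
      rw [PMF.uniformOfFinset_apply_of_notMem h1 ha, zero_mul]
  · rw [PMF.pure_bind]
  · exact absurd (Finset.not_nonempty_iff_eq_empty.1 h1) h2

theorem choiceLaw_apply_none (S : Finset β) : choiceLaw S none = if S = ∅ then 1 else 0 := by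
  have := choiceLaw_bind_apply S PMF.pure none
  rw [PMF.bind_pure] at this
  rw [this]
  simp

theorem choiceLaw_apply_some (S : Finset β) (a : β) :
    choiceLaw S (some a) = if a ∈ S then (S.card : ℝ≥0∞)⁻¹ else 0 := by
  have := choiceLaw_bind_apply S PMF.pure (some a)
  rw [PMF.bind_pure] at this
  rw [this]
  by_cases hS : S = ∅
  · simp [hS]
  · simp [hS, PMF.pure_apply]

/-- The balance for a deletion: an element of the remaining `s` is reached either as the old choice
or, if the deleted element had been chosen, as the fresh one. -/
theorem inv_succ_mul_inv_add {s : ℕ} (hs : s ≠ 0) :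
    ((s : ℝ≥0∞) + 1)⁻¹ * ((s : ℝ≥0∞)⁻¹ + 1) = (s : ℝ≥0∞)⁻¹ := by
  have h0 : (s : ℝ≥0∞) ≠ 0 := by exact_mod_cast hs
  have h1 : (s : ℝ≥0∞) ≠ ∞ := ENNReal.natCast_ne_top s
  have h2 : (s : ℝ≥0∞) + 1 ≠ 0 := by simp
  have h3 : (s : ℝ≥0∞) + 1 ≠ ∞ := by simp
  have h4 : (s : ℝ≥0∞)⁻¹ + 1 = ((s : ℝ≥0∞) + 1) * (s : ℝ≥0∞)⁻¹ := by
    rw [add_mul, ENNReal.mul_inv_cancel h0 h1, one_mul, add_comm]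
  rw [h4, ← mul_assoc, ENNReal.inv_mul_cancel h2 h3, one_mul]

/-- With `s` old elements, the new one is taken with probability `1 / (s + 1)`, and each old one
survives with probability `s / (s + 1) * (1 / s)`. If there were none, the draw is certain to give
the new element. -/
theorem choiceLaw_bind_insert {S : Finset β} {v : β} (hv : v ∉ S) :
    ((choiceLaw S).bind fun x => (choiceLaw (insert v S)).map fun y =>
      if y = some v then y else x) = choiceLaw (insert v S) := by
  -- The two draws are independent, so the later one may be made first; the outcome is then either
  -- fixed or the untouched old choice.
  have hcomm : ((choiceLaw S).bind fun x => (choiceLaw (insert v S)).map fun y =>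
      if y = some v then y else x) = (choiceLaw (insert v S)).bind fun y =>
        if y = some v then PMF.pure (some v) else choiceLaw S := by
    have := PMF.bind_comm (choiceLaw S) (choiceLaw (insert v S))
      fun x y => PMF.pure (if y = some v then y else x)
    refine Eq.trans this (congrArg _ (funext fun y => ?_))
    split_ifs with h
    · rw [PMF.bind_const, h]
    · rw [PMF.bind_pure]
  rw [hcomm]
  have hcard : ((insert v S).card : ℝ≥0∞) = (S.card : ℝ≥0∞) + 1 := by
    rw [Finset.card_insert_of_notMem hv]; push_cast; rfl
  ext z
  rw [choiceLaw_bind_apply, if_neg (Finset.insert_ne_empty v S), Finset.sum_insert hv, if_pos rfl,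
    Finset.sum_congr rfl (g := fun _ => choiceLaw S z) (fun a ha => by
      rw [if_neg]
      intro h
      exact hv (Option.some_injective _ h ▸ ha)), Finset.sum_const, nsmul_eq_mul, hcard]
  rcases z with _ | a
  · rw [choiceLaw_apply_none, choiceLaw_apply_none, if_neg (Finset.insert_ne_empty v S)]
    by_cases hS : S = ∅
    · simp [hS]
    · simp [hS]
  · rw [choiceLaw_apply_some, choiceLaw_apply_some, hcard]
    by_cases hav : a = v
    · subst hav
      simp [hv]
    · by_cases ha : a ∈ S
      · have h0 : (S.card : ℝ≥0∞) ≠ 0 := by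
          exact_mod_cast Finset.card_ne_zero_of_mem ha
        simp [ha, hav, PMF.pure_apply, ENNReal.mul_inv_cancel h0 (ENNReal.natCast_ne_top _)]
      · simp [ha, hav, PMF.pure_apply]

/-- Given that the old choice is not the deleted element, it is uniform on the rest; otherwise it is
replaced by a fresh choice, which is uniform on the rest as well. -/
theorem choiceLaw_bind_erase {S : Finset β} {v : β} (hv : v ∉ S) :
    ((choiceLaw (insert v S)).bind fun x => (choiceLaw S).map fun y =>
      if x = some v then y else x) = choiceLaw S := by
  have hcard : ((insert v S).card : ℝ≥0∞) = (S.card : ℝ≥0∞) + 1 := by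
    rw [Finset.card_insert_of_notMem hv]; push_cast; rfl
  ext z
  rw [choiceLaw_bind_apply, if_neg (Finset.insert_ne_empty v S), Finset.sum_insert hv, hcard,
    Finset.sum_congr rfl (g := fun a => (PMF.pure (some a) : PMF (Option β)) z) (fun a ha => by
      have : some a ≠ some v := fun h => hv (Option.some_injective _ h ▸ ha)
      simp only [if_neg this]
      rw [show (fun _ : Option β => some a) = Function.const _ (some a) from rfl, PMF.map_const])]
  simp only [if_true]
  rw [show (fun y : Option β => y) = id from rfl, PMF.map_id]
  rcases z with _ | a
  · rw [choiceLaw_apply_none]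
    by_cases hS : S = ∅
    · simp [hS]
    · simp [hS, PMF.pure_apply]
  · rw [choiceLaw_apply_some]
    by_cases ha : a ∈ S
    · simp only [ha, if_true, PMF.pure_apply, Option.some_inj, Finset.sum_ite_eq]
      exact inv_succ_mul_inv_add (Finset.card_ne_zero_of_mem ha)
    · simp [ha, PMF.pure_apply]

end Choice

/-! ### Joint law of centers and targets, and its exchangeability -/

section Joint

variable {n : ℕ} {ins : Bool} {G G' : SimpleGraph (Fin n)} {u v : Fin n}

/-- The joint distribution of centers and contraction map, where `q` is the distribution of the set
of centers. -/
noncomputable def jointLaw (q : PMF (Finset (Fin n))) (G : SimpleGraph (Fin n)) : PMF (Config n) :=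
  q.bind fun R => (piLaw (vertexLaw G R)).map fun g => (R, g)

theorem mem_centersAt {R : Finset (Fin n)} {w : Fin n} :
    w ∈ centersAt G R v ↔ G.Adj v w ∧ w ∈ R := by simp [centersAt]

theorem AddEdge.centersAt_left {R : Finset (Fin n)} (h : AddEdge G G' u v) (hv : v ∈ R) :
    centersAt G' R u = insert v (centersAt G R u) := by
  ext w
  rw [Finset.mem_insert, mem_centersAt, mem_centersAt, h.adj]
  constructor
  · rintro ⟨h1 | h1 | h1, h2⟩
    · exact .inr ⟨h1, h2⟩
    · exact .inl h1.2
    · exact absurd h1.1 h.ne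
  · rintro (rfl | ⟨h1, h2⟩)
    · exact ⟨.inr (.inl ⟨rfl, rfl⟩), hv⟩
    · exact ⟨.inl h1, h2⟩

theorem AddEdge.notMem_centersAt {R : Finset (Fin n)} (h : AddEdge G G' u v) :
    v ∉ centersAt G R u := fun h' => h.not (mem_centersAt.1 h').1

theorem AddEdge.centersAt_eq {R : Finset (Fin n)} (h : AddEdge G G' u v) {w : Fin n}
    (hu : w = u → v ∉ R) (hv : w = v → u ∉ R) : centersAt G' R w = centersAt G R w := by
  ext x
  rw [mem_centersAt, mem_centersAt, h.adj]
  constructor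
  · rintro ⟨h1 | ⟨h1, rfl⟩ | ⟨h1, rfl⟩, h2⟩
    · exact ⟨h1, h2⟩
    · exact absurd h2 (hu h1)
    · exact absurd h2 (hv h1)
  · rintro ⟨h1, h2⟩
    exact ⟨.inl h1, h2⟩

theorem Change.centersAt_eq {R : Finset (Fin n)} (h : Change ins G G' u v) {w : Fin n}
    (hu : w = u → v ∉ R) (hv : w = v → u ∉ R) : centersAt G' R w = centersAt G R w := by
  unfold Change at h
  split_ifs at h
  · exact h.centersAt_eq hu hv
  · exact (h.centersAt_eq hu hv).symm

theorem choiceLaw_bind_resample {R : Finset (Fin n)} (h : Change ins G G' u v) (hv : v ∈ R) :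
    (choiceLaw (centersAt G R u)).bind (resample (centersAt G' R u) ins v) =
      choiceLaw (centersAt G' R u) := by
  unfold Change at h
  split_ifs at h with hi
  · subst hi
    rw [h.centersAt_left hv]
    exact choiceLaw_bind_insert h.notMem_centersAt
  · obtain rfl : ins = false := by simpa using hi
    rw [h.centersAt_left hv]
    exact choiceLaw_bind_erase h.notMem_centersAt

/-- Only the law of the target of `u` has to change: the other end `v` is a center, whose target is
itself in any graph, and no other vertex sees the edge. -/
theorem piLaw_bind_resampleAt {R : Finset (Fin n)} (h : Change ins G G' u v) (hu : u ∉ R)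
    (hv : v ∈ R) :
    ((piLaw (vertexLaw G R)).bind fun g => resampleAt G' ins u v (R, g)) =
      (piLaw (vertexLaw G' R)).map fun g => (R, g) := by
  have h1 := piLaw_bind_update (vertexLaw G R) u (resample (centersAt G' R u) ins v)
  have h2 : Function.update (vertexLaw G R) u
      ((vertexLaw G R u).bind (resample (centersAt G' R u) ins v)) = vertexLaw G' R := by
    funext w
    by_cases hw : w = u
    · subst hw
      rw [Function.update_self, vertexLaw, vertexLaw, if_neg hu, if_neg hu,
        choiceLaw_bind_resample h hv]
    · rw [Function.update_of_ne hw, vertexLaw, vertexLaw]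
      split_ifs with hwR
      · rfl
      · rw [h.centersAt_eq (fun h => absurd h hw) (fun h => absurd (h ▸ hv) hwR)]
  rw [h2] at h1
  rw [← h1, PMF.map_bind]
  refine congrArg _ (funext fun g => ?_)
  rw [PMF.map_comp]
  rfl

/-- One update preserves the form of the joint distribution. -/
theorem jointLaw_bind_updateKernel (q : PMF (Finset (Fin n))) (h : Change ins G G' u v) :
    (jointLaw q G).bind (updateKernel G' ins u v) = jointLaw q G' := by
  unfold jointLaw
  rw [PMF.bind_bind]
  refine congrArg _ (funext fun R => ?_)
  rw [PMF.bind_map]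
  by_cases h1 : u ∉ R ∧ v ∈ R
  · rw [← piLaw_bind_resampleAt h h1.1 h1.2]
    refine congrArg _ (funext fun g => ?_)
    simp only [Function.comp, updateKernel]
    rw [if_pos h1]
  · by_cases h2 : u ∈ R ∧ v ∉ R
    · rw [← piLaw_bind_resampleAt h.symm h2.2 h2.1]
      refine congrArg _ (funext fun g => ?_)
      simp only [Function.comp, updateKernel]
      rw [if_neg h1, if_pos h2]
    · have hk : updateKernel G' ins u v ∘ (fun g => (R, g)) = PMF.pure ∘ fun g => (R, g) := by
        funext g
        simp only [Function.comp, updateKernel]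
        rw [if_neg h1, if_neg h2]
      rw [hk]
      -- If both ends are centers, each is its own target; if neither is, the edge enters no list of
      -- centers.
      have : vertexLaw G R = vertexLaw G' R := by
        funext w
        rw [vertexLaw, vertexLaw]
        split_ifs with hw
        · rfl
        · rw [h.centersAt_eq]
          · rintro rfl; tauto
          · rintro rfl; tauto
      rw [this]
      rfl

theorem jointLaw_apply (q : PMF (Finset (Fin n))) (G : SimpleGraph (Fin n)) (o : Config n) :
    jointLaw q G o = q o.1 * ∏ w, vertexLaw G o.1 w (o.2 w) := by
  obtain ⟨R, g⟩ := o
  unfold jointLaw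
  rw [PMF.bind_apply, tsum_eq_single R]
  · rw [PMF.map_apply, tsum_eq_single g]
    · simp [piLaw_apply]
    · intro g' hg'
      rw [if_neg]
      intro h
      exact hg' (Prod.ext_iff.1 h).2.symm
  · intro R' hR'
    suffices ((piLaw (vertexLaw G R')).map fun g => (R', g)) (R, g) = 0 by rw [this, mul_zero]
    rw [PMF.map_apply, ENNReal.tsum_eq_zero]
    intro g'
    rw [if_neg]
    intro h
    exact hR' (Prod.ext_iff.1 h).1.symm

theorem jointLaw_map_eval (q : PMF (Finset (Fin n))) (G : SimpleGraph (Fin n)) (u : Fin n) :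
    (jointLaw q G).map (fun o => o.2 u) = q.bind fun R => vertexLaw G R u := by
  unfold jointLaw
  rw [PMF.map_bind]
  refine congrArg _ (funext fun R => ?_)
  rw [PMF.map_comp]
  exact piLaw_map_eval _ _

/-- The transposition of two neighbors of `u` preserves the neighborhood of `u` and fixes `u`, so it
carries choices at `u` for `R` to choices for the transposed set. -/
theorem vertexLaw_swap {v w : Fin n} (hv : G.Adj u v) (hw : G.Adj u w) (R : Finset (Fin n)) :
    vertexLaw G (R.map (Equiv.swap v w).toEmbedding) u (some w) = vertexLaw G R u (some v) := by
  have huv := hv.ne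
  have huw := hw.ne
  have hmem : ∀ x, x ∈ R.map (Equiv.swap v w).toEmbedding ↔ Equiv.swap v w x ∈ R := by
    intro x
    rw [Finset.mem_map_equiv, Equiv.symm_swap]
  have hu : u ∈ R.map (Equiv.swap v w).toEmbedding ↔ u ∈ R := by
    rw [hmem, Equiv.swap_apply_of_ne_of_ne huv huw]
  have hadj : ∀ x, G.Adj u (Equiv.swap v w x) ↔ G.Adj u x := by
    intro x
    rw [Equiv.swap_apply_def]
    split_ifs with h1 h2
    · subst h1; simp [hv, hw]
    · subst h2; simp [hv, hw]
    · rfl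
  have hS : centersAt G (R.map (Equiv.swap v w).toEmbedding) u =
      (centersAt G R u).map (Equiv.swap v w).toEmbedding := by
    ext x
    rw [Finset.mem_map_equiv, Equiv.symm_swap, mem_centersAt, mem_centersAt, hmem, hadj]
  unfold vertexLaw
  by_cases huR : u ∈ R
  · rw [if_pos huR, if_pos (hu.2 huR)]
    simp [PMF.pure_apply, huv.symm, huw.symm]
  · rw [if_neg huR, if_neg (fun h => huR (hu.1 h)), choiceLaw_apply_some, choiceLaw_apply_some, hS,
      Finset.card_map]
    have : (w ∈ (centersAt G R u).map (Equiv.swap v w).toEmbedding) ↔ v ∈ centersAt G R u := by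
      rw [Finset.mem_map_equiv, Equiv.symm_swap, Equiv.swap_apply_right]
    simp only [this]

/-- If the probability of a set of centers depends only on its size, then `u` is contracted into
a given neighbor with probability at most one over the degree. -/
theorem degree_mul_jointLaw_le {q : PMF (Finset (Fin n))}
    (hq : ∀ R R' : Finset (Fin n), R.card = R'.card → q R = q R') (huv : G.Adj u v) :
    ((nb G u).card : ℝ≥0∞) * (jointLaw q G).map (fun o => o.2 u) (some v) ≤ 1 := by
  classical
  rw [jointLaw_map_eval, nb_eq_map, Finset.card_map]
  set p := q.bind fun R => vertexLaw G R u with hp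
  -- Reindex the sum over sets of centers by the transposition; sizes, and hence the weights `q`,
  -- are preserved. The probabilities of all neighbors are thus equal, and their sum is at most one.
  have hsym : ∀ w ∈ G.neighborFinset u, p (some w) = p (some v) := by
    intro w hw
    rw [SimpleGraph.mem_neighborFinset] at hw
    rw [hp, PMF.bind_apply, PMF.bind_apply, tsum_fintype, tsum_fintype]
    symm
    refine Fintype.sum_equiv (Equiv.finsetCongr (Equiv.swap v w)) _ _ fun R => ?_
    rw [Equiv.finsetCongr_apply, vertexLaw_swap huv hw, hq _ R (Finset.card_map _)]
  have h1 : ∑ w ∈ G.neighborFinset u, p (some w) ≤ 1 := by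
    rw [← PMF_sum_eq_one p, Fintype.sum_option]
    refine le_trans ?_ le_add_self
    exact Finset.sum_le_sum_of_subset (Finset.subset_univ _)
  rw [Finset.sum_congr rfl hsym, Finset.sum_const, nsmul_eq_mul] at h1
  exact h1

/-- Degree times probability is at most one in either direction along the edge, which gives the two.
The edge must be present: the uniformity of targets concerns neighbors only. -/
theorem sum_jointLaw_mul_changeCost_le {q : PMF (Finset (Fin n))}
    (hq : ∀ R R' : Finset (Fin n), R.card = R'.card → q R = q R') (huv : G.Adj u v) :
    ∑ o, jointLaw q G o * (changeCost G u v o.2 : ℝ≥0∞) ≤ 2 := by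
  have key : ∀ u v : Fin n, G.Adj u v →
      ∑ o, jointLaw q G o * ((if o.2 u = some v then (nb G u).card else 0 : ℕ) : ℝ≥0∞) ≤ 1 := by
    intro u v huv
    refine le_trans (le_of_eq ?_) (degree_mul_jointLaw_le hq huv)
    rw [PMF.map_apply, tsum_fintype, Finset.mul_sum]
    refine Finset.sum_congr rfl fun o _ => ?_
    by_cases h : o.2 u = some v
    · simp [h, mul_comm]
    · simp [h, Ne.symm h]
  have h2 : (2 : ℝ≥0∞) = 1 + 1 := by norm_num
  rw [h2]
  refine le_trans (le_of_eq ?_) (add_le_add (key u v huv) (key v u huv.symm))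
  rw [← Finset.sum_add_distrib]
  refine Finset.sum_congr rfl fun o _ => ?_
  rw [← mul_add, changeCost]
  push_cast
  rfl

end Joint

/-! ### Initialization: the sampling probability -/

/-- Powers of `1 - 1 / n` in fixed-point arithmetic with denominator `D`. -/
def fixedPow (D n : ℕ) : ℕ → ℕ
  | 0 => D
  | j + 1 => fixedPow D n j * (n - 1) / n

/-- Partial sums of the series of `-log (1 - (1 - 1 / n)) = log n` in fixed-point arithmetic. -/
def fixedLog (D n J : ℕ) : ℕ := ∑ j ∈ Finset.range J, fixedPow D n (j + 1) / (j + 1)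

theorem fixedPow_le (D n j : ℕ) : fixedPow D n j ≤ D := by
  induction j with
  | zero => exact le_rfl
  | succ j ih =>
    simp only [fixedPow]
    rcases Nat.eq_zero_or_pos n with rfl | hn
    · simp
    · refine (Nat.div_le_of_le_mul ?_).trans ih
      rw [mul_comm n]
      exact Nat.mul_le_mul_left _ (Nat.sub_le _ _)

theorem fixedLog_le (D n J : ℕ) : fixedLog D n J ≤ J * D := by
  unfold fixedLog
  refine (Finset.sum_le_card_nsmul _ _ D fun j _ => ?_).trans (by simp)
  exact (Nat.div_le_self _ _).trans (fixedPow_le D n _)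

/-- Double register `6` and count in register `7`, unless register `6` exceeds `n`. -/
def doubleBody : Prog := .ifLt 3 6 .skip (.block [.arith .add 6 6 6, .arith .add 7 7 4])

/-- The next term of the series. -/
def seriesBody : Prog := .block [
  .arith .mul 11 11 14,
  .arith .div 11 11 3,
  .arith .add 13 13 4,
  .arith .div 15 11 13,
  .arith .add 12 12 15]

/-- Compute the bit length of `n` in register `7`. -/
def lengthProg : Prog := .block [
  .const 4 1,
  .arith .add 3 0 5,
  .const 6 1,
  .loop 0 doubleBody]

/-- Compute the denominator in register `9` and the number of terms in register `10`. -/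
def precisionProg (c₀ D₀ : ℕ) : Prog := .block [
  .const 8 c₀,
  .const 9 D₀,
  .loop 8 (.arith .mul 9 9 3),
  .arith .mul 10 7 8,
  .arith .mul 10 10 3]

/-- Compute the fixed-point logarithm of `n` in register `12`. -/
def logProg : Prog := .block [
  .arith .add 11 9 5,
  .arith .sub 14 3 4,
  .loop 10 seriesBody]

/-- Compute the numerator in register `16` and the denominator minus one in register `18` of the
sampling probability. -/
def ratioProg (K : ℕ) : Prog := .block [
  .const 16 K,
  .arith .mul 16 16 12,
  .arith .mul 16 16 2,
  .arith .mul 17 9 1,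
  .arith .sub 18 17 4]

/-- A bound for all numbers that occur in the initialization. -/
def initMax (K c₀ D₀ n a b : ℕ) : ℕ :=
  (2 * n + 1) + c₀ + D₀ * n ^ c₀ * (n + 1) + D₀ + n * c₀ * n + n * c₀ * n * (D₀ * n ^ c₀) +
    K * (n * c₀ * n * (D₀ * n ^ c₀)) * (b + 1) + D₀ * n ^ c₀ * a + 4 * K * n * n * (b + 1) + n * a +
    4 * K + a + b

/-- The registers before the initialization. -/
structure InitRegs (n a b : ℕ) (m : Mem) : Prop where
  r0 : m.reg 0 = n
  r1 : m.reg 1 = a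
  r2 : m.reg 2 = b
  zero : ∀ r, 3 ≤ r → m.reg r = 0
  arr : ∀ x i, m.arr x i = 0

/-- Only counted loops are available, so the doubling is offered `n` times and becomes idle once the
power exceeds `n`. The number of rounds also gives `l ≤ n`. -/
theorem lengthProg_spec {M n : ℕ} {m : Mem} (hok : m.Ok M) (hn : 1 ≤ n) (h0 : m.reg 0 = n)
    (hz : ∀ r, 3 ≤ r → m.reg r = 0) (hM : 2 * n + 1 ≤ M) :
    let m' := lengthProg.run m
    lengthProg.Safe M m ∧ (∀ r, r < 3 ∨ 7 < r → m'.reg r = m.reg r) ∧ m'.arr = m.arr ∧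
    m'.reg 3 = n ∧ m'.reg 4 = 1 ∧ m'.reg 5 = 0 ∧ n < 2 ^ m'.reg 7 ∧ 2 ^ m'.reg 7 ≤ 2 * n ∧
    m'.reg 7 ≤ n ∧ lengthProg.steps m ≤ 4 + 4 * n := by
  intro m'
  set m₁ := (Prog.block [.const 4 1, .arith .add 3 0 5, .const 6 1]).run m with hm₁
  have r3 : m₁.reg 3 = n := by simp [hm₁, Prog.block, Prog.run, ArithOp.eval, h0, hz]
  have r4 : m₁.reg 4 = 1 := by simp [hm₁, Prog.block, Prog.run]
  have r6 : m₁.reg 6 = 1 := by simp [hm₁, Prog.block, Prog.run]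
  have rr : ∀ r, r ≠ 3 → r ≠ 4 → r ≠ 6 → m₁.reg r = m.reg r := by
    intro r f1 f2 f3
    simp [hm₁, Prog.block, Prog.run, f1, f2, f3]
  have s1 : (Prog.block [.const 4 1, .arith .add 3 0 5, .const 6 1]).Safe M m := by
    simp [Prog.block, Prog.run, Prog.Safe, ArithOp.eval, h0, hz]
    omega
  have r0 : m₁.reg 0 = n := by rw [rr 0 (by omega) (by omega) (by omega), h0]
  obtain ⟨g1, g2, g3, g4, g5, g6, g7⟩ := Prog.loop_inv (P := doubleBody) (x := 0)
    (fun i t => (∀ r, r ≠ 6 → r ≠ 7 → t.reg r = m₁.reg r) ∧ t.arr = m₁.arr ∧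
      t.reg 6 = 2 ^ t.reg 7 ∧ t.reg 6 ≤ 2 * n ∧ t.reg 7 ≤ i ∧ (t.reg 7 = i ∨ n < t.reg 6))
    (hok.run s1) ⟨fun _ _ _ => rfl, rfl, by
      rw [r6, rr 7 (by omega) (by omega) (by omega), hz 7 (by omega)]; rfl,
      by change m₁.reg 6 ≤ 2 * n; rw [r6]; omega,
      by rw [rr 7 (by omega) (by omega) (by omega), hz 7 (by omega)],
      .inl (by rw [rr 7 (by omega) (by omega) (by omega), hz 7 (by omega)])⟩ (by
    rintro i hi t - ⟨h1, h2, h3, h4, h5, h6⟩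
    have e3 : t.reg 3 = n := by rw [h1 3 (by omega) (by omega), r3]
    have e4 : t.reg 4 = 1 := by rw [h1 4 (by omega) (by omega), r4]
    by_cases hc : t.reg 3 < t.reg 6
    · have hrun : doubleBody.run t = t := if_pos hc
      rw [hrun]
      exact ⟨⟨fun _ => trivial, fun h => absurd hc h⟩, h1, h2, h3, h4, by omega, .inr (by omega)⟩
    · have hrun : doubleBody.run t = (Prog.block [.arith .add 6 6 6, .arith .add 7 7 4]).run t :=
        if_neg hc
      have e6 : (doubleBody.run t).reg 6 = t.reg 6 + t.reg 6 := by
        rw [hrun]; simp [Prog.block, Prog.run, ArithOp.eval]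
      have e7 : (doubleBody.run t).reg 7 = t.reg 7 + 1 := by
        rw [hrun]; simp [Prog.block, Prog.run, ArithOp.eval, e4]
      refine ⟨⟨fun h => absurd h hc, fun _ => ?_⟩, ?_, ?_, ?_, ?_, ?_, ?_⟩
      · simp [Prog.block, Prog.run, Prog.Safe, ArithOp.eval, e4]
        rw [r0] at hi
        omega
      · intro r f1 f2
        rw [← h1 r f1 f2, hrun]
        simp [Prog.block, Prog.run, f1, f2]
      · rw [← h2, hrun]
        simp [Prog.block, Prog.run]
      · rw [e6, e7, pow_succ]; omega
      · omega
      · omega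
      · left; omega)
  have hm' : m' = (Prog.loop 0 doubleBody).run m₁ := rfl
  rw [r0] at g6 g7
  rw [← hm'] at g2 g3 g4 g5 g6 g7
  refine ⟨⟨s1.1, s1.2.1, s1.2.2.1, g1, trivial⟩, fun r hr => ?_, g3.trans rfl, ?_, ?_, ?_, ?_, ?_,
    g6, ?_⟩
  · rw [g2 r (by omega) (by omega), rr r (by omega) (by omega) (by omega)]
  · rw [g2 3 (by omega) (by omega), r3]
  · rw [g2 4 (by omega) (by omega), r4]
  · rw [g2 5 (by omega) (by omega), rr 5 (by omega) (by omega) (by omega), hz 5 (by omega)]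
  -- If the doubling never stopped, the exponent is `n` itself, and `n < 2 ^ n`.
  · rcases g7 with h | h
    · rw [h]; exact Nat.lt_two_pow_self
    · omega
  · omega
  · have := Prog.steps_loop_le 0 doubleBody m₁ (by simp [doubleBody, Prog.block, Prog.Flat])
    rw [r0] at this
    have hl : doubleBody.len = 3 := rfl
    rw [hl] at this
    have hs : lengthProg.steps m = 1 + (1 + (1 + ((Prog.loop 0 doubleBody).steps m₁ + 0))) := rfl
    omega

/-- The number `l * c₀ * n` of terms is chosen so that the power of `1 - 1 / n` in the remainder of
the series is at most `n ^ (-c₀)`, as `one_sub_inv_pow_le` shows. -/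
theorem precisionProg_spec {M n l : ℕ} (c₀ D₀ : ℕ) {m : Mem} (hok : m.Ok M) (hn : 1 ≤ n)
    (h3 : m.reg 3 = n) (h7 : m.reg 7 = l) (hl : l ≤ n) (hc : c₀ ≤ M) (hD : D₀ * n ^ c₀ ≤ M)
    (hJ : n * c₀ * n ≤ M) :
    let m' := (precisionProg c₀ D₀).run m
    (precisionProg c₀ D₀).Safe M m ∧ (∀ r, r < 8 ∨ 10 < r → m'.reg r = m.reg r) ∧
    m'.arr = m.arr ∧ m'.reg 9 = D₀ * n ^ c₀ ∧ m'.reg 10 = l * c₀ * n ∧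
    (precisionProg c₀ D₀).steps m ≤ 5 + 2 * c₀ := by
  intro m'
  have hD0 : D₀ ≤ M := le_trans (Nat.le_mul_of_pos_right _ (by positivity)) hD
  set m₁ := (Prog.block [.const 8 c₀, .const 9 D₀]).run m with hm₁
  have r8 : m₁.reg 8 = c₀ := by simp [hm₁, Prog.block, Prog.run]
  have r9 : m₁.reg 9 = D₀ := by simp [hm₁, Prog.block, Prog.run]
  have rr : ∀ r, r ≠ 8 → r ≠ 9 → m₁.reg r = m.reg r := by
    intro r f1 f2
    simp [hm₁, Prog.block, Prog.run, f1, f2]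
  have s1 : (Prog.block [.const 8 c₀, .const 9 D₀]).Safe M m := ⟨hc, hD0, trivial⟩
  have hpow : ∀ i ≤ c₀, D₀ * n ^ i ≤ M := fun i hi =>
    (Nat.mul_le_mul_left _ (Nat.pow_le_pow_right hn hi)).trans hD
  obtain ⟨g1, g2, g3, g4⟩ := Prog.loop_inv (P := .arith .mul 9 9 3) (x := 8)
    (fun i t => (∀ r, r ≠ 9 → t.reg r = m₁.reg r) ∧ t.arr = m₁.arr ∧ t.reg 9 = D₀ * n ^ i)
    (hok.run s1) ⟨fun _ _ => rfl, rfl, by simpa using r9⟩ (by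
    rintro i hi t - ⟨h1, h2, h5⟩
    have e3 : t.reg 3 = n := by rw [h1 3 (by omega), rr 3 (by omega) (by omega), h3]
    rw [r8] at hi
    have he : t.reg 9 * t.reg 3 = D₀ * n ^ (i + 1) := by rw [h5, e3, pow_succ, mul_assoc]
    refine ⟨?_, fun r hr => by rw [← h1 r hr]; simp [Prog.run, hr], h2, ?_⟩
    · change t.reg 9 * t.reg 3 ≤ M
      rw [he]
      exact hpow _ hi
    · simp [Prog.run, ArithOp.eval, he])
  set m₂ := (Prog.loop 8 (.arith .mul 9 9 3)).run m₁ with hm₂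
  rw [r8] at g4
  have e7 : m₂.reg 7 = l := by rw [g2 7 (by omega), rr 7 (by omega) (by omega), h7]
  have e8 : m₂.reg 8 = c₀ := by rw [g2 8 (by omega), r8]
  have e3 : m₂.reg 3 = n := by rw [g2 3 (by omega), rr 3 (by omega) (by omega), h3]
  have hJ' : l * c₀ * n ≤ M := le_trans (by gcongr) hJ
  have hm' : m' = (Prog.block [.arith .mul 10 7 8, .arith .mul 10 10 3]).run m₂ := rfl
  refine ⟨⟨s1.1, s1.2.1, g1, ?_, ?_, trivial⟩, fun r hr => ?_, ?_, ?_, ?_, ?_⟩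
  · change m₂.reg 7 * m₂.reg 8 ≤ M
    rw [e7, e8]
    exact le_trans (Nat.le_mul_of_pos_right _ hn) hJ'
  · change Function.update m₂.reg 10 (m₂.reg 7 * m₂.reg 8) 10 *
      Function.update m₂.reg 10 (m₂.reg 7 * m₂.reg 8) 3 ≤ M
    simpa [e7, e8, e3] using hJ'
  · have f : r ≠ 10 := by omega
    rw [← rr r (by omega) (by omega), ← g2 r (by omega), hm']
    simp [Prog.block, Prog.run, f]
  · exact g3
  · rw [hm', ← g4]
    simp [Prog.block, Prog.run]
  · rw [hm']
    simp [Prog.block, Prog.run, ArithOp.eval, e7, e8, e3]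
  · have := Prog.steps_loop_le 8 (.arith .mul 9 9 3) m₁ trivial
    rw [r8] at this
    have hl : (Prog.arith .mul 9 9 3).len = 1 := rfl
    rw [hl] at this
    have hs : (precisionProg c₀ D₀).steps m = 1 + (1 + ((Prog.loop 8 (.arith .mul 9 9 3)).steps m₁ +
      (1 + (1 + 0)))) := rfl
    omega

/-- The loop follows the recursions of `fixedPow` and `fixedLog` literally, so the machine result is
exactly the fixed-point value; its distance to the logarithm is a separate, analytic question. -/
theorem logProg_spec {M n D J : ℕ} {m : Mem} (hok : m.Ok M)
    (h3 : m.reg 3 = n) (h4 : m.reg 4 = 1) (h5 : m.reg 5 = 0) (h9 : m.reg 9 = D)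
    (h10 : m.reg 10 = J) (h12 : m.reg 12 = 0) (h13 : m.reg 13 = 0) (hD : D * (n + 1) ≤ M)
    (hJ : J ≤ M) (hJD : J * D ≤ M) :
    let m' := logProg.run m
    logProg.Safe M m ∧ (∀ r, r < 11 ∨ 15 < r → m'.reg r = m.reg r) ∧
    m'.arr = m.arr ∧ m'.reg 12 = fixedLog D n J ∧ logProg.steps m ≤ 3 + 6 * J := by
  intro m'
  have hn1 : n ≤ M := by rw [← h3]; exact hok.1 3
  have hDM : D ≤ M := by rw [← h9]; exact hok.1 9
  set m₁ := (Prog.block [.arith .add 11 9 5, .arith .sub 14 3 4]).run m with hm₁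
  have r11 : m₁.reg 11 = D := by simp [hm₁, Prog.block, Prog.run, ArithOp.eval, h9, h5]
  have r14 : m₁.reg 14 = n - 1 := by simp [hm₁, Prog.block, Prog.run, ArithOp.eval, h3, h4]
  have rr : ∀ r, r ≠ 11 → r ≠ 14 → m₁.reg r = m.reg r := by
    intro r f1 f2
    simp [hm₁, Prog.block, Prog.run, f1, f2]
  have s1 : (Prog.block [.arith .add 11 9 5, .arith .sub 14 3 4]).Safe M m := by
    simp [Prog.block, Prog.run, Prog.Safe, ArithOp.eval, h3, h4, h5, h9]
    omega
  have r10 : m₁.reg 10 = J := by rw [rr 10 (by omega) (by omega), h10]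
  obtain ⟨g1, g2, g3, -, -, g6⟩ := Prog.loop_inv (P := seriesBody) (x := 10)
    (fun i t => (∀ r, r < 11 ∨ r = 14 ∨ 15 < r → t.reg r = m₁.reg r) ∧ t.arr = m₁.arr ∧
      t.reg 11 = fixedPow D n i ∧ t.reg 13 = i ∧ t.reg 12 = fixedLog D n i)
    (hok.run s1) ⟨fun _ _ => rfl, rfl, r11, by rw [rr 13 (by omega) (by omega), h13],
      by rw [rr 12 (by omega) (by omega), h12]; simp [fixedLog]⟩ (by
    rintro i hi t - ⟨k1, k2, k3, k4, k5⟩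
    rw [r10] at hi
    have e3 : t.reg 3 = n := by rw [k1 3 (by omega), rr 3 (by omega) (by omega), h3]
    have e4 : t.reg 4 = 1 := by rw [k1 4 (by omega), rr 4 (by omega) (by omega), h4]
    have e14 : t.reg 14 = n - 1 := by rw [k1 14 (by omega), r14]
    have hp := fixedPow_le D n i
    have hp1 : fixedPow D n i * (n - 1) / n ≤ D := fixedPow_le D n (i + 1)
    have hl := fixedLog_le D n (i + 1)
    have hl' : fixedLog D n (i + 1) ≤ M := hl.trans (le_trans (Nat.mul_le_mul_right _ hi) hJD)
    have hlog : fixedLog D n (i + 1) =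
        fixedLog D n i + fixedPow D n i * (n - 1) / n / (i + 1) := by
      simp [fixedLog, Finset.sum_range_succ, fixedPow]
    refine ⟨?_, fun r hr => ?_, ?_, ?_, ?_, ?_⟩
    · simp only [seriesBody, Prog.block, Prog.run, Prog.Safe, ArithOp.eval]
      simp [k3, k4, k5, e3, e4, e14]
      refine ⟨?_, hp1.trans hDM, by omega, ?_, by rw [← hlog]; exact hl'⟩
      · refine le_trans ?_ hD
        exact Nat.mul_le_mul hp (by omega)
      · exact (Nat.div_le_self _ _).trans (hp1.trans hDM)
    · have f1 : r ≠ 11 := by omega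
      have f2 : r ≠ 12 := by omega
      have f3 : r ≠ 13 := by omega
      have f4 : r ≠ 15 := by omega
      rw [← k1 r hr]
      simp [seriesBody, Prog.block, Prog.run, f1, f2, f3, f4]
    · rw [← k2]
      simp [seriesBody, Prog.block, Prog.run]
    · simp [seriesBody, Prog.block, Prog.run, ArithOp.eval, k3, e3, e14, fixedPow]
    · simp [seriesBody, Prog.block, Prog.run, ArithOp.eval, k4, e4]
    · rw [hlog]
      simp [seriesBody, Prog.block, Prog.run, ArithOp.eval, k3, k4, k5, e3, e4, e14])
  have hm' : m' = (Prog.loop 10 seriesBody).run m₁ := rfl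
  rw [← hm'] at g2 g3 g6
  rw [r10] at g6
  refine ⟨⟨s1.1, s1.2.1, g1, trivial⟩, fun r hr => ?_, g3, g6, ?_⟩
  · rw [g2 r (by omega), rr r (by omega) (by omega)]
  · have := Prog.steps_loop_le 10 seriesBody m₁ (by simp [seriesBody, Prog.block, Prog.Flat])
    rw [r10] at this
    have hl : seriesBody.len = 5 := rfl
    rw [hl] at this
    have hs : logProg.steps m = 1 + (1 + ((Prog.loop 10 seriesBody).steps m₁ + 0)) := rfl
    omega

theorem ratioProg_spec {M K D Q a b : ℕ} {m : Mem} (h1 : m.reg 1 = a) (h2 : m.reg 2 = b)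
    (h4 : m.reg 4 = 1) (h9 : m.reg 9 = D) (h12 : m.reg 12 = Q) (hK : K ≤ M) (hKQ : K * Q ≤ M)
    (hKQb : K * Q * b ≤ M) (hDa : D * a ≤ M) :
    let m' := (ratioProg K).run m
    (ratioProg K).Safe M m ∧ (∀ r, r < 16 ∨ 18 < r → m'.reg r = m.reg r) ∧ m'.arr = m.arr ∧
    m'.reg 16 = K * Q * b ∧ m'.reg 18 = D * a - 1 ∧ (ratioProg K).steps m = 5 := by
  refine ⟨?_, fun r hr => ?_, ?_, ?_, ?_, rfl⟩
  · simp [ratioProg, Prog.block, Prog.run, Prog.Safe, ArithOp.eval, h1, h2, h4, h9, h12]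
    omega
  · have f1 : r ≠ 16 := by omega
    have f2 : r ≠ 17 := by omega
    have f3 : r ≠ 18 := by omega
    simp [ratioProg, Prog.block, Prog.run, f1, f2, f3]
  · simp [ratioProg, Prog.block, Prog.run]
  · simp [ratioProg, Prog.block, Prog.run, ArithOp.eval, h2, h12]
  · simp [ratioProg, Prog.block, Prog.run, ArithOp.eval, h1, h4, h9]

/-- The deterministic first part of the initialization. -/
def setupProg (K c₀ D₀ : ℕ) : Prog :=
  .block [lengthProg, precisionProg c₀ D₀, logProg, ratioProg K]

theorem setupProg_det (K c₀ D₀ : ℕ) : (setupProg K c₀ D₀).Det := by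
  simp [setupProg, lengthProg, precisionProg, logProg, ratioProg, doubleBody, seriesBody,
    Prog.block, Prog.Det]

theorem setupProg_spec (K c₀ D₀ : ℕ) {n a b : ℕ} {m : Mem} (hn : 1 ≤ n) (h : InitRegs n a b m)
    (hok : m.Ok (initMax K c₀ D₀ n a b)) :
    let m' := (setupProg K c₀ D₀).run m
    (setupProg K c₀ D₀).Safe (initMax K c₀ D₀ n a b) m ∧
    ∃ l, n < 2 ^ l ∧ 2 ^ l ≤ 2 * n ∧ l ≤ n ∧ m'.reg 0 = n ∧ m'.reg 1 = a ∧ m'.reg 2 = b ∧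
      m'.reg 3 = n ∧ m'.reg 4 = 1 ∧ m'.reg 5 = 0 ∧ m'.reg 7 = l ∧
      m'.reg 16 = K * fixedLog (D₀ * n ^ c₀) n (l * c₀ * n) * b ∧
      m'.reg 18 = D₀ * n ^ c₀ * a - 1 ∧ (∀ r, 18 < r → m'.reg r = 0) ∧
      (∀ x i, m'.arr x i = 0) ∧
      (setupProg K c₀ D₀).steps m ≤ 17 + 4 * n + 2 * c₀ + 6 * (l * c₀ * n) := by
  intro m'
  set M := initMax K c₀ D₀ n a b with hM
  have hMdef : M = (2 * n + 1) + c₀ + D₀ * n ^ c₀ * (n + 1) + D₀ + n * c₀ * n +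
    n * c₀ * n * (D₀ * n ^ c₀) +
    K * (n * c₀ * n * (D₀ * n ^ c₀)) * (b + 1) + D₀ * n ^ c₀ * a + 4 * K * n * n * (b + 1) + n * a +
    4 * K + a + b := rfl
  obtain ⟨a1, a2, a3, a4, a5, a6, a7, a8, a9, a10⟩ := lengthProg_spec hok hn h.r0 h.zero (by omega)
  set m₁ := lengthProg.run m with hm₁
  set l := m₁.reg 7 with hl
  have hD1 : D₀ * n ^ c₀ ≤ M := by
    have : D₀ * n ^ c₀ ≤ D₀ * n ^ c₀ * (n + 1) := Nat.le_mul_of_pos_right _ (by omega)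
    omega
  obtain ⟨b1, b2, b3, b4, b5, b6⟩ := precisionProg_spec (M := M) (n := n) c₀ D₀ (hok.run a1) hn a4
    hl.symm a9 (by omega) hD1 (by omega)
  set m₂ := (precisionProg c₀ D₀).run m₁ with hm₂
  have hJ : l * c₀ * n ≤ n * c₀ * n := by gcongr
  have hJD : l * c₀ * n * (D₀ * n ^ c₀) ≤ n * c₀ * n * (D₀ * n ^ c₀) := by gcongr
  obtain ⟨c1, c2, c3, c4, c5⟩ := logProg_spec (M := M) (n := n) (D := D₀ * n ^ c₀)
    (J := l * c₀ * n) (m := m₂) ((hok.run a1).run b1) (by rw [b2 3 (by omega), a4])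
    (by rw [b2 4 (by omega), a5]) (by rw [b2 5 (by omega), a6]) b4 b5
    (by rw [b2 12 (by omega), a2 12 (by omega), h.zero 12 (by omega)])
    (by rw [b2 13 (by omega), a2 13 (by omega), h.zero 13 (by omega)]) (by omega) (by omega)
    (by omega)
  set m₃ := logProg.run m₂ with hm₃
  set Q := fixedLog (D₀ * n ^ c₀) n (l * c₀ * n) with hQ
  have hQle : K * Q ≤ K * (n * c₀ * n * (D₀ * n ^ c₀)) :=
    Nat.mul_le_mul_left _ ((fixedLog_le _ _ _).trans hJD)
  have hQb : K * Q * (b + 1) ≤ K * (n * c₀ * n * (D₀ * n ^ c₀)) * (b + 1) :=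
    Nat.mul_le_mul_right _ hQle
  have hQb1 : K * Q * (b + 1) = K * Q * b + K * Q := by ring
  have rr : ∀ r, r < 3 ∨ 15 < r → m₃.reg r = m.reg r := fun r hr => by
    rw [c2 r (by omega), b2 r (by omega), a2 r (by omega)]
  obtain ⟨d1, d2, d3, d4, d5, d6⟩ := ratioProg_spec (M := M) (K := K) (D := D₀ * n ^ c₀) (Q := Q)
    (a := a) (b := b) (m := m₃) (by rw [rr 1 (by omega), h.r1]) (by rw [rr 2 (by omega), h.r2])
    (by rw [c2 4 (by omega), b2 4 (by omega), a5]) (by rw [c2 9 (by omega), b4]) c4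
    (by omega) (by omega) (by omega) (by omega)
  have hm' : m' = (ratioProg K).run m₃ := rfl
  rw [← hm'] at d2 d3 d4 d5
  refine ⟨⟨a1, b1, c1, d1, trivial⟩, l, a7, a8, a9, ?_, ?_, ?_, ?_, ?_, ?_, ?_, d4, d5,
    fun r hr => ?_, ?_, ?_⟩
  · rw [d2 0 (by omega), rr 0 (by omega), h.r0]
  · rw [d2 1 (by omega), rr 1 (by omega), h.r1]
  · rw [d2 2 (by omega), rr 2 (by omega), h.r2]
  · rw [d2 3 (by omega), c2 3 (by omega), b2 3 (by omega), a4]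
  · rw [d2 4 (by omega), c2 4 (by omega), b2 4 (by omega), a5]
  · rw [d2 5 (by omega), c2 5 (by omega), b2 5 (by omega), a6]
  · rw [d2 7 (by omega), c2 7 (by omega), b2 7 (by omega)]
  · rw [d2 r (by omega), rr r (by omega), h.zero r (by omega)]
  · rw [d3, c3, b3, a3]
    exact h.arr
  · have hs : (setupProg K c₀ D₀).steps m = lengthProg.steps m + ((precisionProg c₀ D₀).steps m₁ +
      (logProg.steps m₂ + ((ratioProg K).steps m₃ + 0))) := rfl
    have e1 : lengthProg.steps m ≤ 4 + 4 * n := a10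
    have e2 : (precisionProg c₀ D₀).steps m₁ ≤ 5 + 2 * c₀ := b6
    have e3 : logProg.steps m₂ ≤ 3 + 6 * (l * c₀ * n) := c5
    have e4 : (ratioProg K).steps m₃ = 5 := d6
    omega

/-! ### Initialization: sampling the centers -/

/-- Verification of a loop with random choices: `φ` is the part of the state whose distribution is
traced, and `Inv` holds for all random choices. -/
theorem Prog.loop_law {P : Prog} {x : ℕ} {s : State} {α : Type*} (φ : State → α)
    (Inv : ℕ → State → Prop) (κ : ℕ → α → PMF α) (μ : ℕ → PMF α)
    (h0 : Inv 0 (s.charge (1 + (s.reg x).size)))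
    (hφ : μ 0 = PMF.pure (φ (s.charge (1 + (s.reg x).size))))
    (hμ : ∀ i < s.reg x, (μ i).bind (κ i) = μ (i + 1))
    (hstep : ∀ i < s.reg x, ∀ t, Inv i t →
      (P.exec (t.charge (1 + (s.reg x).size))).map φ = κ i (φ t) ∧
      ∀ r ∈ (P.exec (t.charge (1 + (s.reg x).size))).support, Inv (i + 1) r) :
    ((Prog.loop x P).exec s).map φ = μ (s.reg x) ∧
    ∀ r ∈ ((Prog.loop x P).exec s).support, Inv (s.reg x) r := by
  set F : PMF State → PMF State :=
    fun μ => μ.bind fun t => P.exec (t.charge (1 + (s.reg x).size)) with hF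
  have key : ∀ i ≤ s.reg x, (F^[i] (PMF.pure (s.charge (1 + (s.reg x).size)))).map φ = μ i ∧
      ∀ r ∈ (F^[i] (PMF.pure (s.charge (1 + (s.reg x).size)))).support, Inv i r := by
    intro i
    induction i with
    | zero =>
      intro _
      refine ⟨by rw [Function.iterate_zero_apply, PMF.pure_map, hφ], fun r hr => ?_⟩
      rw [Function.iterate_zero_apply, PMF.support_pure] at hr
      rw [Set.mem_singleton_iff.1 hr]
      exact h0
    | succ i ih =>
      intro hi
      obtain ⟨h1, h2⟩ := ih (by omega)
      rw [Function.iterate_succ_apply', hF]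
      refine ⟨?_, fun r hr => ?_⟩
      · rw [PMF.map_bind, ← hμ i hi, ← h1, PMF.bind_map]
        exact bind_congr_support fun t ht => (hstep i hi t (h2 t ht)).1
      · obtain ⟨t, ht, hr⟩ := (PMF.mem_support_bind_iff _ _ _).1 hr
        exact (hstep i hi t (h2 t ht)).2 r hr
  exact key _ le_rfl

/-- Make the vertex in register `19` a center if register `21` is less than register `16`. -/
def markProg : Prog := .block [
  .ifLt 21 16 (.block [
    .arith .add 22 19 4,
    .store 1 19 22,
    .store 9 19 4,
    .arith .add 20 20 4]) .skip,
  .arith .add 19 19 4]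

/-- Sample the centers; register `20` counts them. -/
def sampleProg : Prog := .loop 0 (.seq (.rand 21 18) markProg)

/-- The set of vertices that are flagged in an array. -/
def flagged (n : ℕ) (A : ℕ → ℕ) : Fin n → Bool := fun x => decide (A x = 1)

/-- The memory `t` after sampling for the first `i` vertices, starting from `m`. -/
structure Sampled (n i M : ℕ) (m t : Mem) : Prop where
  ok : t.Ok M
  reg : ∀ r, r < 19 ∨ 22 < r → t.reg r = m.reg r
  r19 : t.reg 19 = i
  r20 : t.reg 20 = (Finset.univ.filter fun x : Fin n => t.arr 9 x = 1).card
  flag : ∀ j, t.arr 9 j = 0 ∨ t.arr 9 j = 1 ∧ j < i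
  code : ∀ j, t.arr 1 j = if t.arr 9 j = 1 then j + 1 else 0
  arr : ∀ a, a ≠ 1 → a ≠ 9 → t.arr a = m.arr a

theorem markProg_spec {n i M : ℕ} {m t : Mem} (h : Sampled n i M m t) (hi : i < n) (hM : n ≤ M)
    (h4 : m.reg 4 = 1) {z : ℕ} (hz : z ≤ M) :
    let t₁ : Mem := ⟨Function.update t.reg 21 z, t.arr, t.writes⟩
    let t' := markProg.run t₁
    t₁.Ok M ∧ markProg.Safe M t₁ ∧ Sampled n (i + 1) M m t' ∧
    flagged n (t'.arr 9) =
      Function.update (flagged n (t.arr 9)) ⟨i, hi⟩ (decide (z < m.reg 16)) := by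
  intro t₁ t'
  have hok : t₁.Ok M := ⟨update_le h.ok.1 _ hz, h.ok.2⟩
  have e4 : t.reg 4 = 1 := by rw [h.reg 4 (by omega), h4]
  have e16 : t.reg 16 = m.reg 16 := h.reg 16 (by omega)
  have hfi : t.arr 9 i = 0 := by
    rcases h.flag i with h | h
    · exact h
    · omega
  -- Vertex `i` is not flagged yet, so the counter can be increased without exceeding `n`.
  have hcard : (Finset.univ.filter fun x : Fin n => t.arr 9 x = 1).card + 1 ≤ n := by
    have hlt : (Finset.univ.filter fun x : Fin n => t.arr 9 x = 1).card <
        (Finset.univ : Finset (Fin n)).card := by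
      apply Finset.card_lt_card
      rw [Finset.filter_ssubset]
      exact ⟨⟨i, hi⟩, Finset.mem_univ _, by simp [hfi]⟩
    simpa using hlt
  by_cases hc : z < m.reg 16
  · have hrun : t' = (Prog.block [.arith .add 22 19 4, .store 1 19 22, .store 9 19 4,
        .arith .add 20 20 4, .arith .add 19 19 4]).run t₁ := by
      have : t₁.reg 21 < t₁.reg 16 := by simpa [t₁, e16] using hc
      simp only [t', markProg, Prog.block, Prog.run, this, if_true]
    have hsafe : markProg.Safe M t₁ := by
      simp [markProg, Prog.block, Prog.Safe, Prog.run, ArithOp.eval, t₁, e16, hc, e4, h.r19, h.r20]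
      omega
    have a9 : t'.arr 9 = Function.update (t.arr 9) i 1 := by
      rw [hrun]; simp [Prog.block, Prog.run, ArithOp.eval, t₁, e4, h.r19]
    have a1 : t'.arr 1 = Function.update (t.arr 1) i (i + 1) := by
      rw [hrun]; simp [Prog.block, Prog.run, ArithOp.eval, t₁, e4, h.r19]
    have r20 : t'.reg 20 = t.reg 20 + 1 := by
      rw [hrun]; simp [Prog.block, Prog.run, ArithOp.eval, t₁, e4]
    have hfilt : (Finset.univ.filter fun x : Fin n => t'.arr 9 x = 1) =
        insert ⟨i, hi⟩ (Finset.univ.filter fun x : Fin n => t.arr 9 x = 1) := by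
      ext x
      simp only [Finset.mem_filter, Finset.mem_univ, true_and, Finset.mem_insert, a9]
      by_cases hx : (x : ℕ) = i
      · simp [hx, Fin.ext_iff]
      · simp [hx, Fin.ext_iff]
    refine ⟨hok, hsafe, ⟨hok.run hsafe, fun r hr => ?_, ?_, ?_, fun j => ?_, fun j => ?_,
      fun a ha1 ha9 => ?_⟩, ?_⟩
    · have f1 : r ≠ 19 := by omega
      have f2 : r ≠ 20 := by omega
      have f3 : r ≠ 21 := by omega
      have f4 : r ≠ 22 := by omega
      rw [← h.reg r hr, hrun]
      simp [Prog.block, Prog.run, t₁, f1, f2, f3, f4]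
    · rw [hrun]; simp [Prog.block, Prog.run, ArithOp.eval, t₁, e4, h.r19]
    · rw [r20, h.r20, hfilt, Finset.card_insert_of_notMem (by simp [hfi])]
    · rw [a9]
      by_cases hj : j = i
      · subst hj; simp
      · rw [Function.update_of_ne hj]
        rcases h.flag j with h | h
        · exact .inl h
        · exact .inr ⟨h.1, by omega⟩
    · rw [a9, a1]
      by_cases hj : j = i
      · subst hj; simp
      · rw [Function.update_of_ne hj, Function.update_of_ne hj, h.code]
    · rw [← h.arr a ha1 ha9, hrun]
      simp [Prog.block, Prog.run, t₁, ha1, ha9]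
    · funext x
      by_cases hx : x = ⟨i, hi⟩
      · subst hx; simp [flagged, a9, hc]
      · have : (x : ℕ) ≠ i := fun h => hx (Fin.ext h)
        simp [flagged, a9, hx, this]
  · have hrun : t' = (Prog.arith .add 19 19 4).run t₁ := by
      have : ¬ t₁.reg 21 < t₁.reg 16 := by simpa [t₁, e16] using hc
      simp only [t', markProg, Prog.block, Prog.run, this, if_false]
    have hsafe : markProg.Safe M t₁ := by
      simp [markProg, Prog.block, Prog.Safe, Prog.run, ArithOp.eval, t₁, e16, hc, e4, h.r19]
      omega
    have ha : t'.arr = t.arr := by rw [hrun]; rfl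
    refine ⟨hok, hsafe, ⟨hok.run hsafe, fun r hr => ?_, ?_, ?_, fun j => ?_, fun j => ?_,
      fun a ha1 ha9 => ?_⟩, ?_⟩
    · have f1 : r ≠ 19 := by omega
      have f3 : r ≠ 21 := by omega
      rw [← h.reg r hr, hrun]
      simp [Prog.run, t₁, f1, f3]
    · rw [hrun]; simp [Prog.run, ArithOp.eval, t₁, e4, h.r19]
    · rw [ha, ← h.r20, hrun]; simp [Prog.run, t₁]
    · rw [ha]
      rcases h.flag j with h | h
      · exact .inl h
      · exact .inr ⟨h.1, by omega⟩
    · rw [ha]; exact h.code j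
    · rw [ha]; exact h.arr a ha1 ha9
    · rw [ha]
      funext x
      by_cases hx : x = ⟨i, hi⟩
      · subst hx; simp [flagged, hc, hfi]
      · simp [hx]

/-- A biased coin. -/
noncomputable def coinLaw (T W : ℕ) : PMF Bool :=
  (PMF.uniformOfFinset (Finset.range (W + 1)) Finset.nonempty_range_add_one).map fun z =>
    decide (z < T)

theorem markProg_det : markProg.Det := by simp [markProg, Prog.block, Prog.Det]

theorem markProg_steps (m : Mem) : markProg.steps m ≤ 6 :=
  (Prog.steps_le_len _ _ (by simp [markProg, Prog.block, Prog.Flat])).trans (by decide)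

/-- After `i` rounds the flags are independent, coins for the first `i` vertices and constantly
false for the others. One round is a change of one coordinate by a constant kernel, as in
`piLaw_bind_update`. The factor eight is the loop charge, the draw and at most six instructions of
`markProg`. -/
theorem sampleProg_spec {n M : ℕ} {s : State} (hok : s.mem.Ok M) (hM : n ≤ M) (h0 : s.reg 0 = n)
    (h4 : s.reg 4 = 1) (h19 : s.reg 19 = 0) (h20 : s.reg 20 = 0) (ha : ∀ a i, s.arr a i = 0) :
    (sampleProg.exec s).map (fun t => flagged n (t.arr 9)) =
      piLaw (fun _ => coinLaw (s.reg 16) (s.reg 18)) ∧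
    ∀ t ∈ (sampleProg.exec s).support, Sampled n n M s.mem t.mem ∧
      t.time ≤ s.time + (1 + 8 * n) * unitCost M := by
  set θ := coinLaw (s.reg 16) (s.reg 18) with hθ
  have hsize : ∀ r, (s.reg r).size ≤ M.size := fun r => Nat.size_le_size (hok.1 r)
  have key := Prog.loop_law (P := .seq (.rand 21 18) markProg) (x := 0) (s := s)
    (fun t => flagged n (t.arr 9))
    (fun i t => Sampled n i M s.mem t.mem ∧ t.time ≤ s.time + (1 + 8 * i) * unitCost M)
    (fun i f => if hi : i < n then θ.map fun z => Function.update f ⟨i, hi⟩ z else PMF.pure f)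
    (fun i => piLaw fun x : Fin n => if (x : ℕ) < i then θ else PMF.pure false) ?_ ?_ ?_ ?_
  · rw [h0] at key
    refine ⟨?_, key.2⟩
    unfold sampleProg
    rw [key.1]
    congr 1
    funext x
    rw [if_pos x.2]
  · refine ⟨⟨hok, fun _ _ => rfl, h19, ?_, fun j => .inl (ha 9 j), fun j => ?_, fun _ _ _ => rfl⟩,
      ?_⟩
    · change s.reg 20 = _
      rw [h20]
      simp [ha]
    · simp [ha]
    · have := hsize 0
      simp only [State.charge, unitCost]
      omega
  · ext f
    have : flagged n ((s.charge (1 + (s.reg 0).size)).arr 9) = fun _ => false := by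
      funext x
      simp [flagged, State.charge, ha]
    rw [this, piLaw_apply, PMF.pure_apply]
    simp only [Nat.not_lt_zero, if_false, PMF.pure_apply]
    by_cases hf : f = fun _ => false
    · simp [hf]
    · rw [if_neg hf]
      obtain ⟨x, hx⟩ := Function.ne_iff.1 hf
      exact Finset.prod_eq_zero (Finset.mem_univ x) (if_neg hx)
  · intro i hi
    rw [h0] at hi
    have h := piLaw_bind_update (fun x : Fin n => if (x : ℕ) < i then θ else PMF.pure false)
      ⟨i, hi⟩ (fun _ => θ)
    simp only [hi, dif_pos]
    rw [h]
    congr 1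
    funext x
    by_cases hx : x = ⟨i, hi⟩
    · subst hx; simp
    · have h1 : (x : ℕ) ≠ i := fun h => hx (Fin.ext h)
      rw [Function.update_of_ne hx]
      have : (x : ℕ) < i + 1 ↔ (x : ℕ) < i := by omega
      simp only [this]
  · rintro i hi t ⟨ht, htime⟩
    rw [h0] at hi
    set t₀ := t.charge (1 + (s.reg 0).size) with ht₀
    have e18 : t₀.reg 18 = s.reg 18 := ht.reg 18 (by omega)
    set S := Finset.range (s.reg 18 + 1) with hS
    have hne : S.Nonempty := Finset.nonempty_range_add_one
    have hrest : ∀ z ≤ s.reg 18, ∃ r,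
        markProg.exec ((t₀.setReg 21 z).charge (1 + (t₀.reg 18).size + z.size)) = PMF.pure r ∧
        Sampled n (i + 1) M s.mem r.mem ∧ flagged n (r.arr 9) =
          Function.update (flagged n (t.arr 9)) ⟨i, hi⟩ (decide (z < s.reg 16)) ∧
        r.time ≤ s.time + (1 + 8 * (i + 1)) * unitCost M := by
      intro z hz
      have hzM : z ≤ M := hz.trans (hok.1 18)
      obtain ⟨g1, g2, g3, g4⟩ := markProg_spec ht hi hM h4 hzM
      obtain ⟨r, hr1, hr2, hr3⟩ := exec_eq_pure (M := M) markProg_det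
        (s := (t₀.setReg 21 z).charge (1 + (t₀.reg 18).size + z.size)) g1 g2
      refine ⟨r, hr1, by rw [hr2]; exact g3, ?_, ?_⟩
      · rw [← State.mem_arr, hr2]; exact g4
      · have k1 := Nat.mul_le_mul_right (unitCost M) (markProg_steps
          ((t₀.setReg 21 z).charge (1 + (t₀.reg 18).size + z.size)).mem)
        have k2 := hsize 0
        have k3 := hsize 18
        have k4 := Nat.size_le_size hzM
        have k5 : ((t₀.setReg 21 z).charge (1 + (t₀.reg 18).size + z.size)).time =
          t.time + (1 + (s.reg 0).size) + (1 + (s.reg 18).size + z.size) := by rw [e18]; rfl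
        rw [k5] at hr3
        unfold unitCost at *
        nlinarith
    have hexec : (Prog.seq (.rand 21 18) markProg).exec t₀ =
        (PMF.uniformOfFinset S hne).bind fun z =>
          markProg.exec ((t₀.setReg 21 z).charge (1 + (t₀.reg 18).size + z.size)) := by
      simp only [Prog.exec]
      rw [PMF.bind_map]
      simp only [e18]
      rfl
    rw [hexec]
    have hmem : ∀ z ∈ (PMF.uniformOfFinset S hne).support, z ≤ s.reg 18 := by
      intro z hz
      rw [PMF.mem_support_uniformOfFinset_iff, hS, Finset.mem_range] at hz
      omega
    constructor
    · simp only [hi, dif_pos]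
      rw [PMF.map_bind, hθ, coinLaw, PMF.map_comp]
      refine bind_congr_support fun z hz => ?_
      obtain ⟨r, hr1, -, hr3, -⟩ := hrest z (hmem z hz)
      rw [hr1, PMF.pure_map, hr3]
      rfl
    · intro r hr
      obtain ⟨z, hz, hr⟩ := (PMF.mem_support_bind_iff _ _ _).1 hr
      obtain ⟨r', hr1, hr2, -, hr4⟩ := hrest z (hmem z hz)
      rw [hr1, PMF.support_pure, Set.mem_singleton_iff] at hr
      subst hr
      exact ⟨hr2, hr4⟩

/-- Clear the registers of the list. -/
def clearRegs (l : List ℕ) : Prog := .block (l.map fun r => .const r 0)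

/-- Clearing is needed because the numbers of the initialization depend on `τ` and can exceed `(n +
1) ^ 2`, the bound on which all updates rely. -/
theorem clearRegs_spec (M : ℕ) (l : List ℕ) (m : Mem) :
    (clearRegs l).Det ∧ (clearRegs l).Safe M m ∧ ((clearRegs l).run m).arr = m.arr ∧
    (∀ r, ((clearRegs l).run m).reg r = if r ∈ l then 0 else m.reg r) ∧
    (clearRegs l).steps m = l.length := by
  induction l generalizing m with
  | nil => exact ⟨trivial, trivial, rfl, fun r => by simp [clearRegs, Prog.block, Prog.run], rfl⟩
  | cons x l ih =>
    obtain ⟨h1, h2, h3, h4, h5⟩ := ih ((Prog.const x 0).run m)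
    have hrun : (clearRegs (x :: l)).run m = (clearRegs l).run ((Prog.const x 0).run m) := rfl
    have hsteps : (clearRegs (x :: l)).steps m =
      1 + (clearRegs l).steps ((Prog.const x 0).run m) := rfl
    refine ⟨⟨trivial, h1⟩, ⟨Nat.zero_le _, h2⟩, by rw [hrun, h3]; rfl, fun r => ?_, ?_⟩
    · rw [hrun, h4]
      by_cases hx : r = x
      · subst hx; simp [Prog.run]
      · simp [Prog.run, hx]
    · rw [hsteps, h5, List.length_cons, add_comm]

/-- Unmark the vertex in register `19`. -/
def unmarkBody : Prog := .block [.store 1 19 5, .store 9 19 5, .arith .add 19 19 4]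

/-- Unmark all vertices. -/
def unmarkProg : Prog := .block [.const 19 0, .loop 0 unmarkBody]

/-- Compare the number of centers with its limit. -/
def limitProg (K : ℕ) : Prog := .block [
  .const 23 (4 * K),
  .arith .mul 23 23 0,
  .arith .mul 23 23 7,
  .arith .mul 23 23 2,
  .arith .mul 20 20 1]

/-- If there are too many centers, start with the trivial contraction; clear the registers. -/
def finishProg (K : ℕ) : Prog := .block [
  limitProg K,
  .ifLt 23 20 unmarkProg .skip,
  clearRegs (List.range' 6 18)]

/-- The arrays after unmarking the first `i` vertices. -/
def unmarked (i : ℕ) (A : ℕ → ℕ → ℕ) (a j : ℕ) : ℕ :=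
  if (a = 1 ∨ a = 9) ∧ j < i then 0 else A a j

theorem unmarkProg_spec {n M : ℕ} {m : Mem} (hok : m.Ok M) (hM : n ≤ M) (h0 : m.reg 0 = n)
    (h4 : m.reg 4 = 1) (h5 : m.reg 5 = 0) :
    let m' := unmarkProg.run m
    unmarkProg.Safe M m ∧ (∀ r, r ≠ 19 → m'.reg r = m.reg r) ∧ m'.arr = unmarked n m.arr ∧
    unmarkProg.steps m ≤ 2 + 4 * n := by
  intro m'
  set m₁ := (Prog.const 19 0).run m with hm₁
  have rr : ∀ r, r ≠ 19 → m₁.reg r = m.reg r := fun r hr => by simp [hm₁, Prog.run, hr]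
  have r0 : m₁.reg 0 = n := by rw [rr 0 (by omega), h0]
  have s1 : (Prog.const 19 0).Safe M m := Nat.zero_le _
  obtain ⟨g1, g2, g3, g4⟩ := Prog.loop_inv (P := unmarkBody) (x := 0)
    (fun i t => (∀ r, r ≠ 19 → t.reg r = m.reg r) ∧ t.reg 19 = i ∧ t.arr = unmarked i m.arr)
    (hok.run s1) ⟨rr, by simp [Prog.run], by
      funext a j; simp [unmarked, Prog.run]⟩ (by
    rintro i hi t - ⟨k1, k2, k3⟩
    rw [r0] at hi
    have e4 : t.reg 4 = 1 := by rw [k1 4 (by omega), h4]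
    have e5 : t.reg 5 = 0 := by rw [k1 5 (by omega), h5]
    refine ⟨?_, fun r hr => ?_, ?_, ?_⟩
    · simp [unmarkBody, Prog.block, Prog.Safe, Prog.run, ArithOp.eval, k2, e4]
      omega
    · rw [← k1 r hr]
      simp [unmarkBody, Prog.block, Prog.run, hr]
    · simp [unmarkBody, Prog.block, Prog.run, ArithOp.eval, k2, e4]
    · have : (unmarkBody.run t).arr = Function.update (Function.update t.arr 1
          (Function.update (t.arr 1) i 0)) 9 (Function.update (t.arr 9) i 0) := by
        simp [unmarkBody, Prog.block, Prog.run, k2, e5]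
      rw [this, k3]
      funext a j
      by_cases h9 : a = 9
      · subst h9
        by_cases hj : j = i
        · subst hj; simp [unmarked]
        · have : j < i + 1 ↔ j < i := by omega
          simp [unmarked, hj, this]
      · by_cases h1 : a = 1
        · subst h1
          by_cases hj : j = i
          · subst hj; simp [unmarked]
          · have : j < i + 1 ↔ j < i := by omega
            simp [unmarked, hj, this]
        · simp [unmarked, h1, h9])
  rw [r0] at g4
  refine ⟨⟨s1, g1, trivial⟩, g2, g4, ?_⟩
  have h := Prog.steps_loop_le 0 unmarkBody m₁ (by simp [unmarkBody, Prog.block, Prog.Flat])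
  rw [r0] at h
  have hl : unmarkBody.len = 3 := rfl
  rw [hl] at h
  have hs : unmarkProg.steps m = 1 + ((Prog.loop 0 unmarkBody).steps m₁ + 0) := rfl
  omega

theorem finishProg_det (K : ℕ) : (finishProg K).Det := by
  have h := (clearRegs_spec 0 (List.range' 6 18) ⟨fun _ => 0, fun _ _ => 0, 0⟩).1
  refine ⟨?_, ?_, h, trivial⟩
  · simp [limitProg, Prog.block, Prog.Det]
  · simp [unmarkProg, unmarkBody, Prog.block, Prog.Det]

/-- The comparison is that of the number of centers with `4 K n l / τ`, multiplied out with `τ = a /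
b`. -/
theorem finishProg_spec (K : ℕ) {n l a b N M : ℕ} {m : Mem} (hok : m.Ok M) (h0 : m.reg 0 = n)
    (h1 : m.reg 1 = a) (h2 : m.reg 2 = b) (h4 : m.reg 4 = 1) (h5 : m.reg 5 = 0)
    (h7 : m.reg 7 = l) (h20 : m.reg 20 = N) (hM0 : 4 * K ≤ M)
    (hM1 : 4 * K * n ≤ M) (hM2 : 4 * K * n * l ≤ M) (hM3 : 4 * K * n * l * b ≤ M)
    (hM4 : N * a ≤ M) :
    let m' := (finishProg K).run m
    (finishProg K).Safe M m ∧ (∀ r, r < 6 ∨ 23 < r → m'.reg r = m.reg r) ∧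
    (∀ r, 6 ≤ r → r ≤ 23 → m'.reg r = 0) ∧
    m'.arr = (if 4 * K * n * l * b < N * a then unmarked n m.arr else m.arr) ∧
    (finishProg K).steps m ≤ 26 + 4 * n := by
  intro m'
  set m₁ := (limitProg K).run m with hm₁
  have rr : ∀ r, r ≠ 20 → r ≠ 23 → m₁.reg r = m.reg r := by
    intro r f1 f2
    simp [hm₁, limitProg, Prog.block, Prog.run, f1, f2]
  have r23 : m₁.reg 23 = 4 * K * n * l * b := by
    simp [hm₁, limitProg, Prog.block, Prog.run, ArithOp.eval, h0, h7, h2]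
  have r20 : m₁.reg 20 = N * a := by
    simp [hm₁, limitProg, Prog.block, Prog.run, ArithOp.eval, h20, h1]
  have s1 : (limitProg K).Safe M m := by
    simp [limitProg, Prog.block, Prog.Safe, Prog.run, ArithOp.eval, h0, h1, h2, h7, h20]
    exact ⟨hM0, hM1, hM2, hM3, hM4⟩
  have st1 : (limitProg K).steps m = 5 := rfl
  have a1 : m₁.arr = m.arr := rfl
  obtain ⟨u1, u2, u3, u4⟩ := unmarkProg_spec (m := m₁) (n := n) (hok.run s1)
    (h0 ▸ hok.1 0) (by rw [rr 0 (by omega) (by omega), h0])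
    (by rw [rr 4 (by omega) (by omega), h4]) (by rw [rr 5 (by omega) (by omega), h5])
  set Q : Prog := .ifLt 23 20 unmarkProg .skip with hQ
  set m₂ := Q.run m₁ with hm₂
  have key : Q.Safe M m₁ ∧ (∀ r, r ≠ 19 → m₂.reg r = m₁.reg r) ∧
      m₂.arr = (if 4 * K * n * l * b < N * a then unmarked n m.arr else m.arr) ∧
      Q.steps m₁ ≤ 3 + 4 * n := by
    by_cases hc : m₁.reg 23 < m₁.reg 20
    · have e : m₂ = unmarkProg.run m₁ := if_pos hc
      have hs : Q.steps m₁ = 1 + unmarkProg.steps m₁ := by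
        simp only [hQ, Prog.steps, if_pos hc]
      rw [r23, r20] at hc
      rw [e, if_pos hc, ← a1]
      exact ⟨⟨fun _ => u1, fun _ => trivial⟩, u2, u3, by rw [hs]; omega⟩
    · have e : m₂ = m₁ := if_neg hc
      have hs : Q.steps m₁ = 1 + 0 := by
        simp only [hQ, Prog.steps, if_neg hc]
      have hc' := hc
      rw [r23, r20] at hc'
      rw [e, if_neg hc']
      exact ⟨⟨fun h => absurd h hc, fun _ => trivial⟩, fun _ _ => rfl, rfl, by rw [hs]; omega⟩
  obtain ⟨k1, k2, k3, k4⟩ := key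
  obtain ⟨-, q2, q3, q4, q5⟩ := clearRegs_spec M (List.range' 6 18) m₂
  have hm' : m' = (clearRegs (List.range' 6 18)).run m₂ := rfl
  refine ⟨⟨s1, k1, q2, trivial⟩, fun r hr => ?_, fun r hr hr' => ?_, ?_, ?_⟩
  · rw [hm', q4, if_neg (by rw [List.mem_range'_1]; omega), k2 r (by omega),
      rr r (by omega) (by omega)]
  · rw [hm', q4, if_pos (by rw [List.mem_range'_1]; omega)]
  · rw [hm', q3, k3]
  · have hs : (finishProg K).steps m = (limitProg K).steps m + (Q.steps m₁ +
      ((clearRegs (List.range' 6 18)).steps m₂ + 0)) := rfl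
    rw [List.length_range'] at q5
    omega

/-- The initialization. -/
def initProg (K c₀ D₀ : ℕ) : Prog :=
  .seq (setupProg K c₀ D₀) (.seq sampleProg (finishProg K))

/-! ### Law and cost of the whole initialization -/

section Start

variable {n : ℕ}

/-- The contraction map in the absence of edges. -/
def idMap (R : Finset (Fin n)) (v : Fin n) : Option (Fin n) := if v ∈ R then some v else none

/-- The centers, if there are not too many. -/
def cappedCenters (L a : ℕ) (f : Fin n → Bool) : Finset (Fin n) :=
  if L < (Finset.univ.filter fun x => f x = true).card * a then ∅
  else Finset.univ.filter fun x => f x = true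

/-- The distribution of the centers. -/
noncomputable def centerLaw (n L a : ℕ) (θ : PMF Bool) : PMF (Finset (Fin n)) :=
  (piLaw fun _ : Fin n => θ).map (cappedCenters L a)

theorem piLaw_pure {ι β : Type*} [Fintype ι] [DecidableEq ι] [Fintype β] (g : ι → β) :
    piLaw (fun i => PMF.pure (g i)) = PMF.pure g := by
  classical
  ext f
  rw [piLaw_apply, PMF.pure_apply]
  simp only [PMF.pure_apply]
  by_cases hf : f = g
  · simp [hf]
  · rw [if_neg hf]
    obtain ⟨x, hx⟩ := Function.ne_iff.1 hf
    exact Finset.prod_eq_zero (Finset.mem_univ x) (if_neg hx)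

/-- Without edges no vertex has a center neighbor, so all targets are determined by `R`. -/
theorem jointLaw_bot (q : PMF (Finset (Fin n))) :
    jointLaw q ⊥ = q.map fun R => (R, idMap R) := by
  unfold jointLaw
  refine congrArg _ (funext fun R => ?_)
  have : vertexLaw ⊥ R = fun v => PMF.pure (idMap R v) := by
    funext v
    have hc : centersAt (⊥ : SimpleGraph (Fin n)) R v = ∅ := by ext w; simp [mem_centersAt]
    unfold vertexLaw idMap
    split_ifs
    · rfl
    · rw [hc]; simp [choiceLaw]
  rw [this, piLaw_pure, PMF.pure_map]
  rfl

/-- The arrays that represent the graph without edges and the given centers. -/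
structure Fresh (n : ℕ) (A : ℕ → ℕ → ℕ) : Prop where
  flag : ∀ j, A 9 j = 0 ∨ A 9 j = 1 ∧ j < n
  code : ∀ j, A 1 j = if A 9 j = 1 then j + 1 else 0
  arr : ∀ a, a ≠ 1 → a ≠ 9 → ∀ i, A a i = 0

theorem nb_bot (x : ℕ) : nb (⊥ : SimpleGraph (Fin n)) x = ∅ := by
  ext y; simp [mem_nb]

theorem Fresh.fullRep {A : ℕ → ℕ → ℕ} (h : Fresh n A) : FullRep (⊥ : SimpleGraph (Fin n)) A where
  wts X Y _ _ := by rw [h.arr 0 (by omega) (by omega)]; simp [wt]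
  adj x _ := ⟨by rw [h.arr 4 (by omega) (by omega)]; simp [nb_bot], by simp [nb_bot]⟩
  flag x _ := by
    rw [h.code]
    rcases h.flag x with h | h
    · simp [h]
    · simp [h.1]
  code x hx y hy := by
    rw [h.code] at hy
    split_ifs at hy with h9
    obtain rfl : x = y := by omega
    exact ⟨hx, h9⟩
  cnt y := h.arr 8 (by omega) (by omega) y
  centers x _ _ := by
    have : centerNb (⊥ : SimpleGraph (Fin n)) A x = ∅ := by simp [centerNb, nb_bot]
    rw [this]
    exact ⟨by rw [h.arr 7 (by omega) (by omega)]; simp, by simp⟩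
  along x _ y hy := by
    rw [h.code] at hy
    split_ifs at hy with h9
    exact .inl (by omega)

theorem Fresh.configOf {A : ℕ → ℕ → ℕ} (h : Fresh n A) :
    configOf n A = ((configOf n A).1, idMap (configOf n A).1) := by
  refine Prod.ext rfl (funext fun v => ?_)
  change decode n (A 1 v) = idMap _ v
  rw [h.code]
  unfold idMap
  simp only [mem_configOf]
  split_ifs
  · rw [decode_succ v.2]
  · rw [decode_zero]

theorem Fresh.le {A : ℕ → ℕ → ℕ} (h : Fresh n A) (a i : ℕ) : A a i ≤ (n + 1) ^ 2 := by
  have h1 : n + 1 ≤ (n + 1) ^ 2 := Nat.le_self_pow (by omega) _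
  by_cases h9 : a = 9
  · subst h9
    rcases h.flag i with h | h <;> omega
  · by_cases ha : a = 1
    · subst ha
      rw [h.code]
      rcases h.flag i with h | h
      · simp [h]
      · rw [if_pos h.1]; omega
    · rw [h.arr a ha h9]; omega

set_option maxHeartbeats 1000000 in
/-- The distribution and the bounds of the initialization. -/
theorem initProg_spec (K c₀ D₀ : ℕ) {a b : ℕ} {s : State} (hn : 1 ≤ n)
    (h : InitRegs n a b s.mem) (htime : s.time = 0) :
    ∃ l, n < 2 ^ l ∧ 2 ^ l ≤ 2 * n ∧ l ≤ n ∧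
    (((initProg K c₀ D₀).exec s).map fun t => configOf n t.arr) =
      jointLaw (centerLaw n (4 * K * n * l * b) a
        (coinLaw (K * fixedLog (D₀ * n ^ c₀) n (l * c₀ * n) * b) (D₀ * n ^ c₀ * a - 1))) ⊥ ∧
    ∀ t ∈ ((initProg K c₀ D₀).exec s).support, StateRep (⊥ : SimpleGraph (Fin n)) t ∧
      (configOf n t.arr).1.card * a ≤ 4 * K * n * l * b ∧
      t.time ≤ (44 + 16 * n + 2 * c₀ + 6 * (l * c₀ * n)) * unitCost (initMax K c₀ D₀ n a b) := by
  set M := initMax K c₀ D₀ n a b with hM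
  have hMdef : M = (2 * n + 1) + c₀ + D₀ * n ^ c₀ * (n + 1) + D₀ + n * c₀ * n +
    n * c₀ * n * (D₀ * n ^ c₀) +
    K * (n * c₀ * n * (D₀ * n ^ c₀)) * (b + 1) + D₀ * n ^ c₀ * a + 4 * K * n * n * (b + 1) + n * a +
    4 * K + a + b := rfl
  have hok : s.mem.Ok M := by
    refine ⟨fun r => ?_, fun x i => by rw [h.arr]; omega⟩
    by_cases h0 : r = 0
    · subst h0; rw [h.r0]; omega
    by_cases h1 : r = 1
    · subst h1; rw [h.r1]; omega
    by_cases h2 : r = 2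
    · subst h2; rw [h.r2]; omega
    rw [h.zero r (by omega)]; omega
  obtain ⟨a1, l, hl1, hl2, hl3, e0, e1, e2, e3, e4, e5, e7, e16, e18, ez, ea, est⟩ :=
    setupProg_spec K c₀ D₀ hn h hok
  obtain ⟨t, ht1, ht2, ht3⟩ := exec_eq_pure (setupProg_det K c₀ D₀) hok a1
  have hokt : t.mem.Ok M := ht2 ▸ hok.run a1
  rw [← ht2] at e0 e1 e2 e3 e4 e5 e7 e16 e18 ez ea
  simp only [State.mem_reg, State.mem_arr] at e0 e1 e2 e3 e4 e5 e7 e16 e18 ez ea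
  have hnM : n ≤ M := by omega
  obtain ⟨b1, b2⟩ := sampleProg_spec hokt hnM e0 e4 (ez 19 (by omega)) (ez 20 (by omega)) ea
  rw [e16, e18] at b1
  set θ := coinLaw (K * fixedLog (D₀ * n ^ c₀) n (l * c₀ * n) * b) (D₀ * n ^ c₀ * a - 1) with hθ
  set L := 4 * K * n * l * b with hL
  have hfin : ∀ r ∈ (sampleProg.exec t).support, ∃ z, (finishProg K).exec r = PMF.pure z ∧
      configOf n z.arr = (cappedCenters L a (flagged n (r.arr 9)),
        idMap (cappedCenters L a (flagged n (r.arr 9)))) ∧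
      StateRep (⊥ : SimpleGraph (Fin n)) z ∧ (configOf n z.arr).1.card * a ≤ L ∧
      z.time ≤ (44 + 16 * n + 2 * c₀ + 6 * (l * c₀ * n)) * unitCost M := by
    intro r hr
    obtain ⟨c1, c2⟩ := b2 r hr
    set N := r.reg 20 with hN
    have hNeq : N = (Finset.univ.filter fun x : Fin n => flagged n (r.arr 9) x = true).card := by
      refine c1.r20.trans (congrArg Finset.card ?_)
      ext x
      rw [Finset.mem_filter, Finset.mem_filter]
      simp [flagged]
    have hNn : N ≤ n := by
      rw [hNeq]
      exact (Finset.card_filter_le _ _).trans (by simp)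
    have d1 : 4 * K * n * l ≤ 4 * K * n * n := by gcongr
    have d2 : 4 * K * n * n * (b + 1) = 4 * K * n * n * b + 4 * K * n * n := by ring
    have d3 : 4 * K * n * l * b ≤ 4 * K * n * n * b := by gcongr
    have d4 : 4 * K * n ≤ 4 * K * n * n := Nat.le_mul_of_pos_right _ hn
    have d5 : N * a ≤ n * a := by gcongr
    have rg : ∀ x, x < 19 ∨ 22 < x → r.reg x = t.reg x := c1.reg
    obtain ⟨f1, f2, f3, f4, f5⟩ := finishProg_spec K (n := n) (l := l) (a := a) (b := b) (N := N)
      c1.ok (by rw [State.mem_reg, rg 0 (by omega), e0]) (by rw [State.mem_reg, rg 1 (by omega), e1])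
      (by rw [State.mem_reg, rg 2 (by omega), e2]) (by rw [State.mem_reg, rg 4 (by omega), e4])
      (by rw [State.mem_reg, rg 5 (by omega), e5]) (by rw [State.mem_reg, rg 7 (by omega), e7])
      rfl (by omega) (by omega) (by omega) (by omega) (by omega)
    obtain ⟨z, hz1, hz2, hz3⟩ := exec_eq_pure (finishProg_det K) c1.ok f1
    rw [← hz2] at f2 f3 f4
    simp only [State.mem_reg, State.mem_arr] at f2 f3 f4
    have hfr : Fresh n r.arr := ⟨c1.flag, c1.code, fun x h1 h9 i => by
      rw [← State.mem_arr, c1.arr x h1 h9]; exact ea x i⟩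
    have hfz : Fresh n z.arr := by
      rw [f4]
      split_ifs
      · refine ⟨fun j => ?_, fun j => ?_, fun x h1 h9 i => ?_⟩
        · rcases hfr.flag j with h | h
          · simp [unmarked, h]
          · simp [unmarked, h.2]
        · by_cases hj : j < n
          · simp [unmarked, hj]
          · simp [unmarked, hj, hfr.code j]
        · simp [unmarked, h1, h9, hfr.arr x h1 h9]
      · exact hfr
    have hcen : (configOf n z.arr).1 = cappedCenters L a (flagged n (r.arr 9)) := by
      unfold cappedCenters
      rw [← hNeq]
      ext x
      rw [mem_configOf, f4]
      split_ifs
      · simp [unmarked]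
      · simp [flagged]
    refine ⟨z, hz1, by rw [hfz.configOf, hcen], ⟨fun x hx => ?_, hfz.le, ?_, ?_, ?_, hfz.fullRep⟩,
      ?_, ?_⟩
    · by_cases h6 : 6 ≤ x ∧ x ≤ 23
      · rw [f3 x h6.1 h6.2]; omega
      · rw [f2 x (by omega), rg x (by omega)]
        by_cases h23 : 23 < x
        · rw [ez x (by omega)]; omega
        · have : x = 3 ∨ x = 4 ∨ x = 5 := by omega
          have h1 : n + 1 ≤ (n + 1) ^ 2 := Nat.le_self_pow (by omega) _
          rcases this with rfl | rfl | rfl <;> omega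
    · rw [f2 3 (by omega), rg 3 (by omega), e3]
    · rw [f2 4 (by omega), rg 4 (by omega), e4]
    · rw [f2 5 (by omega), rg 5 (by omega), e5]
    · rw [hcen, cappedCenters]
      split_ifs
      · simp
      · omega
    · have k1 := Nat.mul_le_mul_right (unitCost M) f5
      have k2 := Nat.mul_le_mul_right (unitCost M) est
      rw [htime] at ht3
      have k3 : (44 + 16 * n + 2 * c₀ + 6 * (l * c₀ * n)) * unitCost M =
        (17 + 4 * n + 2 * c₀ + 6 * (l * c₀ * n)) * unitCost M + (1 + 8 * n) * unitCost M +
          (26 + 4 * n) * unitCost M := by ring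
      omega
  refine ⟨l, hl1, hl2, hl3, ?_, ?_⟩
  · change ((((setupProg K c₀ D₀).exec s).bind fun t =>
      (sampleProg.exec t).bind fun r => (finishProg K).exec r).map _) = _
    rw [ht1, PMF.pure_bind, PMF.map_bind, jointLaw_bot, centerLaw, ← b1, PMF.map_comp, PMF.map_comp]
    refine bind_congr_support fun r hr => ?_
    obtain ⟨z, hz1, hz2, -⟩ := hfin r hr
    rw [hz1, PMF.pure_map, hz2]
    rfl
  · intro z hz
    change z ∈ (((setupProg K c₀ D₀).exec s).bind fun t =>
      (sampleProg.exec t).bind fun r => (finishProg K).exec r).support at hz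
    rw [ht1, PMF.pure_bind] at hz
    obtain ⟨r, hr, hz⟩ := (PMF.mem_support_bind_iff _ _ _).1 hz
    obtain ⟨z', hz1, -, hz3⟩ := hfin r hr
    rw [hz1, PMF.support_pure, Set.mem_singleton_iff] at hz
    subst hz
    exact hz3

end Start

/-! ### The distribution of the algorithm -/

section Law

variable {n : ℕ}

/-- The dynamic algorithm. -/
def starAlgorithm (K c₀ D₀ : ℕ) : Algorithm := ⟨initProg K c₀ D₀, updateProg⟩

theorem tsum_map_mul {α β : Type*} (μ : PMF α) (φ : α → β) (F : β → ℝ≥0∞) :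
    ∑' s, μ s * F (φ s) = ∑' o, μ.map φ o * F o := by
  classical
  simp only [PMF.map_apply, ← ENNReal.tsum_mul_right]
  rw [ENNReal.tsum_comm]
  refine tsum_congr fun s => ?_
  rw [tsum_eq_single (φ s)]
  · simp
  · intro o ho
    simp [ho]

theorem expect_le_of_support {μ : PMF State} {X : State → ℕ} {Y : State → ℝ≥0∞}
    (h : ∀ s ∈ μ.support, (X s : ℝ≥0∞) ≤ Y s) : expect μ X ≤ ∑' s, μ s * Y s := by
  refine ENNReal.tsum_le_tsum fun s => ?_
  by_cases hs : μ s = 0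
  · simp [hs]
  · exact mul_le_mul_right (h s hs) _

theorem expect_bind (μ : PMF State) (f : State → PMF State) (X : State → ℕ) :
    expect (μ.bind f) X = ∑' s, μ s * expect (f s) X := by
  simp only [expect, PMF.bind_apply, ← ENNReal.tsum_mul_right, ← ENNReal.tsum_mul_left]
  rw [ENNReal.tsum_comm]
  simp only [mul_assoc]

theorem tsum_mul_const_add {μ : PMF State} (α β : ℝ≥0∞) (F : State → ℝ≥0∞) :
    ∑' s, μ s * (α + β * F s) = α + β * ∑' s, μ s * F s := by
  simp only [mul_add]
  rw [ENNReal.tsum_add, ENNReal.tsum_mul_right, μ.tsum_coe, one_mul, ← ENNReal.tsum_mul_left]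
  congr 1
  exact tsum_congr fun s => by ring

theorem StateRep.outMap_eq_some {G : SimpleGraph (Fin n)} {s : State} (h : StateRep G s)
    {v a : Fin n} : s.outMap n v = some a ↔ s.arr 1 v = a + 1 :=
  decode_eq_some (h.rep.toRep.code_le v.2)

theorem wt_comm (G : SimpleGraph (Fin n)) (γ : ℕ → ℕ) (X Y : ℕ) : wt G γ X Y = wt G γ Y X := by
  classical
  unfold wt
  refine Finset.card_bij (fun q _ => (q.2, q.1)) ?_ ?_ ?_
  · rintro ⟨x, y⟩ h
    simp only [Finset.mem_filter, Finset.mem_univ, true_and] at h ⊢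
    exact ⟨h.1.symm, h.2.2, h.2.1⟩
  · rintro ⟨x, y⟩ _ ⟨x', y'⟩ _ h
    simp only [Prod.mk.injEq] at h ⊢
    exact ⟨h.2, h.1⟩
  · rintro ⟨x, y⟩ h
    simp only [Finset.mem_filter, Finset.mem_univ, true_and] at h
    exact ⟨(y, x), by simpa using ⟨h.1.symm, h.2.2, h.2.1⟩, rfl⟩

theorem StateRep.mem_contractedVerts {G : SimpleGraph (Fin n)} {s : State} (h : StateRep G s)
    {a : Fin n} : a ∈ contractedVerts (s.outMap n) ↔ a ∈ (configOf n s.arr).1 := by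
  change s.outMap n a = some a ↔ _
  rw [h.outMap_eq_some, mem_configOf, h.rep.flag a a.2]
  split_ifs <;> simp_all

theorem StateRep.isPartialContraction {G : SimpleGraph (Fin n)} {s : State} (h : StateRep G s) :
    IsPartialContraction G (s.outMap n) (s.outWeight n) := by
  classical
  refine ⟨fun v a hva => ?_, fun a b hab => ?_⟩
  · rw [h.outMap_eq_some] at hva
    constructor
    · rw [h.mem_contractedVerts, mem_configOf]
      exact (h.rep.code v v.2 a hva).2
    · rcases h.rep.along v v.2 a hva with h1 | h1
      · exact .inl (Fin.ext h1)
      · exact .inr (mem_nb_fin.1 h1)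
  · simp only [h.outMap_eq_some]
    have key : s.outWeight n a b = wt G (s.arr 1) a b := by
      unfold State.outWeight
      have hab' : (a : ℕ) ≠ b := fun h => hab (Fin.ext h)
      rcases lt_or_gt_of_ne hab' with hlt | hlt
      · rw [min_eq_left hlt.le, max_eq_right hlt.le, h.rep.wts _ _ hlt b.2]
      · rw [min_eq_right hlt.le, max_eq_left hlt.le, h.rep.wts _ _ hlt a.2, wt_comm]
    rw [key, wt]

/-- The request overwrites registers `0`, `1`, `2`, and vertex numbers respect the bound. Hence
`StateRep` need not bound what those registers held before, in particular the data of `τ`. -/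
theorem step_spec (K c₀ D₀ : ℕ) {G : SimpleGraph (Fin n)} {e : Update n} (he : e.Valid G)
    {s : State} (h : StateRep G s) :
    ((starAlgorithm K c₀ D₀).step e s).map (fun t => configOf n t.arr) =
      updateKernel (e.apply G) e.ins e.u e.v (configOf n s.arr) ∧
    ∀ t ∈ ((starAlgorithm K c₀ D₀).step e s).support,
      StepBound e.ins G (e.apply G) e.u e.v s t := by
  have h1 : n + 1 ≤ (n + 1) ^ 2 := Nat.le_self_pow (by omega) _
  have := updateProg_spec (s := {
    reg := fun x => if x = 0 then (e.u : ℕ) else if x = 1 then (e.v : ℕ)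
      else if x = 2 then (if e.ins = true then 1 else 0) else s.reg x
    arr := s.arr
    time := 0
    writes := 0 }) (Update.change he)
    ⟨⟨fun r => by
      simp only [State.mem_reg]
      have := e.u.2
      have := e.v.2
      split_ifs with h1 h2 h3
      · omega
      · omega
      · omega
      · omega
      · exact h.reg_le r (by omega), h.arr_le⟩, h.r3, h.r4, h.r5⟩ h.rep rfl rfl rfl rfl rfl
  exact ⟨this.1, fun t ht => let r := this.2 t ht; ⟨r.rep, r.flags, r.writes_le, r.cost⟩⟩

/-- The state with distribution `μ` represents the graph `G`, the centers and the contraction map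
have their joint distribution, and the number of centers is bounded. -/
structure Tracks (q : PMF (Finset (Fin n))) (L a : ℕ) (G : SimpleGraph (Fin n)) (μ : PMF State) :
    Prop where
  law : μ.map (fun t => configOf n t.arr) = jointLaw q G
  rep : ∀ s ∈ μ.support, StateRep G s
  card : ∀ s ∈ μ.support, (configOf n s.arr).1.card * a ≤ L

variable {q : PMF (Finset (Fin n))} {L a : ℕ} {G : SimpleGraph (Fin n)} {μ : PMF State}

theorem StepBound.centers_eq {ins : Bool} {G' : SimpleGraph (Fin n)} {u v : Fin n} {s t : State}
    (h : StepBound ins G G' u v s t) : (configOf n t.arr).1 = (configOf n s.arr).1 := by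
  ext x
  rw [mem_configOf, mem_configOf, h.flags]

/-- On the support of `μ` the machine step acts on centers and map as `updateKernel`, which sends
the joint law of the old graph to that of the new one. The flags are never changed, so the cap on
the centers persists. -/
theorem Tracks.step (K c₀ D₀ : ℕ) {e : Update n} (he : e.Valid G) (h : Tracks q L a G μ) :
    Tracks q L a (e.apply G) (μ.bind ((starAlgorithm K c₀ D₀).step e)) where
  law := by
    rw [PMF.map_bind, ← jointLaw_bind_updateKernel q (Update.change he), ← h.law, PMF.bind_map]
    exact bind_congr_support fun s hs => (step_spec K c₀ D₀ he (h.rep s hs)).1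
  rep t ht := by
    obtain ⟨s, hs, ht⟩ := (PMF.mem_support_bind_iff _ _ _).1 ht
    exact ((step_spec K c₀ D₀ he (h.rep s hs)).2 t ht).rep
  card t ht := by
    obtain ⟨s, hs, ht⟩ := (PMF.mem_support_bind_iff _ _ _).1 ht
    rw [((step_spec K c₀ D₀ he (h.rep s hs)).2 t ht).centers_eq]
    exact h.card s hs

theorem Tracks.foldl (K c₀ D₀ : ℕ) {σ : List (Update n)} (hσ : ValidFrom G σ)
    (h : Tracks q L a G μ) : Tracks q L a (σ.foldl (fun G e => e.apply G) G)
      (σ.foldl (fun μ e => μ.bind ((starAlgorithm K c₀ D₀).step e)) μ) := by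
  induction σ generalizing G μ with
  | nil => exact h
  | cons e σ ih => exact ih hσ.2 (h.step K c₀ D₀ hσ.1)

theorem validFrom_append {G : SimpleGraph (Fin n)} {σ ρ : List (Update n)} :
    ValidFrom G (σ ++ ρ) ↔ ValidFrom G σ ∧ ValidFrom (σ.foldl (fun G e => e.apply G) G) ρ := by
  induction σ generalizing G with
  | nil => simp [ValidFrom]
  | cons e σ ih => simp [ValidFrom, ih, and_assoc]

theorem changeCost_le (H : SimpleGraph (Fin n)) (u v : Fin n) (g : Fin n → Option (Fin n)) :
    changeCost H u v g ≤ 2 * n := by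
  have h1 := card_le_of_subset_range (nb_subset H u)
  have h2 := card_le_of_subset_range (nb_subset H v)
  unfold changeCost
  split_ifs <;> omega

theorem Tracks.sum_changeCost_le (h : Tracks q L a G μ)
    (hq : ∀ R R' : Finset (Fin n), R.card = R'.card → q R = q R') {u v : Fin n} (huv : G.Adj u v) :
    ∑' s, μ s * (changeCost G u v (configOf n s.arr).2 : ℝ≥0∞) ≤ 2 := by
  rw [tsum_map_mul μ (fun s => configOf n s.arr) fun o => (changeCost G u v o.2 : ℝ≥0∞), h.law,
    tsum_fintype]
  exact sum_jointLaw_mul_changeCost_le hq huv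

/-- Expected bounds for one update. -/
theorem Tracks.expect_step_le (K c₀ D₀ : ℕ) {e : Update n} (he : e.Valid G) (h : Tracks q L a G μ)
    (hq : ∀ R R' : Finset (Fin n), R.card = R'.card → q R = q R') (X : State → ℕ) (α β : ℕ)
    (hX : ∀ (t : State) (k : ℕ), t.time ≤ (200 + 62 * k) * unitCost ((n + 1) ^ 2) →
      t.writes ≤ 1 + 2 * k → X t ≤ α + β * k) :
    expect (μ.bind ((starAlgorithm K c₀ D₀).step e)) X ≤ ((α + β * 2 : ℕ) : ℝ≥0∞) := by
  have hstep := h.step K c₀ D₀ he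
  have hX' : ∀ s ∈ μ.support, ∀ t ∈ ((starAlgorithm K c₀ D₀).step e s).support,
      X t ≤ α + β * changeCost (if e.ins = true then e.apply G else G) e.u e.v
        (if e.ins = true then (configOf n t.arr).2 else (configOf n s.arr).2) := by
    intro s hs t ht
    obtain ⟨k, h1, h2, h3⟩ := ((step_spec K c₀ D₀ he (h.rep s hs)).2 t ht).cost
    exact (hX t k h1 h2).trans (by gcongr)
  have hcast : ((α + β * 2 : ℕ) : ℝ≥0∞) = α + β * 2 := by push_cast; rfl
  rw [hcast]
  have hc := Update.change he
  unfold Change at hc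
  -- The cost is an observable of the map in the graph that contains the edge: of the map after an
  -- insertion, and of the map before a deletion. The corresponding joint law is applied in each
  -- case.
  by_cases hi : e.ins = true
  · rw [if_pos hi] at hc
    have hadj : (e.apply G).Adj e.u e.v := (hc.adj _ _).2 (.inr (.inl ⟨rfl, rfl⟩))
    refine (expect_le_of_support (Y := fun t => α + β *
      (changeCost (e.apply G) e.u e.v (configOf n t.arr).2 : ℝ≥0∞)) fun t ht => ?_).trans ?_
    · obtain ⟨s, hs, ht⟩ := (PMF.mem_support_bind_iff _ _ _).1 ht
      have := hX' s hs t ht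
      rw [if_pos hi, if_pos hi] at this
      exact_mod_cast this
    · rw [tsum_mul_const_add]
      gcongr
      exact hstep.sum_changeCost_le hq hadj
  · rw [if_neg hi] at hc
    have hadj : G.Adj e.u e.v := (hc.adj _ _).2 (.inr (.inl ⟨rfl, rfl⟩))
    rw [expect_bind]
    refine le_trans (ENNReal.tsum_le_tsum (g := fun s => μ s * (α + β *
      (changeCost G e.u e.v (configOf n s.arr).2 : ℝ≥0∞))) fun s => ?_) ?_
    · by_cases hs : μ s = 0
      · simp [hs]
      refine mul_le_mul_right ?_ _
      refine (expect_le_of_support (Y := fun _ => α + β *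
        (changeCost G e.u e.v (configOf n s.arr).2 : ℝ≥0∞)) fun t ht => ?_).trans ?_
      · have := hX' s hs t ht
        rw [if_neg hi, if_neg hi] at this
        exact_mod_cast this
      · rw [ENNReal.tsum_mul_right, PMF.tsum_coe, one_mul]
    · rw [tsum_mul_const_add]
      gcongr
      exact h.sum_changeCost_le hq hadj

/-- Worst case bounds for one update. -/
theorem Tracks.step_le (K c₀ D₀ : ℕ) {e : Update n} (he : e.Valid G) (h : Tracks q L a G μ)
    {t : State} (ht : t ∈ (μ.bind ((starAlgorithm K c₀ D₀).step e)).support) :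
    t.time ≤ (200 + 124 * n) * unitCost ((n + 1) ^ 2) ∧ t.writes * a ≤ 3 * L := by
  obtain ⟨s, hs, ht⟩ := (PMF.mem_support_bind_iff _ _ _).1 ht
  have hb := (step_spec K c₀ D₀ he (h.rep s hs)).2 t ht
  obtain ⟨k, h1, -, h3⟩ := hb.cost
  have h4 := h3.trans (changeCost_le _ _ _ _)
  constructor
  · exact h1.trans (Nat.mul_le_mul_right _ (by omega))
  · have := h.card s hs
    calc t.writes * a ≤ 3 * (configOf n s.arr).1.card * a := Nat.mul_le_mul_right _ hb.writes_le
      _ ≤ 3 * L := by rw [mul_assoc]; omega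

theorem cappedCenters_card_le (L a : ℕ) (f : Fin n → Bool) :
    (cappedCenters L a f).card * a ≤ L := by
  unfold cappedCenters
  split_ifs
  · simp
  · omega

theorem piLaw_decide_mem (θ : PMF Bool) (R : Finset (Fin n)) :
    piLaw (fun _ => θ) (fun x => decide (x ∈ R)) = ∏ x, if x ∈ R then θ true else θ false := by
  rw [piLaw_apply]
  refine Finset.prod_congr rfl fun x _ => ?_
  split_ifs with h <;> simp [h]

theorem cappedCenters_decide_mem {L a : ℕ} {R : Finset (Fin n)} (h : R.card * a ≤ L) :
    cappedCenters L a (fun x => decide (x ∈ R)) = R := by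
  have : (Finset.univ.filter fun x => decide (x ∈ R) = true) = R := by ext x; simp
  unfold cappedCenters
  rw [this, if_neg (by omega)]

/-- Sampling exactly `R` is one way to end with `R`. For the empty set it is not the only one, since
rejected samples end there too, so in general there is only an inequality. -/
theorem le_centerLaw {L a : ℕ} (θ : PMF Bool) {R : Finset (Fin n)} (h : R.card * a ≤ L) :
    (∏ x, if x ∈ R then θ true else θ false) ≤ centerLaw n L a θ R := by
  classical
  rw [← piLaw_decide_mem, centerLaw, PMF.map_apply]
  refine le_trans ?_ (ENNReal.le_tsum fun x => decide (x ∈ R))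
  rw [cappedCenters_decide_mem h]
  simp

theorem centerLaw_eq {L a : ℕ} (θ : PMF Bool) {R : Finset (Fin n)} (hR : R ≠ ∅)
    (h : R.card * a ≤ L) :
    centerLaw n L a θ R = ∏ x, if x ∈ R then θ true else θ false := by
  classical
  rw [← piLaw_decide_mem, centerLaw, PMF.map_apply, tsum_eq_single fun x => decide (x ∈ R),
    cappedCenters_decide_mem h, if_pos rfl]
  intro f hf
  rw [if_neg]
  intro hc
  apply hf
  unfold cappedCenters at hc
  split_ifs at hc
  · exact absurd hc hR
  · funext x
    rw [hc]
    simp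

theorem centerLaw_eq_zero {L a : ℕ} (θ : PMF Bool) {R : Finset (Fin n)} (h : L < R.card * a) :
    centerLaw n L a θ R = 0 := by
  classical
  rw [centerLaw, PMF.map_apply, ENNReal.tsum_eq_zero]
  intro f
  rw [if_neg]
  rintro rfl
  exact absurd (cappedCenters_card_le L a f) (by omega)

/-- Sets beyond the cap have probability zero, nonempty sets below it have the product probability,
and the empty set is the only one of its size. Sending rejected samples to the empty set therefore
preserves exchangeability. -/
theorem centerLaw_card (L a : ℕ) (θ : PMF Bool) (R R' : Finset (Fin n)) (h : R.card = R'.card) :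
    centerLaw n L a θ R = centerLaw n L a θ R' := by
  classical
  have hprod : ∀ R : Finset (Fin n), (∏ x, if x ∈ R then θ true else θ false) =
      θ true ^ R.card * θ false ^ (n - R.card) := by
    intro R
    rw [Finset.prod_ite, Finset.prod_const, Finset.prod_const, Finset.filter_not,
      Finset.filter_mem_eq_inter, Finset.univ_inter, ← Finset.compl_eq_univ_sdiff,
      Finset.card_compl, Fintype.card_fin]
  by_cases hR : R = ∅
  · subst hR
    rw [Finset.card_empty] at h
    rw [Finset.card_eq_zero.1 h.symm]
  · have hR' : R' ≠ ∅ := by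
      rintro rfl
      exact hR (Finset.card_eq_zero.1 (by simpa using h))
    by_cases hL : R.card * a ≤ L
    · rw [centerLaw_eq θ hR hL, centerLaw_eq θ hR' (by rw [← h]; exact hL), hprod, hprod, h]
    · rw [centerLaw_eq_zero θ (by omega), centerLaw_eq_zero θ (by rw [← h]; omega)]

theorem start_spec (K c₀ D₀ : ℕ) {τ : ℚ} (hn : 1 ≤ n) :
    ∃ l, n < 2 ^ l ∧ 2 ^ l ≤ 2 * n ∧ l ≤ n ∧
    Tracks (centerLaw n (4 * K * n * l * τ.den) τ.num.natAbs
        (coinLaw (K * fixedLog (D₀ * n ^ c₀) n (l * c₀ * n) * τ.den)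
          (D₀ * n ^ c₀ * τ.num.natAbs - 1)))
      (4 * K * n * l * τ.den) τ.num.natAbs ⊥ ((starAlgorithm K c₀ D₀).start n τ) ∧
    ∀ t ∈ ((starAlgorithm K c₀ D₀).start n τ).support,
      t.time ≤ (44 + 16 * n + 2 * c₀ + 6 * (l * c₀ * n)) *
        unitCost (initMax K c₀ D₀ n τ.num.natAbs τ.den) := by
  obtain ⟨l, h1, h2, h3, h4, h5⟩ := initProg_spec K c₀ D₀ (a := τ.num.natAbs) (b := τ.den) (s :=
    { reg := fun x => if x = 0 then n else if x = 1 then τ.num.natAbs else if x = 2 then τ.den else 0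
      arr := fun _ _ => 0
      time := 0
      writes := 0 }) hn ⟨rfl, rfl, rfl, fun r hr => by
        simp only [State.mem_reg]
        rw [if_neg (by omega), if_neg (by omega), if_neg (by omega)], fun _ _ => rfl⟩ rfl
  exact ⟨l, h1, h2, h3, ⟨h4, fun s hs => (h5 s hs).1, fun s hs => (h5 s hs).2.1⟩,
    fun s hs => (h5 s hs).2.2⟩

end Law

/-! ### Random sets of centers -/

section RandomSets

variable {α : Type*} [Fintype α] [DecidableEq α]

theorem sum_prod_ite_mem (x y : α → ℝ) :
    ∑ R : Finset α, ∏ v, (if v ∈ R then x v else y v) = ∏ v, (x v + y v) := by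
  rw [Finset.prod_add, Finset.powerset_univ]
  refine Finset.sum_congr rfl fun R _ => ?_
  rw [Finset.prod_ite, Finset.filter_mem_eq_inter, Finset.univ_inter, Finset.filter_not,
    Finset.filter_mem_eq_inter, Finset.univ_inter]

/-- The probability that a random set is `R` if every element is included independently with
probability `p`. -/
noncomputable def setProb (p : ℝ) (R : Finset α) : ℝ := ∏ v, if v ∈ R then p else 1 - p

theorem setProb_nonneg {p : ℝ} (h0 : 0 ≤ p) (h1 : p ≤ 1) (R : Finset α) : 0 ≤ setProb p R :=
  Finset.prod_nonneg fun v _ => by split_ifs <;> linarith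

/-- Induction over the elements: conditioning on one more element adds at most `2 * |p - p'|`,
namely `|p - p'|` from its presence and as much from its absence. The step uses that the
`p'`-weights have total mass one, so this is proved along with it. -/
theorem sum_abs_prod_sub_prod_le {β : Type*} [DecidableEq β] {p p' : ℝ} (h0 : 0 ≤ p)
    (h1 : p ≤ 1) (h0' : 0 ≤ p') (h1' : p' ≤ 1) (s : Finset β) :
    ∑ R ∈ s.powerset, ∏ v ∈ s, (if v ∈ R then p' else 1 - p') = 1 ∧
    ∑ R ∈ s.powerset, |∏ v ∈ s, (if v ∈ R then p else 1 - p) -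
      ∏ v ∈ s, (if v ∈ R then p' else 1 - p')| ≤ 2 * s.card * |p - p'| := by
  induction s using Finset.induction_on with
  | empty => simp
  | insert x s hx ih =>
    have hin : ∀ (r : ℝ), ∀ R ∈ s.powerset, ∏ v ∈ insert x s, (if v ∈ insert x R then r else 1 - r) =
        r * ∏ v ∈ s, (if v ∈ R then r else 1 - r) := by
      intro r R _
      rw [Finset.prod_insert hx, if_pos (Finset.mem_insert_self x R)]
      congr 1
      refine Finset.prod_congr rfl fun v hv => ?_
      have : v ≠ x := fun h => hx (h ▸ hv)
      simp [this]
    have hout : ∀ (r : ℝ), ∀ R ∈ s.powerset, ∏ v ∈ insert x s, (if v ∈ R then r else 1 - r) =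
        (1 - r) * ∏ v ∈ s, (if v ∈ R then r else 1 - r) := by
      intro r R hR
      rw [Finset.prod_insert hx, if_neg fun h => hx (Finset.mem_powerset.1 hR h)]
    rw [Finset.sum_powerset_insert hx, Finset.sum_powerset_insert hx, Finset.sum_congr rfl (hin p'),
      Finset.sum_congr rfl (hout p')]
    refine ⟨?_, ?_⟩
    · rw [← Finset.mul_sum, ← Finset.mul_sum, ih.1]; ring
    · rw [← Finset.sum_add_distrib]
      have hle : ∀ R ∈ s.powerset,
          |∏ v ∈ insert x s, (if v ∈ R then p else 1 - p) -
            ∏ v ∈ insert x s, (if v ∈ R then p' else 1 - p')| +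
          |∏ v ∈ insert x s, (if v ∈ insert x R then p else 1 - p) -
            ∏ v ∈ insert x s, (if v ∈ insert x R then p' else 1 - p')| ≤
          |∏ v ∈ s, (if v ∈ R then p else 1 - p) - ∏ v ∈ s, (if v ∈ R then p' else 1 - p')| +
          2 * |p - p'| * ∏ v ∈ s, (if v ∈ R then p' else 1 - p') := by
        intro R hR
        rw [hin p R hR, hin p' R hR, hout p R hR, hout p' R hR]
        set X := ∏ v ∈ s, (if v ∈ R then p else 1 - p)
        have hY : 0 ≤ ∏ v ∈ s, (if v ∈ R then p' else 1 - p') :=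
          Finset.prod_nonneg fun v _ => by split_ifs <;> linarith
        set Y := ∏ v ∈ s, (if v ∈ R then p' else 1 - p')
        have e1 : (1 - p) * X - (1 - p') * Y = (1 - p) * (X - Y) + -(p - p') * Y := by ring
        have e2 : p * X - p' * Y = p * (X - Y) + (p - p') * Y := by ring
        rw [e1, e2]
        have t1 := abs_add_le ((1 - p) * (X - Y)) (-(p - p') * Y)
        have t2 := abs_add_le (p * (X - Y)) ((p - p') * Y)
        rw [abs_mul, abs_mul, abs_neg, abs_of_nonneg hY, abs_of_nonneg (by linarith : 0 ≤ 1 - p)] at t1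
        rw [abs_mul, abs_mul, abs_of_nonneg hY, abs_of_nonneg h0] at t2
        linarith
      refine (Finset.sum_le_sum hle).trans ?_
      rw [Finset.sum_add_distrib, ← Finset.mul_sum, ih.1, Finset.card_insert_of_notMem hx]
      have := ih.2
      push_cast
      linarith

theorem sum_abs_setProb_sub_le {p p' : ℝ} (h0 : 0 ≤ p) (h1 : p ≤ 1) (h0' : 0 ≤ p')
    (h1' : p' ≤ 1) :
    ∑ R : Finset α, |setProb p R - setProb p' R| ≤ 2 * Fintype.card α * |p - p'| := by
  have := (sum_abs_prod_sub_prod_le h0 h1 h0' h1' (Finset.univ : Finset α)).2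
  rwa [Finset.powerset_univ] at this

/-- Disjointness becomes part of the product if the weight `p` for inclusion is replaced by zero on
`A`; the sum then factors over the elements. -/
theorem sum_setProb_disjoint (p : ℝ) (A : Finset α) :
    (∑ R : Finset α, if Disjoint A R then setProb p R else 0) = (1 - p) ^ A.card := by
  have h : ∀ R : Finset α, (if Disjoint A R then setProb p R else 0) =
      ∏ v, if v ∈ R then (if v ∈ A then 0 else p) else 1 - p := by
    intro R
    split_ifs with hd
    · refine Finset.prod_congr rfl fun v _ => ?_
      split_ifs with h1 h2
      · exact absurd h1 (Finset.disjoint_left.1 hd h2)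
      · rfl
      · rfl
    · obtain ⟨v, hv, hv'⟩ := Finset.not_disjoint_iff.1 hd
      symm
      exact Finset.prod_eq_zero (Finset.mem_univ v) (by simp [hv, hv'])
  rw [Finset.sum_congr rfl fun R _ => h R, sum_prod_ite_mem]
  have h2 : ∀ v, ((if v ∈ A then 0 else p) + (1 - p)) = if v ∈ A then 1 - p else 1 := by
    intro v
    split_ifs <;> ring
  simp only [h2]
  rw [Finset.prod_ite_mem, Finset.univ_inter, Finset.prod_const]

/-- Exponential Markov inequality with parameter one: the mean of `exp |R|` is the power of `1 + p
(e - 1)`, and `e - 1 ≤ 2` bounds this base by `exp (2 p)`. -/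
theorem sum_setProb_large_le {p : ℝ} (h0 : 0 ≤ p) (h1 : p ≤ 1) (t : ℝ) :
    (∑ R : Finset α, if t < R.card then setProb p R else 0) ≤
      Real.exp (2 * p * Fintype.card α - t) := by
  have h : ∀ R : Finset α, (if t < R.card then setProb p R else 0) ≤
      Real.exp (-t) * ∏ v, if v ∈ R then p * Real.exp 1 else 1 - p := by
    intro R
    have hnn := setProb_nonneg h0 h1 R
    have e : ∏ v, (if v ∈ R then p * Real.exp 1 else 1 - p) = Real.exp R.card * setProb p R := by
      have e1 : Real.exp R.card = ∏ v, if v ∈ R then Real.exp 1 else 1 := by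
        rw [Finset.prod_ite_mem, Finset.univ_inter, Finset.prod_const, ← Real.exp_nat_mul, mul_one]
      rw [e1, setProb, ← Finset.prod_mul_distrib]
      refine Finset.prod_congr rfl fun v _ => ?_
      split_ifs <;> ring
    rw [e, ← mul_assoc, ← Real.exp_add]
    split_ifs with ht
    · have : 1 ≤ Real.exp (-t + R.card) := Real.one_le_exp (by linarith)
      nlinarith
    · positivity
  refine (Finset.sum_le_sum fun R _ => h R).trans ?_
  rw [← Finset.mul_sum, sum_prod_ite_mem, Finset.prod_const, Finset.card_univ]
  have hb : p * Real.exp 1 + (1 - p) ≤ Real.exp (2 * p) := by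
    have := Real.add_one_le_exp (2 * p)
    have := Real.exp_one_lt_d9
    nlinarith
  have hb0 : 0 ≤ p * Real.exp 1 + (1 - p) := by
    have := Real.exp_pos 1
    nlinarith
  calc Real.exp (-t) * (p * Real.exp 1 + (1 - p)) ^ Fintype.card α
      ≤ Real.exp (-t) * Real.exp (2 * p) ^ Fintype.card α := by gcongr
    _ = Real.exp (2 * p * Fintype.card α - t) := by
        rw [← Real.exp_nat_mul, ← Real.exp_add]
        congr 1
        ring

end RandomSets

/-! ### Comparison with static star contraction -/

section Comparison

variable {n : ℕ}

open Classical in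
/-- The probability that `v` is contracted into `y` in static star contraction. -/
noncomputable def starFactor (G : SimpleGraph (Fin n)) (τ : ℚ) (R : Finset (Fin n)) (v y : Fin n) :
    ℝ :=
  if v ∉ R ∧ τ ≤ (G.degree v : ℚ) ∧ (G.neighborFinset v ∩ R).Nonempty then
    (if y ∈ G.neighborFinset v ∩ R then 1 / ((G.neighborFinset v ∩ R).card : ℝ) else 0)
  else (if y = v then 1 else 0)

theorem starProb_eq (G : SimpleGraph (Fin n)) (τ : ℚ) (p : ℝ)
    (o : Finset (Fin n) × (Fin n → Fin n)) :
    starProb G τ p o = setProb p o.1 * ∏ v, starFactor G τ o.1 v (o.2 v) := by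
  unfold starProb setProb starFactor
  rfl

theorem starFactor_nonneg (G : SimpleGraph (Fin n)) (τ : ℚ) (R : Finset (Fin n)) (v y : Fin n) :
    0 ≤ starFactor G τ R v y := by
  unfold starFactor
  split_ifs <;> positivity

theorem sum_starFactor (G : SimpleGraph (Fin n)) (τ : ℚ) (R : Finset (Fin n)) (v : Fin n) :
    ∑ y, starFactor G τ R v y = 1 := by
  classical
  unfold starFactor
  split_ifs with h
  · have hc : ((G.neighborFinset v ∩ R).card : ℝ) ≠ 0 := by
      exact_mod_cast (Finset.card_pos.2 h.2.2).ne'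
    rw [Finset.sum_ite_mem, Finset.univ_inter, Finset.sum_const, nsmul_eq_mul,
      mul_one_div_cancel hc]
  · simp

theorem sum_prod_starFactor (G : SimpleGraph (Fin n)) (τ : ℚ) (R : Finset (Fin n)) :
    ∑ f : Fin n → Fin n, ∏ v, starFactor G τ R v (f v) = 1 := by
  have := Finset.prod_univ_sum (fun _ : Fin n => (Finset.univ : Finset (Fin n)))
    (fun v y => starFactor G τ R v y)
  rw [Fintype.piFinset_univ] at this
  rw [← this]
  simp [sum_starFactor]

/-- Once the degree is at least `τ` and a non-center has a center neighbor, the static rule and the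
maintained law both choose a uniform center neighbor; a center stays uncontracted in both. -/
theorem starFactor_eq {G : SimpleGraph (Fin n)} {τ : ℚ} {R : Finset (Fin n)} {v y : Fin n}
    (hτ : τ ≤ (nb G v).card) (hv : v ∉ R → (centersAt G R v).Nonempty) :
    starFactor G τ R v y = (vertexLaw G R v (some y)).toReal := by
  classical
  have hC : G.neighborFinset v ∩ R = centersAt G R v := by
    ext w
    simp [mem_centersAt]
  rw [card_nb] at hτ
  unfold starFactor vertexLaw
  by_cases h : v ∈ R
  · rw [if_neg (by tauto), if_pos h]
    by_cases hy : y = v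
    · simp [hy]
    · rw [if_neg hy, PMF.pure_apply, if_neg (by simpa using hy)]
      simp
  · have hne := hv h
    have hcond : v ∉ R ∧ τ ≤ (G.degree v : ℚ) ∧ (G.neighborFinset v ∩ R).Nonempty := by
      refine ⟨h, ?_, by rw [hC]; exact hne⟩
      convert hτ
    rw [if_pos hcond, if_neg h, choiceLaw_apply_some, hC]
    split_ifs
    · simp
    · simp

open Classical in
/-- A bound for the probability that `R` is the set of centers and misses a neighborhood. -/
noncomputable def missProb (G : SimpleGraph (Fin n)) (p : ℝ) (R : Finset (Fin n)) : ℝ :=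
  ∑ v : Fin n, if Disjoint (G.neighborFinset v) R then setProb p R else 0

/-- The probability that `R` is the set of centers, if it is large. -/
noncomputable def largeProb (L a : ℕ) (p : ℝ) (R : Finset (Fin n)) : ℝ :=
  if L < R.card * a then setProb p R else 0

theorem missProb_nonneg (G : SimpleGraph (Fin n)) {p : ℝ} (h0 : 0 ≤ p) (h1 : p ≤ 1)
    (R : Finset (Fin n)) : 0 ≤ missProb G p R :=
  Finset.sum_nonneg fun v _ => by
    split_ifs
    · exact setProb_nonneg h0 h1 R
    · exact le_rfl

theorem largeProb_nonneg (L a : ℕ) {p : ℝ} (h0 : 0 ≤ p) (h1 : p ≤ 1) (R : Finset (Fin n)) :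
    0 ≤ largeProb L a p R := by
  unfold largeProb
  split_ifs
  · exact setProb_nonneg h0 h1 R
  · exact le_rfl

theorem sum_missProb (G : SimpleGraph (Fin n)) (p : ℝ) :
    ∑ R, missProb G p R = ∑ v : Fin n, (1 - p) ^ (nb G v).card := by
  classical
  unfold missProb
  rw [Finset.sum_comm]
  refine Finset.sum_congr rfl fun v _ => ?_
  rw [card_nb, ← SimpleGraph.card_neighborFinset_eq_degree, ← sum_setProb_disjoint]

theorem setProb_le_missProb {G : SimpleGraph (Fin n)} {p : ℝ} (h0 : 0 ≤ p) (h1 : p ≤ 1)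
    {R : Finset (Fin n)} {v : Fin n} (hv : ¬ (centersAt G R v).Nonempty) :
    setProb p R ≤ missProb G p R := by
  classical
  have hd : Disjoint (G.neighborFinset v) R := by
    rw [Finset.disjoint_left]
    intro w hw hwR
    exact hv ⟨w, mem_centersAt.2 ⟨(G.mem_neighborFinset v w).1 hw, hwR⟩⟩
  have := Finset.single_le_sum (f := fun v => if Disjoint (G.neighborFinset v) R then
    setProb p R else 0) (fun w _ => by
      split_ifs
      · exact setProb_nonneg h0 h1 R
      · exact le_rfl) (Finset.mem_univ v)
  simp only [hd, if_true] at this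
  refine this.trans (le_of_eq ?_)
  unfold missProb
  refine Finset.sum_congr rfl fun w _ => ?_
  congr

/-- If `R` is below the cap and every non-center has a center neighbor, the conditional laws agree
and only the weights of `R` are compared. Otherwise the whole weight of `R` is charged to `missProb`
or `largeProb`, and the maintained probability is bounded below by zero. -/
theorem starProb_sub_jointLaw_le {G : SimpleGraph (Fin n)} {τ : ℚ} {p p' : ℝ} (h0 : 0 ≤ p)
    (h1 : p ≤ 1) {q : PMF (Finset (Fin n))} {L a : ℕ}
    (hq : ∀ R : Finset (Fin n), R.card * a ≤ L → setProb p' R ≤ (q R).toReal)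
    (hτ : ∀ v : Fin n, τ ≤ (nb G v).card) (R : Finset (Fin n)) (f : Fin n → Fin n) :
    starProb G τ p (R, f) - (jointLaw q G (R, some ∘ f)).toReal ≤
      (|setProb p R - setProb p' R| + missProb G p R + largeProb L a p R) *
        ∏ v, starFactor G τ R v (f v) := by
  rw [starProb_eq]
  have hV : 0 ≤ ∏ v, starFactor G τ R v (f v) :=
    Finset.prod_nonneg fun v _ => starFactor_nonneg G τ R v _
  have hJ : 0 ≤ (jointLaw q G (R, some ∘ f)).toReal := ENNReal.toReal_nonneg
  have habs := abs_nonneg (setProb p R - setProb p' R)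
  have g3 := missProb_nonneg G h0 h1 R
  have g4 := largeProb_nonneg L a h0 h1 R
  by_cases hgood : (∀ v, v ∉ R → (centersAt G R v).Nonempty) ∧ R.card * a ≤ L
  · have e : (jointLaw q G (R, some ∘ f)).toReal =
        (q R).toReal * ∏ v, starFactor G τ R v (f v) := by
      rw [jointLaw_apply, ENNReal.toReal_mul, ENNReal.toReal_prod]
      congr 1
      refine Finset.prod_congr rfl fun v _ => ?_
      exact (starFactor_eq (hτ v) (hgood.1 v)).symm
    rw [e, ← sub_mul]
    refine mul_le_mul_of_nonneg_right ?_ hV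
    have g1 := hq R hgood.2
    have g2 := le_abs_self (setProb p R - setProb p' R)
    linarith
  · have hle : setProb p R ≤ |setProb p R - setProb p' R| + missProb G p R + largeProb L a p R := by
      by_cases hL : R.card * a ≤ L
      · have : ∃ v, v ∉ R ∧ ¬ (centersAt G R v).Nonempty := by
          by_contra hc
          push Not at hc
          exact hgood ⟨hc, hL⟩
        obtain ⟨v, -, hv⟩ := this
        have := setProb_le_missProb h0 h1 hv
        linarith
      · have : largeProb L a p R = setProb p R := if_pos (by omega)
        linarith
    have := mul_le_mul_of_nonneg_right hle hV
    linarith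

/-- If `q` is at least the distribution with sampling probability `p'` on all small sets, then the
distribution of the contraction differs from that of static star contraction with sampling
probability `p` only by the difference of `p` and `p'`, by sets of centers that miss a neighborhood,
and by large sets of centers. -/
theorem sum_starProb_sub_le {G : SimpleGraph (Fin n)} {τ : ℚ} {p p' : ℝ} (h0 : 0 ≤ p) (h1 : p ≤ 1)
    {q : PMF (Finset (Fin n))} {L a : ℕ}
    (hq : ∀ R : Finset (Fin n), R.card * a ≤ L → setProb p' R ≤ (q R).toReal)
    (hτ : ∀ v : Fin n, τ ≤ (nb G v).card) (S : Finset (Finset (Fin n) × (Fin n → Fin n))) :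
    ∑ o ∈ S, starProb G τ p o - ∑ o ∈ S, (jointLaw q G (o.1, some ∘ o.2)).toReal ≤
      ∑ R : Finset (Fin n), |setProb p R - setProb p' R| + ∑ v : Fin n, (1 - p) ^ (nb G v).card +
      ∑ R : Finset (Fin n), largeProb L a p R := by
  rw [← Finset.sum_sub_distrib]
  refine (Finset.sum_le_sum fun o _ => starProb_sub_jointLaw_le h0 h1 hq hτ o.1 o.2).trans ?_
  refine (Finset.sum_le_univ_sum_of_nonneg fun o => mul_nonneg ?_ ?_).trans ?_
  · have := abs_nonneg (setProb p o.1 - setProb p' o.1)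
    have := missProb_nonneg G h0 h1 o.1
    have := largeProb_nonneg L a h0 h1 o.1
    linarith
  · exact Finset.prod_nonneg fun v _ => starFactor_nonneg G τ _ v _
  · rw [Fintype.sum_prod_type]
    simp only [← Finset.mul_sum, sum_prod_starFactor, mul_one]
    rw [Finset.sum_add_distrib, Finset.sum_add_distrib, sum_missProb]

/-- The probability of a set of outcomes in terms of the joint distribution. -/
theorem Tracks.sum_jointLaw_le_prob {q : PMF (Finset (Fin n))} {L a : ℕ} {G : SimpleGraph (Fin n)}
    {μ : PMF State} (h : Tracks q L a G μ) (S : Finset (Finset (Fin n) × (Fin n → Fin n))) :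
    ∑ o ∈ S, (jointLaw q G (o.1, some ∘ o.2)).toReal ≤
      prob μ {s | IsComplete G (s.outMap n) ∧ ∃ o ∈ S, Realizes (s.outMap n) o} := by
  classical
  set ι : Finset (Fin n) × (Fin n → Fin n) → Config n := fun o => (o.1, some ∘ o.2) with hι
  have hinj : Function.Injective ι := by
    rintro ⟨R, f⟩ ⟨R', f'⟩ heq
    simp only [hι, Prod.mk.injEq] at heq
    refine Prod.ext heq.1 (funext fun v => ?_)
    exact Option.some_injective _ (congrFun heq.2 v)
  have e1 : ∑ o ∈ S, jointLaw q G (ι o) = μ.toOuterMeasure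
      ((fun t => configOf n t.arr) ⁻¹' (S.image ι : Finset (Config n))) := by
    rw [← PMF.toOuterMeasure_map_apply, h.law, PMF.toOuterMeasure_apply_finset,
      Finset.sum_image fun x _ y _ hxy => hinj hxy]
  have e2 : ∑ o ∈ S, (jointLaw q G (ι o)).toReal = (∑ o ∈ S, jointLaw q G (ι o)).toReal := by
    rw [ENNReal.toReal_sum fun o _ => PMF.apply_ne_top _ _]
  change ∑ o ∈ S, (jointLaw q G (ι o)).toReal ≤ _
  rw [e2, e1, prob]
  refine ENNReal.toReal_mono ?_ (PMF.toOuterMeasure_mono μ ?_)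
  · refine ne_top_of_le_ne_top ENNReal.one_ne_top ?_
    exact (μ.toOuterMeasure.mono (Set.subset_univ _)).trans
      ((PMF.toOuterMeasure_apply_eq_one_iff μ _).2 (Set.subset_univ _)).le
  · rintro s ⟨hs, hsupp⟩
    obtain ⟨o, ho, hoc⟩ := Finset.mem_image.1 (Finset.mem_coe.1 hs)
    have hg : s.outMap n = some ∘ o.2 := by
      rw [outMap_eq]
      exact (congrArg Prod.snd hoc).symm
    have hR : (configOf n s.arr).1 = o.1 := (congrArg Prod.fst hoc).symm
    -- A map of the form `some ∘ f` is defined everywhere, so completeness comes for free.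
    refine ⟨fun u v _ => by simp [hg], o, ho, ?_, fun v => by rw [hg]; rfl⟩
    ext x
    rw [(h.rep s hsupp).mem_contractedVerts, hR, Finset.mem_coe]

end Comparison

/-! ### The sampling probability -/

theorem coinLaw_true (T W : ℕ) : coinLaw T W true = (min T (W + 1) : ℕ) * ((W + 1 : ℕ) : ℝ≥0∞)⁻¹ := by
  classical
  rw [coinLaw, PMF.map_apply, tsum_eq_sum (s := Finset.range (min T (W + 1)))]
  · rw [Finset.sum_congr rfl (g := fun _ => ((W + 1 : ℕ) : ℝ≥0∞)⁻¹), Finset.sum_const,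
      Finset.card_range, nsmul_eq_mul]
    intro z hz
    rw [Finset.mem_range] at hz
    rw [PMF.uniformOfFinset_apply_of_mem _ (by rw [Finset.mem_range]; omega), Finset.card_range,
      if_pos]
    simp; omega
  · intro z hz
    rw [Finset.mem_range] at hz
    split_ifs with h
    · apply PMF.uniformOfFinset_apply_of_notMem
      have : z < T := by simpa using h
      rw [Finset.mem_range]
      omega
    · rfl

/-- The draw is from `W` values because the random instruction includes its upper end `W - 1`. A
threshold `T` beyond `W` is capped automatically, like the sampling probability. -/
theorem coinLaw_true_toReal {T W : ℕ} (hW : 0 < W) :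
    (coinLaw T (W - 1) true).toReal = min 1 ((T : ℝ) / W) := by
  have h1 : W - 1 + 1 = W := by omega
  have hW' : (0 : ℝ) < W := by exact_mod_cast hW
  rw [coinLaw_true, h1, ENNReal.toReal_mul, ENNReal.toReal_inv, ENNReal.toReal_natCast,
    ENNReal.toReal_natCast, Nat.cast_min, ← div_eq_mul_inv, min_comm, ← min_div_div_right hW'.le,
    div_self hW'.ne']

theorem toReal_false (θ : PMF Bool) : (θ false).toReal = 1 - (θ true).toReal := by
  have h := PMF_sum_eq_one θ
  rw [Fintype.sum_bool] at h
  have := congrArg ENNReal.toReal h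
  rw [ENNReal.toReal_add (PMF.apply_ne_top _ _) (PMF.apply_ne_top _ _), ENNReal.toReal_one] at this
  linarith

theorem setProb_le_centerLaw {n L a : ℕ} (θ : PMF Bool) {R : Finset (Fin n)} (h : R.card * a ≤ L) :
    setProb (θ true).toReal R ≤ (centerLaw n L a θ R).toReal := by
  refine le_trans (le_of_eq ?_) (ENNReal.toReal_mono (PMF.apply_ne_top _ _) (le_centerLaw θ h))
  rw [ENNReal.toReal_prod, setProb]
  refine Finset.prod_congr rfl fun v _ => ?_
  split_ifs
  · rfl
  · rw [toReal_false]

/-- Each division loses less than one unit, and the factor `1 - 1 / n` does not amplify earlier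
losses, so at most `j` units are lost after `j` steps. -/
theorem fixedPow_bounds (D : ℕ) {n : ℕ} (hn : 1 ≤ n) (j : ℕ) :
    (fixedPow D n j : ℝ) ≤ D * (1 - 1 / n) ^ j ∧ D * (1 - 1 / n : ℝ) ^ j ≤ fixedPow D n j + j := by
  have hn' : (0 : ℝ) < n := by exact_mod_cast hn
  have hx : (1 - 1 / n : ℝ) = ((n - 1 : ℕ) : ℝ) / n := by
    rw [Nat.cast_sub hn]
    field_simp
    simp
  have hx0 : (0 : ℝ) ≤ 1 - 1 / n := by rw [hx]; positivity
  have hx1 : (1 - 1 / n : ℝ) ≤ 1 := by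
    have : (0 : ℝ) ≤ 1 / n := by positivity
    linarith
  induction j with
  | zero => simp [fixedPow]
  | succ j ih =>
    have e : (fixedPow D n j : ℝ) * (1 - 1 / n) = ((fixedPow D n j * (n - 1) : ℕ) : ℝ) / n := by
      rw [hx]; push_cast; ring
    have h1 : (fixedPow D n (j + 1) : ℝ) ≤ (fixedPow D n j : ℝ) * (1 - 1 / n) := by
      rw [e]
      exact Nat.cast_div_le
    have h2 : (fixedPow D n j : ℝ) * (1 - 1 / n) ≤ fixedPow D n (j + 1) + 1 := by
      rw [e]
      exact (Nat.lt_floor_add_one _).le.trans (by rw [Nat.floor_div_eq_div]; rfl)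
    refine ⟨?_, ?_⟩
    · rw [pow_succ, ← mul_assoc]
      exact h1.trans (mul_le_mul_of_nonneg_right ih.1 hx0)
    · rw [pow_succ, ← mul_assoc]
      have := mul_le_mul_of_nonneg_right ih.2 hx0
      push_cast
      have hj : (j : ℝ) * (1 - 1 / n) ≤ j := mul_le_of_le_one_right (by positivity) hx1
      rw [add_mul] at this
      linarith

/-- In the term with divisor `j + 1`, the power is off by at most `j + 1` units, hence by one after
the division, and rounding the quotient costs one more. -/
theorem fixedLog_bounds (D : ℕ) {n : ℕ} (hn : 1 ≤ n) (J : ℕ) :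
    (fixedLog D n J : ℝ) ≤ D * ∑ j ∈ Finset.range J, (1 - 1 / n : ℝ) ^ (j + 1) / (j + 1) ∧
    D * ∑ j ∈ Finset.range J, (1 - 1 / n : ℝ) ^ (j + 1) / (j + 1) ≤ fixedLog D n J + 2 * J := by
  unfold fixedLog
  rw [Finset.mul_sum]
  push_cast
  constructor
  · refine Finset.sum_le_sum fun j _ => ?_
    refine Nat.cast_div_le.trans ?_
    rw [← mul_div_assoc]
    push_cast
    gcongr
    exact (fixedPow_bounds D hn (j + 1)).1
  · have : (2 * J : ℝ) = ∑ j ∈ Finset.range J, (2 : ℝ) := by simp [mul_comm]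
    rw [this, ← Finset.sum_add_distrib]
    refine Finset.sum_le_sum fun j _ => ?_
    have h1 := (fixedPow_bounds D hn (j + 1)).2
    have h2 : (fixedPow D n (j + 1) : ℝ) / (j + 1 : ℕ) ≤
        (fixedPow D n (j + 1) / (j + 1) : ℕ) + 1 :=
      (Nat.lt_floor_add_one _).le.trans (by rw [Nat.floor_div_eq_div])
    push_cast at h1 h2 ⊢
    have hj : (0 : ℝ) < (j : ℝ) + 1 := by positivity
    have h3 : D * (1 - 1 / n : ℝ) ^ (j + 1) / (j + 1) ≤ (fixedPow D n (j + 1) + (j + 1)) / (j + 1) := by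
      gcongr
    rw [add_div, div_self hj.ne'] at h3
    rw [← mul_div_assoc]
    linarith

/-- The precision of the fixed-point logarithm. -/
theorem abs_log_sub_fixedLog_le {D n J : ℕ} (hD : 0 < D) (hn : 1 ≤ n) :
    |Real.log n - fixedLog D n J / D| ≤ 2 * J / D + n * (1 - 1 / n : ℝ) ^ J := by
  have hn' : (0 : ℝ) < n := by exact_mod_cast hn
  have hD' : (0 : ℝ) < D := by exact_mod_cast hD
  have hx0 : (0 : ℝ) ≤ 1 - 1 / n := by
    rw [sub_nonneg, div_le_one hn']
    exact_mod_cast hn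
  have hx1 : (1 - 1 / n : ℝ) < 1 := by
    have : (0 : ℝ) < 1 / n := by positivity
    linarith
  obtain ⟨h1, h2⟩ := fixedLog_bounds D hn J
  -- The series of `log (1 - x)` at `x = 1 - 1 / n`, where `1 - x = 1 / n`: its value is `-log n`,
  -- and the remainder bound has denominator `1 / n`, which yields the factor `n`.
  have h3 := Real.abs_log_sub_add_sum_range_le (x := (1 - 1 / n : ℝ)) (by rwa [abs_of_nonneg hx0]) J
  rw [abs_of_nonneg hx0] at h3
  have e1 : (1 - (1 - 1 / n) : ℝ) = (n : ℝ)⁻¹ := by rw [one_div]; ring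
  rw [e1, Real.log_inv, div_inv_eq_mul] at h3
  set A := ∑ j ∈ Finset.range J, (1 - 1 / n : ℝ) ^ (j + 1) / (j + 1)
  have h4 : (1 - 1 / n : ℝ) ^ (J + 1) * n ≤ n * (1 - 1 / n : ℝ) ^ J := by
    rw [mul_comm]
    exact mul_le_mul_of_nonneg_left (pow_le_pow_of_le_one hx0 hx1.le (Nat.le_succ J)) hn'.le
  have h5 : fixedLog D n J / (D : ℝ) ≤ A := by
    rw [div_le_iff₀ hD', mul_comm]; exact h1
  have h6 : A ≤ fixedLog D n J / (D : ℝ) + 2 * J / D := by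
    rw [← add_div, le_div_iff₀ hD', mul_comm]; exact h2
  have h7 : (0 : ℝ) ≤ 2 * J / D := by positivity
  rw [abs_le] at h3 ⊢
  constructor <;> linarith [h3.1, h3.2]

/-- The exponent of `n` in the denominator of the fixed-point arithmetic. -/
def precExp (K c : ℕ) : ℕ := c + 3 + 16 * K

/-- The constant factor of the denominator of the fixed-point arithmetic. -/
def precScale (K c : ℕ) : ℕ := 32 * precExp K c * K

/-- Raising `1 - 1 / n ≤ exp (-1 / n)` to the power `l * c₀ * n` gives `exp (-l * c₀)`, and `exp l ≥
2 ^ l ≥ n`. -/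
theorem one_sub_inv_pow_le {n l c₀ : ℕ} (hn : 1 ≤ n) (hl : n ≤ 2 ^ l) :
    (1 - 1 / n : ℝ) ^ (l * c₀ * n) ≤ 1 / (n : ℝ) ^ c₀ := by
  have hn' : (0 : ℝ) < n := by exact_mod_cast hn
  have hx0 : (0 : ℝ) ≤ 1 - 1 / n := by
    rw [sub_nonneg, div_le_one hn']
    exact_mod_cast hn
  have h1 : (1 - 1 / n : ℝ) ≤ Real.exp (-(1 / n)) := by
    have := Real.add_one_le_exp (-(1 / n : ℝ))
    linarith
  have h2 : (n : ℝ) ≤ Real.exp l := by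
    have h3 : (n : ℝ) ≤ 2 ^ l := by exact_mod_cast hl
    have h4 : (2 : ℝ) ≤ Real.exp 1 := by
      have := Real.add_one_le_exp (1 : ℝ)
      linarith
    refine h3.trans ?_
    calc (2 : ℝ) ^ l ≤ Real.exp 1 ^ l := by gcongr
      _ = Real.exp l := by rw [← Real.exp_nat_mul, mul_one]
  calc (1 - 1 / n : ℝ) ^ (l * c₀ * n) ≤ Real.exp (-(1 / n)) ^ (l * c₀ * n) := by gcongr
    _ = (Real.exp l ^ c₀)⁻¹ := by
        rw [← Real.exp_nat_mul, ← Real.exp_nat_mul, ← Real.exp_neg]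
        congr 1
        push_cast
        field_simp
    _ ≤ ((n : ℝ) ^ c₀)⁻¹ := by gcongr
    _ = _ := (one_div _).symm

/-- The exponent `precExp` is made up of `c + 1` for the desired precision, two for the factor `l *
n ≤ n ^ 2`, and `16 * K` because `n ^ (16 * K) ≥ 16 * K` absorbs constants; `precScale` cancels the
constants of the rounding error. Rounding and truncation then each use half of the budget. -/
theorem precision_le {K c n l : ℕ} (hK : 1 ≤ K) (hn : 2 ≤ n) (hl : n ≤ 2 ^ l) (hl' : l ≤ n) :
    K * (2 * ((l * precExp K c * n : ℕ) : ℝ) / ((precScale K c * n ^ precExp K c : ℕ) : ℝ) +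
      n * (1 - 1 / n : ℝ) ^ (l * precExp K c * n)) ≤ 1 / (8 * (n : ℝ) ^ (c + 1)) := by
  have hn' : (0 : ℝ) < n := by exact_mod_cast (by omega : 0 < n)
  have hn2 : (2 : ℝ) ≤ n := by exact_mod_cast hn
  have hK' : (0 : ℝ) < K := by exact_mod_cast hK
  have hc0 : (0 : ℝ) < precExp K c := by exact_mod_cast (by unfold precExp; omega : 0 < precExp K c)
  have h1 := one_sub_inv_pow_le (c₀ := precExp K c) (by omega) hl
  have hpow : (n : ℝ) ^ precExp K c = (n : ℝ) ^ (c + 1) * n ^ 2 * n ^ (16 * K) := by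
    rw [precExp, ← pow_add, ← pow_add]
  have hP : (0 : ℝ) < (n : ℝ) ^ (c + 1) := by positivity
  have h16 : (16 * K : ℝ) ≤ (n : ℝ) ^ (16 * K) := by
    have : (16 * K : ℕ) ≤ n ^ (16 * K) := (Nat.lt_pow_self (by omega)).le
    exact_mod_cast this
  have h16' : (1 : ℝ) ≤ (n : ℝ) ^ (16 * K) := one_le_pow₀ (by linarith)
  have hl'' : (l : ℝ) ≤ n := by exact_mod_cast hl'
  have hA : K * (2 * ((l * precExp K c * n : ℕ) : ℝ) / ((precScale K c * n ^ precExp K c : ℕ) : ℝ)) ≤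
      1 / (16 * (n : ℝ) ^ (c + 1)) := by
    unfold precScale
    push_cast
    rw [hpow, ← mul_div_assoc, div_le_div_iff₀ (by positivity) (by positivity)]
    have e : K * (2 * (l * (precExp K c : ℝ) * n)) * (16 * (n : ℝ) ^ (c + 1)) =
        32 * precExp K c * K * (n : ℝ) ^ (c + 1) * (l * n) := by ring
    have e' : 1 * (32 * (precExp K c : ℝ) * K * ((n : ℝ) ^ (c + 1) * n ^ 2 * n ^ (16 * K))) =
        32 * precExp K c * K * (n : ℝ) ^ (c + 1) * (n * n * n ^ (16 * K)) := by ring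
    rw [e, e']
    refine mul_le_mul_of_nonneg_left ?_ (by positivity)
    calc (l : ℝ) * n ≤ n * n * 1 := by rw [mul_one]; gcongr
      _ ≤ _ := by gcongr
  have hB : K * (n * (1 - 1 / n : ℝ) ^ (l * precExp K c * n)) ≤ 1 / (16 * (n : ℝ) ^ (c + 1)) := by
    calc K * (n * (1 - 1 / n : ℝ) ^ (l * precExp K c * n))
        ≤ K * (n * (1 / (n : ℝ) ^ precExp K c)) := by gcongr
      _ = K * n / ((n : ℝ) ^ (c + 1) * n ^ 2 * n ^ (16 * K)) := by rw [hpow]; ring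
      _ ≤ 1 / (16 * (n : ℝ) ^ (c + 1)) := by
        rw [div_le_div_iff₀ (by positivity) (by positivity)]
        have e : K * (n : ℝ) * (16 * (n : ℝ) ^ (c + 1)) = (n : ℝ) ^ (c + 1) * (n * (16 * K)) := by
          ring
        have e' : 1 * ((n : ℝ) ^ (c + 1) * n ^ 2 * n ^ (16 * K)) =
          (n : ℝ) ^ (c + 1) * (n * (n * n ^ (16 * K))) := by ring
        rw [e, e']
        have : (n : ℝ) ^ (16 * K) ≤ n * n ^ (16 * K) :=
          le_mul_of_one_le_left (by positivity) (by linarith)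
        exact mul_le_mul_of_nonneg_left (mul_le_mul_of_nonneg_left (h16.trans this) hn'.le) hP.le
  have e : 1 / (8 * (n : ℝ) ^ (c + 1)) =
      1 / (16 * (n : ℝ) ^ (c + 1)) + 1 / (16 * (n : ℝ) ^ (c + 1)) := by
    field_simp
    norm_num
  rw [mul_add, e]
  linarith

theorem abs_min_one_sub_le (x y : ℝ) : |min 1 x - min 1 y| ≤ |x - y| := by
  rcases le_total 1 x with hx | hx <;> rcases le_total 1 y with hy | hy <;>
    simp only [min_eq_left, min_eq_right, hx, hy]
  · simp
  · rw [abs_of_nonneg (by linarith), abs_of_nonneg (by linarith)]; linarith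
  · rw [abs_of_nonpos (by linarith), abs_of_nonpos (by linarith)]; linarith
  · exact le_rfl

/-- The precision of the sampling probability. -/
theorem abs_centerProb_sub_le {K c n l : ℕ} {τ : ℚ} (hK : 800 ≤ K) (hn : 2 ≤ n) (hl : n ≤ 2 ^ l)
    (hl' : l ≤ n) (hτ : 0 < τ) :
    |centerProb K n τ - (coinLaw (K * fixedLog (precScale K c * n ^ precExp K c) n
      (l * precExp K c * n) * τ.den) (precScale K c * n ^ precExp K c * τ.num.natAbs - 1)
        true).toReal| ≤ 1 / (8 * (n : ℝ) ^ (c + 1)) := by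
  have hpe : 0 < precExp K c := by unfold precExp; omega
  have hD : 0 < precScale K c * n ^ precExp K c := by
    unfold precScale
    have : 0 < K := by omega
    positivity
  have ha : 0 < τ.num.natAbs := Int.natAbs_pos.2 (Rat.num_pos.2 hτ).ne'
  have hprec := precision_le (c := c) (by omega : 1 ≤ K) hn hl hl'
  have herr := abs_log_sub_fixedLog_le (J := l * precExp K c * n) hD (by omega : 1 ≤ n)
  set D := precScale K c * n ^ precExp K c with hDdef
  set J := l * precExp K c * n with hJ
  set Q := fixedLog D n J with hQ
  rw [coinLaw_true_toReal (Nat.mul_pos hD ha), centerProb]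
  have hτr : (τ : ℝ) = (τ.num.natAbs : ℝ) / τ.den := by
    have : (τ.num : ℝ) = (τ.num.natAbs : ℝ) := by
      rw [← Int.cast_natCast, Int.natAbs_of_nonneg (Rat.num_pos.2 hτ).le]
    rw [← this, Rat.cast_def]
  have hb : (0 : ℝ) < τ.den := by exact_mod_cast τ.pos
  have ha' : (0 : ℝ) < τ.num.natAbs := by exact_mod_cast ha
  have hD' : (0 : ℝ) < D := by exact_mod_cast hD
  have hτ' : (0 : ℝ) < τ := by exact_mod_cast hτ
  have hK' : (800 : ℝ) ≤ K := by exact_mod_cast hK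
  have hn' : (2 : ℝ) ≤ n := by exact_mod_cast hn
  have ey : ((K * Q * τ.den : ℕ) : ℝ) / ((D * τ.num.natAbs : ℕ) : ℝ) = K * (Q / D) / τ := by
    rw [hτr]
    push_cast
    field_simp
  rw [ey]
  have herr' : |(K : ℝ) * Real.log n - K * (Q / D)| ≤ 1 / (8 * (n : ℝ) ^ (c + 1)) := by
    rw [← mul_sub, abs_mul, abs_of_nonneg (by linarith : (0 : ℝ) ≤ K)]
    exact le_trans (mul_le_mul_of_nonneg_left herr (by linarith)) hprec
  -- For `τ ≥ 1` the division by `τ` does not enlarge the error. For `τ < 1` it could, but then both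
  -- quotients exceed one, as `K * log n ≥ 400`, and both probabilities are capped at one.
  rcases le_or_gt 1 (τ : ℝ) with h1 | h1
  · refine (abs_min_one_sub_le _ _).trans ?_
    rw [← sub_div, abs_div, abs_of_pos hτ']
    exact (div_le_self (abs_nonneg _) h1).trans herr'
  · have hlog : 1 / 2 ≤ Real.log n := by
      have h2 := Real.log_two_gt_d9
      have h3 := Real.log_le_log (by norm_num) hn'
      linarith
    have hsmall : 1 / (8 * (n : ℝ) ^ (c + 1)) ≤ 1 := by
      rw [div_le_one (by positivity)]
      have : (1 : ℝ) ≤ (n : ℝ) ^ (c + 1) := one_le_pow₀ (by linarith)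
      linarith
    have hKl : 400 ≤ (K : ℝ) * Real.log n := by nlinarith
    have hx : 1 ≤ K * Real.log n / τ := by rw [le_div_iff₀ hτ']; linarith
    have hy : 1 ≤ K * (Q / D) / (τ : ℝ) := by
      rw [le_div_iff₀ hτ']
      have := (abs_le.1 herr').2
      linarith
    rw [min_eq_left hx, min_eq_left hy]
    simp

theorem centerProb_nonneg {K n : ℕ} {τ : ℚ} (hτ : 0 < τ) : 0 ≤ centerProb K n τ := by
  have hτ' : (0 : ℝ) < τ := by exact_mod_cast hτ
  have : 0 ≤ Real.log n := Real.log_natCast_nonneg n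
  exact le_min zero_le_one (by positivity)

/-- A neighborhood of size at least `τ` is missed with probability at most `exp (-p τ) = n ^ (-K)`
if `p` is not capped, and never if `p = 1`, as degrees are positive. -/
theorem sum_pow_degree_le {K n : ℕ} {τ : ℚ} {G : SimpleGraph (Fin n)} (hn : 1 ≤ n)
    (hτ : 0 < τ) (hdeg : ∀ v : Fin n, τ ≤ (nb G v).card) :
    ∑ v : Fin n, (1 - centerProb K n τ) ^ (nb G v).card ≤ n * (1 / (n : ℝ) ^ K) := by
  have hτ' : (0 : ℝ) < τ := by exact_mod_cast hτ
  have hn' : (0 : ℝ) < n := by exact_mod_cast hn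
  have key : ∀ v : Fin n, (1 - centerProb K n τ) ^ (nb G v).card ≤ 1 / (n : ℝ) ^ K := by
    intro v
    have hd : (τ : ℝ) ≤ (nb G v).card := by exact_mod_cast hdeg v
    unfold centerProb
    rcases le_total 1 (K * Real.log n / (τ : ℝ)) with h | h
    · rw [min_eq_left h, sub_self, zero_pow]
      · positivity
      · intro h0
        rw [h0] at hd
        simp at hd
        linarith
    · rw [min_eq_right h]
      have h1 : 1 - K * Real.log n / (τ : ℝ) ≤ Real.exp (-(K * Real.log n / (τ : ℝ))) := by
        have := Real.add_one_le_exp (-(K * Real.log n / (τ : ℝ)))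
        linarith
      have hlog : 0 ≤ Real.log n := Real.log_natCast_nonneg n
      calc (1 - K * Real.log n / (τ : ℝ)) ^ (nb G v).card
          ≤ Real.exp (-(K * Real.log n / (τ : ℝ))) ^ (nb G v).card :=
            pow_le_pow_left₀ (by linarith) h1 _
        _ = Real.exp (-((nb G v).card * (K * Real.log n / (τ : ℝ)))) := by
            rw [← Real.exp_nat_mul, mul_neg]
        _ ≤ Real.exp (-(K * Real.log n)) := by
            rw [Real.exp_le_exp, neg_le_neg_iff, ← mul_div_assoc, le_div_iff₀ hτ', mul_comm]
            gcongr
        _ = 1 / (n : ℝ) ^ K := by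
            rw [Real.exp_neg, mul_comm, ← Real.rpow_def_of_pos hn', Real.rpow_natCast, one_div]
  refine (Finset.sum_le_sum fun v _ => key v).trans ?_
  simp

/-- As `l ≥ log n`, the cap is at least `4 K n log n / τ`, twice the upper bound for `2 p n`. The
exponential bound thus gains `2 K n log n / τ`, which is at least `2 K log n` because `τ ≤ n`. -/
theorem sum_largeProb_le {K n l : ℕ} {τ : ℚ} (hn : 1 ≤ n) (hl : n ≤ 2 ^ l) (hτ : 0 < τ)
    (hτn : τ ≤ n) :
    ∑ R : Finset (Fin n), largeProb (4 * K * n * l * τ.den) τ.num.natAbs (centerProb K n τ) R ≤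
      1 / (n : ℝ) ^ (2 * K) := by
  have hτ' : (0 : ℝ) < τ := by exact_mod_cast hτ
  have hn' : (0 : ℝ) < n := by exact_mod_cast hn
  have hτn' : (τ : ℝ) ≤ n := by exact_mod_cast hτn
  have ha : 0 < τ.num.natAbs := Int.natAbs_pos.2 (Rat.num_pos.2 hτ).ne'
  have hb : (0 : ℝ) < τ.den := by exact_mod_cast τ.pos
  have ha' : (0 : ℝ) < τ.num.natAbs := by exact_mod_cast ha
  have hτr : (τ : ℝ) = (τ.num.natAbs : ℝ) / τ.den := by
    have : (τ.num : ℝ) = (τ.num.natAbs : ℝ) := by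
      rw [← Int.cast_natCast, Int.natAbs_of_nonneg (Rat.num_pos.2 hτ).le]
    rw [← this, Rat.cast_def]
  have hlog : 0 ≤ Real.log n := Real.log_natCast_nonneg n
  have hlogl : Real.log n ≤ l := by
    have h1 : Real.log n ≤ Real.log (2 ^ l) := Real.log_le_log hn' (by exact_mod_cast hl)
    rw [Real.log_pow] at h1
    have := Real.log_two_lt_d9
    nlinarith [(Nat.cast_nonneg l : (0 : ℝ) ≤ l)]
  have h := sum_setProb_large_le (α := Fin n) (centerProb_nonneg (K := K) (n := n) hτ)
    (min_le_left _ _) (4 * K * n * l / τ)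
  rw [Fintype.card_fin] at h
  refine le_trans (le_of_eq ?_) (h.trans ?_)
  · refine Finset.sum_congr rfl fun R _ => ?_
    unfold largeProb
    have : 4 * K * n * l * τ.den < R.card * τ.num.natAbs ↔ (4 * K * n * l / τ : ℝ) < R.card := by
      rw [div_lt_iff₀ hτ', hτr, ← mul_div_assoc, lt_div_iff₀ hb]
      exact_mod_cast Iff.rfl
    simp only [this]
  · have hp : centerProb K n τ ≤ K * Real.log n / τ := min_le_right _ _
    have e1 : 2 * centerProb K n τ * n - 4 * K * n * l / τ ≤ -((2 * K : ℕ) * Real.log n) := by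
      have h1 : 2 * centerProb K n τ * n ≤ 2 * (K * Real.log n / τ) * n := by gcongr
      have h2 : 4 * K * n * Real.log n / (τ : ℝ) ≤ 4 * K * n * l / τ := by gcongr
      have h3 : 2 * (K * Real.log n / τ) * n = 2 * K * n * Real.log n / (τ : ℝ) := by ring
      have h4 : 4 * K * n * Real.log n / (τ : ℝ) =
        2 * K * n * Real.log n / (τ : ℝ) + 2 * K * n * Real.log n / (τ : ℝ) := by ring
      have h5 : 2 * K * Real.log n ≤ 2 * K * n * Real.log n / (τ : ℝ) := by
        rw [le_div_iff₀ hτ']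
        calc 2 * K * Real.log n * τ ≤ 2 * K * Real.log n * n := by gcongr
          _ = _ := by ring
      push_cast
      linarith
    calc Real.exp (2 * centerProb K n τ * n - 4 * K * n * l / τ)
        ≤ Real.exp (-((2 * K : ℕ) * Real.log n)) := Real.exp_le_exp.2 e1
      _ = 1 / (n : ℝ) ^ (2 * K) := by
          rw [Real.exp_neg, mul_comm, ← Real.rpow_def_of_pos hn', Real.rpow_natCast, one_div]

/-- If the minimum degree is at least `τ`, the contraction is a star contraction with high
probability. -/
theorem Tracks.star {K c n l : ℕ} {τ : ℚ} {G : SimpleGraph (Fin n)} {μ : PMF State}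
    (h : Tracks (centerLaw n (4 * K * n * l * τ.den) τ.num.natAbs
        (coinLaw (K * fixedLog (precScale K c * n ^ precExp K c) n (l * precExp K c * n) * τ.den)
          (precScale K c * n ^ precExp K c * τ.num.natAbs - 1)))
      (4 * K * n * l * τ.den) τ.num.natAbs G μ)
    (hK : 800 ≤ K) (hc : c + 2 ≤ K) (hn : 1 ≤ n) (hl : n ≤ 2 ^ l) (hl' : l ≤ n) (hτ : 0 < τ)
    (hdeg : τ ≤ (minDeg G : ℚ)) (S : Finset (Finset (Fin n) × (Fin n → Fin n))) :
    (∑ o ∈ S, starProb G τ (centerProb K n τ) o) - 1 / (n : ℝ) ^ c ≤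
      prob μ {s | IsComplete G (s.outMap n) ∧ ∃ o ∈ S, Realizes (s.outMap n) o} := by
  classical
  have hnb : ∀ v : Fin n, τ ≤ (nb G v).card := by
    intro v
    rw [card_nb]
    refine hdeg.trans ?_
    unfold minDeg
    exact_mod_cast G.minDegree_le_degree v
  have hτn : τ < n := by
    have h1 := hnb ⟨0, hn⟩
    rw [card_nb] at h1
    have h2 := G.degree_lt_card_verts (⟨0, hn⟩ : Fin n)
    rw [Fintype.card_fin] at h2
    exact lt_of_le_of_lt h1 (by exact_mod_cast h2)
  have hn2 : 2 ≤ n := by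
    have h1 := hnb ⟨0, hn⟩
    rw [card_nb] at h1
    have h2 := G.degree_lt_card_verts (⟨0, hn⟩ : Fin n)
    rw [Fintype.card_fin] at h2
    have h3 : (0 : ℚ) < G.degree (⟨0, hn⟩ : Fin n) := lt_of_lt_of_le hτ h1
    have h4 : 0 < G.degree (⟨0, hn⟩ : Fin n) := by exact_mod_cast h3
    omega
  have hn' : (2 : ℝ) ≤ n := by exact_mod_cast hn2
  have hn0 : (0 : ℝ) < n := by linarith
  have hclose := abs_centerProb_sub_le (c := c) hK hn2 hl hl' hτ
  set θ := coinLaw (K * fixedLog (precScale K c * n ^ precExp K c) n (l * precExp K c * n) * τ.den)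
    (precScale K c * n ^ precExp K c * τ.num.natAbs - 1)
  have hp0 := centerProb_nonneg (K := K) (n := n) hτ
  have hp1 : centerProb K n τ ≤ 1 := min_le_left _ _
  have h1 := sum_starProb_sub_le (τ := τ) hp0 hp1 (p' := (θ true).toReal)
    (q := centerLaw n (4 * K * n * l * τ.den) τ.num.natAbs θ) (fun R hR => setProb_le_centerLaw θ hR) hnb S
  have h2 := h.sum_jointLaw_le_prob S
  have hθ1 : (θ true).toReal ≤ 1 := by
    have := ENNReal.toReal_mono ENNReal.one_ne_top (PMF.coe_le_one θ true)
    simpa using this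
  have h3 := sum_abs_setProb_sub_le (α := Fin n) hp0 hp1 (p' := (θ true).toReal)
    ENNReal.toReal_nonneg hθ1
  rw [Fintype.card_fin] at h3
  have h4 := sum_pow_degree_le (K := K) hn hτ hnb
  have h5 := sum_largeProb_le (K := K) hn hl hτ hτn.le
  have hP : (0 : ℝ) < (n : ℝ) ^ c := by positivity
  -- The error budget is a quarter for the approximated probability, a half for missed neighborhoods
  -- and a quarter for the cap. It uses `n ≥ 2`, which holds since some degree is positive.
  have b1 : 2 * n * |centerProb K n τ - (θ true).toReal| ≤ 1 / 4 * (1 / (n : ℝ) ^ c) := by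
    calc 2 * n * |centerProb K n τ - (θ true).toReal| ≤ 2 * n * (1 / (8 * (n : ℝ) ^ (c + 1))) := by
          gcongr
      _ = 1 / 4 * (1 / (n : ℝ) ^ c) := by
          rw [pow_succ]
          field_simp
          norm_num
  have hpow : ∀ m, 1 / (n : ℝ) ^ (c + m) ≤ 1 / 2 ^ m * (1 / (n : ℝ) ^ c) := by
    intro m
    rw [pow_add, one_div_mul_one_div]
    have : (2 : ℝ) ^ m ≤ (n : ℝ) ^ m := by gcongr
    apply one_div_le_one_div_of_le (by positivity)
    rw [mul_comm]
    gcongr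
  have hmono : ∀ m k, m ≤ k → 1 / (n : ℝ) ^ k ≤ 1 / (n : ℝ) ^ m := fun m k hmk =>
    one_div_le_one_div_of_le (by positivity) (pow_le_pow_right₀ (by linarith) hmk)
  have b2 : n * (1 / (n : ℝ) ^ K) ≤ 1 / 2 * (1 / (n : ℝ) ^ c) := by
    calc n * (1 / (n : ℝ) ^ K) ≤ n * (1 / (n : ℝ) ^ (c + 1 + 1)) := by
          have := hmono _ _ hc
          gcongr
      _ = 1 / (n : ℝ) ^ (c + 1) := by
          rw [pow_succ _ (c + 1)]
          field_simp
      _ ≤ _ := by simpa using hpow 1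
  have b3 : 1 / (n : ℝ) ^ (2 * K) ≤ 1 / 4 * (1 / (n : ℝ) ^ c) := by
    refine (hmono (c + 2) _ (by omega)).trans ((hpow 2).trans (le_of_eq ?_))
    norm_num
  linarith

/-! ### Time bounds -/

theorem size_le_log {M : ℕ} (hM : 1 ≤ M) : (M.size : ℝ) ≤ 1 + 2 * Real.log M := by
  have h1 : 0 < M.size := Nat.size_pos.2 hM
  have h2 : 2 ^ (M.size - 1) ≤ M := Nat.lt_size.1 (by omega)
  have h3 : Real.log ((2 : ℝ) ^ (M.size - 1)) ≤ Real.log M :=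
    Real.log_le_log (by positivity) (by exact_mod_cast h2)
  rw [Real.log_pow, Nat.cast_sub h1, Nat.cast_one] at h3
  have h4 := Real.log_two_gt_d9
  have h5 : (1 : ℝ) ≤ M.size := by exact_mod_cast h1
  nlinarith

theorem unitCost_le {M : ℕ} (hM : 1 ≤ M) : (unitCost M : ℝ) ≤ 4 + 6 * Real.log M := by
  have := size_le_log hM
  unfold unitCost
  push_cast
  linarith

theorem half_le_log_succ {n : ℕ} (hn : 1 ≤ n) : 1 / 2 ≤ Real.log ((n : ℝ) + 1) := by
  have h1 : (1 : ℝ) ≤ n := by exact_mod_cast hn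
  have h2 := Real.log_two_gt_d9
  have h3 := Real.log_le_log (by norm_num) (by linarith : (2 : ℝ) ≤ n + 1)
  linarith

/-- With `x = log (n + 1) ≥ 1 / 2`, both parts of `4 + 12 x` are absorbed by `40 x ^ 2`, so the
bound covers `n = 1` too. -/
theorem unitCost_sq_le {n : ℕ} (hn : 1 ≤ n) :
    (unitCost ((n + 1) ^ 2) : ℝ) ≤ 40 * Real.log ((n : ℝ) + 1) ^ 2 := by
  have h1 := unitCost_le (M := (n + 1) ^ 2) (Nat.one_le_pow _ _ (by omega))
  have h2 := half_le_log_succ hn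
  push_cast at h1
  rw [Real.log_pow] at h1
  push_cast at h1
  nlinarith

theorem le_of_two_pow_le {n l : ℕ} (hn : 1 ≤ n) (hl : 2 ^ l ≤ 2 * n) :
    (l : ℝ) ≤ 1 + 2 * Real.log n := by
  have h3 : Real.log ((2 : ℝ) ^ l) ≤ Real.log (2 * n) :=
    Real.log_le_log (by positivity) (by exact_mod_cast hl)
  have hn' : (n : ℝ) ≠ 0 := by exact_mod_cast (by omega : n ≠ 0)
  rw [Real.log_pow, Real.log_mul (by norm_num) hn'] at h3
  have h4 := Real.log_two_gt_d9
  have h5 : 0 ≤ Real.log n := Real.log_natCast_nonneg n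
  nlinarith

/-- The constant factor in the bound of the numbers that occur in the initialization. -/
def initFactor (K c₀ D₀ : ℕ) : ℕ := 6 + 2 * c₀ + 3 * D₀ + c₀ * D₀ + K * c₀ * D₀ + 8 * K

theorem initMax_le (K c₀ D₀ : ℕ) {n a b : ℕ} (hn : 1 ≤ n) (hb : 1 ≤ b) :
    initMax K c₀ D₀ n a b ≤ initFactor K c₀ D₀ * (n + a + b) ^ (c₀ + 4) := by
  set N := n + a + b with hN
  have hpow : ∀ e, e ≤ c₀ + 4 → N ^ e ≤ N ^ (c₀ + 4) := fun e he =>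
    Nat.pow_le_pow_right (by omega) he
  have hnN : n ≤ N := by omega
  have hnc : n ^ c₀ ≤ N ^ c₀ := Nat.pow_le_pow_left hnN _
  have p0 := hpow 0 (by omega)
  have p1 := hpow 1 (by omega)
  rw [pow_zero] at p0
  rw [pow_one] at p1
  have q1 : n ^ c₀ * (n + 1) ≤ N ^ (c₀ + 4) := by
    calc n ^ c₀ * (n + 1) ≤ N ^ c₀ * N := Nat.mul_le_mul hnc (by omega)
      _ = N ^ (c₀ + 1) := (pow_succ _ _).symm
      _ ≤ _ := hpow _ (by omega)
  have q2 : n * n ≤ N ^ (c₀ + 4) := by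
    calc n * n ≤ N * N := Nat.mul_le_mul hnN hnN
      _ = N ^ 2 := (sq N).symm
      _ ≤ _ := hpow _ (by omega)
  have q3 : n * n * n ^ c₀ ≤ N ^ (c₀ + 4) := by
    calc n * n * n ^ c₀ ≤ N * N * N ^ c₀ := Nat.mul_le_mul (Nat.mul_le_mul hnN hnN) hnc
      _ = N ^ (c₀ + 2) := by ring
      _ ≤ _ := hpow _ (by omega)
  have q4 : n * n * n ^ c₀ * (b + 1) ≤ N ^ (c₀ + 4) := by
    calc n * n * n ^ c₀ * (b + 1) ≤ N * N * N ^ c₀ * N :=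
          Nat.mul_le_mul (Nat.mul_le_mul (Nat.mul_le_mul hnN hnN) hnc) (by omega)
      _ = N ^ (c₀ + 3) := by ring
      _ ≤ _ := hpow _ (by omega)
  have q5 : n ^ c₀ * a ≤ N ^ (c₀ + 4) := by
    calc n ^ c₀ * a ≤ N ^ c₀ * N := Nat.mul_le_mul hnc (by omega)
      _ = N ^ (c₀ + 1) := (pow_succ _ _).symm
      _ ≤ _ := hpow _ (by omega)
  have q6 : n * n * (b + 1) ≤ N ^ (c₀ + 4) := by
    calc n * n * (b + 1) ≤ N * N * N :=
          Nat.mul_le_mul (Nat.mul_le_mul hnN hnN) (by omega)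
      _ = N ^ 3 := by ring
      _ ≤ _ := hpow _ (by omega)
  have q7 : n * a ≤ N ^ (c₀ + 4) := by
    calc n * a ≤ N * N := Nat.mul_le_mul hnN (by omega)
      _ = N ^ 2 := (sq N).symm
      _ ≤ _ := hpow _ (by omega)
  generalize N ^ (c₀ + 4) = P at *
  have e : initMax K c₀ D₀ n a b = (2 * n + 1) + c₀ * 1 + D₀ * (n ^ c₀ * (n + 1)) + D₀ * 1 +
      c₀ * (n * n) + c₀ * D₀ * (n * n * n ^ c₀) + K * c₀ * D₀ * (n * n * n ^ c₀ * (b + 1)) +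
      D₀ * (n ^ c₀ * a) + 4 * K * (n * n * (b + 1)) + n * a + 4 * K * 1 + a + b := by
    unfold initMax
    ring
  have e' : initFactor K c₀ D₀ * P = 6 * P + c₀ * P + D₀ * P + D₀ * P + c₀ * P + c₀ * D₀ * P +
      K * c₀ * D₀ * P + D₀ * P + 4 * K * P + 4 * K * P := by
    unfold initFactor
    ring
  rw [e, e']
  have s1 := Nat.mul_le_mul_left c₀ p0
  have s2 := Nat.mul_le_mul_left D₀ q1
  have s3 := Nat.mul_le_mul_left D₀ p0
  have s4 := Nat.mul_le_mul_left c₀ q2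
  have s5 := Nat.mul_le_mul_left (c₀ * D₀) q3
  have s6 := Nat.mul_le_mul_left (K * c₀ * D₀) q4
  have s7 := Nat.mul_le_mul_left D₀ q5
  have s8 := Nat.mul_le_mul_left (4 * K) q6
  have s9 := Nat.mul_le_mul_left (4 * K) p0
  omega

/-- The constant factor of the time of the initialization. -/
noncomputable def initConst (K c₀ D₀ : ℕ) : ℝ :=
  (60 + 20 * c₀) * (4 + 6 * (Real.log (initFactor K c₀ D₀) + (c₀ + 4)))

theorem one_le_initFactor (K c₀ D₀ : ℕ) : 1 ≤ initFactor K c₀ D₀ := by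
  unfold initFactor
  omega

theorem initConst_nonneg (K c₀ D₀ : ℕ) : 0 ≤ initConst K c₀ D₀ := by
  have := Real.log_natCast_nonneg (initFactor K c₀ D₀)
  unfold initConst
  positivity

/-- One logarithm comes from the number of instructions, through `l`, and one from the size of the
numbers. As `n + a + b ≥ 3 > e`, the logarithm is at least one and absorbs the constants. -/
theorem initTime_le (K c₀ D₀ : ℕ) {n a b l : ℕ} (hn : 1 ≤ n) (ha : 1 ≤ a) (hb : 1 ≤ b)
    (hl : 2 ^ l ≤ 2 * n) :
    (((44 + 16 * n + 2 * c₀ + 6 * (l * c₀ * n)) * unitCost (initMax K c₀ D₀ n a b) : ℕ) : ℝ) ≤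
      initConst K c₀ D₀ * n * Real.log ((n : ℝ) + a + b) ^ 2 := by
  have hn' : (1 : ℝ) ≤ n := by exact_mod_cast hn
  have ha' : (1 : ℝ) ≤ a := by exact_mod_cast ha
  have hb' : (1 : ℝ) ≤ b := by exact_mod_cast hb
  have hF : (1 : ℝ) ≤ initFactor K c₀ D₀ := by exact_mod_cast one_le_initFactor K c₀ D₀
  set y := Real.log ((n : ℝ) + a + b) with hy
  have hy1 : 1 ≤ y := by
    rw [hy, Real.le_log_iff_exp_le (by linarith)]
    have := Real.exp_one_lt_d9
    linarith
  have hny : Real.log n ≤ y := Real.log_le_log (by linarith) (by linarith)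
  have hM1 : 1 ≤ initMax K c₀ D₀ n a b := by
    unfold initMax
    omega
  have hU := unitCost_le hM1
  have hlogM : Real.log (initMax K c₀ D₀ n a b) ≤
      (Real.log (initFactor K c₀ D₀) + (c₀ + 4)) * y := by
    have h1 : (initMax K c₀ D₀ n a b : ℝ) ≤ initFactor K c₀ D₀ * ((n : ℝ) + a + b) ^ (c₀ + 4) := by
      exact_mod_cast initMax_le K c₀ D₀ (a := a) hn hb
    have h2 := Real.log_le_log (by exact_mod_cast hM1) h1
    rw [Real.log_mul (by linarith) (by positivity), Real.log_pow] at h2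
    have h3 := Real.log_nonneg hF
    push_cast at h2
    nlinarith
  have hl1 := le_of_two_pow_le hn hl
  have hl3 : (l : ℝ) ≤ 3 * y := by linarith
  have hc0 : (0 : ℝ) ≤ c₀ := Nat.cast_nonneg _
  have hny0 : 1 ≤ n * y := by nlinarith
  have hny1 : (n : ℝ) ≤ n * y := by nlinarith
  have hsteps : (44 + 16 * (n : ℝ) + 2 * c₀ + 6 * (l * c₀ * n)) ≤ (60 + 20 * c₀) * (n * y) := by
    have h1 : l * (c₀ : ℝ) * n ≤ 3 * y * c₀ * n := by gcongr
    nlinarith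
  have hU' : (unitCost (initMax K c₀ D₀ n a b) : ℝ) ≤
      (4 + 6 * (Real.log (initFactor K c₀ D₀) + (c₀ + 4))) * y := by nlinarith
  push_cast
  calc (44 + 16 * (n : ℝ) + 2 * c₀ + 6 * (l * c₀ * n)) * unitCost (initMax K c₀ D₀ n a b)
      ≤ ((60 + 20 * c₀) * (n * y)) *
        ((4 + 6 * (Real.log (initFactor K c₀ D₀) + (c₀ + 4))) * y) := by
        gcongr
    _ = _ := by
        unfold initConst
        ring

end DynStar

/-! ### Assembling the bounds -/

theorem mainTheorem3 (K c : ℕ) (hK : 800 ≤ K) (hc : c + 2 ≤ K) :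
    ∃ (A : DynStar.Algorithm) (C : ℝ) (k : ℕ), ∀ (n : ℕ) (τ : ℚ), 1 ≤ n → 0 < τ →
      -- initialization time
      (∀ s ∈ (A.start n τ).support,
        (s.time : ℝ) ≤ C * n * Real.log ((n : ℝ) + τ.num + τ.den) ^ k) ∧
      ∀ σ : List (DynStar.Update n), DynStar.ValidFrom ⊥ σ →
        -- a possibly incomplete contraction is maintained
        (∀ s ∈ (A.law n τ σ).support,
          DynStar.IsPartialContraction (DynStar.graphAfter σ) (s.outMap n) (s.outWeight n)) ∧
        -- if `δ_G ≥ τ`, then with high probability it is complete and a `τ`-star contraction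
        (τ ≤ (DynStar.minDeg (DynStar.graphAfter σ) : ℚ) →
          ∀ S : Finset (Finset (Fin n) × (Fin n → Fin n)),
            (∑ o ∈ S, DynStar.starProb (DynStar.graphAfter σ) τ (DynStar.centerProb K n τ) o)
                - 1 / (n : ℝ) ^ c ≤
              DynStar.prob (A.law n τ σ) {s |
                DynStar.IsComplete (DynStar.graphAfter σ) (s.outMap n) ∧
                ∃ o ∈ S, DynStar.Realizes (s.outMap n) o}) ∧
        -- amortized update time (expected total time of all updates)
        (∑ i ∈ Finset.range σ.length,
            DynStar.expect (A.law n τ (σ.take (i + 1))) DynStar.State.time ≤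
          ENNReal.ofReal (C * σ.length * Real.log ((n : ℝ) + 1) ^ k)) ∧
        -- bounds for the last update
        (σ ≠ [] →
          (∀ s ∈ (A.law n τ σ).support, (s.time : ℝ) ≤ C * n * Real.log ((n : ℝ) + 1) ^ k) ∧
          DynStar.expect (A.law n τ σ) DynStar.State.writes ≤ ENNReal.ofReal C ∧
          (∀ s ∈ (A.law n τ σ).support,
            (s.writes : ℝ) ≤ C * (n / τ) * Real.log ((n : ℝ) + 1) ^ k)) := by
  open DynStar in
  set c₀ := precExp K c with hc₀
  set D₀ := precScale K c with hD₀
  have hI := initConst_nonneg K c₀ D₀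
  have hK0 : (0 : ℝ) ≤ K := Nat.cast_nonneg K
  -- Here `12960 = 324 * 40`, where `324 = 200 + 62 * 2` bounds the expected number of unit costs
  -- per update and `324 n` the worst-case one; `96 * K` is `12 * K * 8` from the cap on the
  -- centers. The expected recourse `1 + 2 * 2` is far below this constant.
  refine ⟨starAlgorithm K c₀ D₀, initConst K c₀ D₀ + 12960 + 96 * K, 2, fun n τ hn hτ => ?_⟩
  set C : ℝ := initConst K c₀ D₀ + 12960 + 96 * K with hC
  have ha : 1 ≤ τ.num.natAbs := Int.natAbs_pos.2 (Rat.num_pos.2 hτ).ne'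
  have hb : 1 ≤ τ.den := τ.pos
  have hnum : (τ.num : ℝ) = (τ.num.natAbs : ℝ) := by
    rw [← Int.cast_natCast, Int.natAbs_of_nonneg (Rat.num_pos.2 hτ).le]
  have hτr : (τ : ℝ) = (τ.num.natAbs : ℝ) / τ.den := by rw [← hnum, Rat.cast_def]
  have hn0 : (1 : ℝ) ≤ n := by exact_mod_cast hn
  have ha0 : (0 : ℝ) < τ.num.natAbs := by exact_mod_cast ha
  have hb0 : (0 : ℝ) < τ.den := by exact_mod_cast hb
  obtain ⟨l, hl1, hl2, hl3, htr, htime⟩ := start_spec K c₀ D₀ (τ := τ) hn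
  set q := centerLaw n (4 * K * n * l * τ.den) τ.num.natAbs
    (coinLaw (K * fixedLog (D₀ * n ^ c₀) n (l * c₀ * n) * τ.den)
      (D₀ * n ^ c₀ * τ.num.natAbs - 1)) with hq
  set x := Real.log ((n : ℝ) + 1) with hx
  have hx2 : 1 / 2 ≤ x := half_le_log_succ hn
  have hU : (unitCost ((n + 1) ^ 2) : ℝ) ≤ 40 * x ^ 2 := unitCost_sq_le hn
  have hlaw : ∀ σ : List (Update n), ValidFrom ⊥ σ →
      Tracks q (4 * K * n * l * τ.den) τ.num.natAbs (graphAfter σ)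
        ((starAlgorithm K c₀ D₀).law n τ σ) :=
    fun σ hσ => htr.foldl K c₀ D₀ hσ
  have hlast : ∀ σ : List (Update n), ValidFrom ⊥ σ → σ ≠ [] → ∃ (σ' : List (Update n))
      (e : Update n), e.Valid (graphAfter σ') ∧ ValidFrom ⊥ σ' ∧
      (starAlgorithm K c₀ D₀).law n τ σ =
        ((starAlgorithm K c₀ D₀).law n τ σ').bind ((starAlgorithm K c₀ D₀).step e) := by
    intro σ hσ hne
    obtain ⟨σ', e, rfl⟩ : ∃ σ' e, σ = σ' ++ [e] :=
      ⟨_, _, (List.dropLast_append_getLast hne).symm⟩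
    obtain ⟨h1, h2⟩ := validFrom_append.1 hσ
    refine ⟨σ', e, h2.1, h1, ?_⟩
    unfold Algorithm.law
    rw [List.foldl_append]
    rfl
  have hexp : ∀ σ : List (Update n), ValidFrom ⊥ σ → σ ≠ [] →
      expect ((starAlgorithm K c₀ D₀).law n τ σ) State.time ≤ ENNReal.ofReal (C * x ^ 2) := by
    intro σ hσ hne
    obtain ⟨σ', e, he, hσ', hl⟩ := hlast σ hσ hne
    rw [hl]
    refine ((hlaw σ' hσ').expect_step_le K c₀ D₀ he (centerLaw_card _ _ _) State.time
      (200 * unitCost ((n + 1) ^ 2)) (62 * unitCost ((n + 1) ^ 2))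
      fun t k h1 _ => h1.trans (le_of_eq (by ring))).trans ?_
    rw [← ENNReal.ofReal_natCast]
    refine ENNReal.ofReal_le_ofReal ?_
    push_cast
    have : 12960 * x ^ 2 ≤ C * x ^ 2 := by
      gcongr
      linarith
    linarith
  refine ⟨fun s hs => ?_, fun σ hσ => ⟨fun s hs => ((hlaw σ hσ).rep s hs).isPartialContraction,
    fun hdeg S => (hlaw σ hσ).star hK hc hn hl1.le hl3 hτ hdeg S, ?_, fun hne => ⟨?_, ?_, ?_⟩⟩⟩
  · have h1 : (s.time : ℝ) ≤ _ := Nat.cast_le.2 (htime s hs)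
    refine h1.trans ((initTime_le K c₀ D₀ hn ha hb hl2).trans ?_)
    rw [hnum]
    gcongr
    linarith
  -- Every single update already satisfies the expected bound, so the total is a sum over prefixes
  -- and no potential function is needed.
  · have hv : ∀ i ∈ Finset.range σ.length,
        expect ((starAlgorithm K c₀ D₀).law n τ (σ.take (i + 1))) State.time ≤
          ENNReal.ofReal (C * x ^ 2) := by
      intro i hi
      rw [Finset.mem_range] at hi
      refine hexp _ ?_ ?_
      · rw [← List.take_append_drop (i + 1) σ] at hσ
        exact (validFrom_append.1 hσ).1
      · intro h
        have := congrArg List.length h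
        rw [List.length_take, List.length_nil] at this
        omega
    refine (Finset.sum_le_sum hv).trans (le_of_eq ?_)
    rw [Finset.sum_const, Finset.card_range, nsmul_eq_mul, ← ENNReal.ofReal_natCast,
      ← ENNReal.ofReal_mul (Nat.cast_nonneg _)]
    congr 1
    ring
  · intro s hs
    obtain ⟨σ', e, he, hσ', hl⟩ := hlast σ hσ hne
    rw [hl] at hs
    have h1 := ((hlaw σ' hσ').step_le K c₀ D₀ he hs).1
    have h2 : (s.time : ℝ) ≤ (200 + 124 * n) * unitCost ((n + 1) ^ 2) := by exact_mod_cast h1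
    calc (s.time : ℝ) ≤ (200 + 124 * n) * unitCost ((n + 1) ^ 2) := h2
      _ ≤ (324 * n) * (40 * x ^ 2) := by
          gcongr
          linarith
      _ = 12960 * n * x ^ 2 := by ring
      _ ≤ C * n * x ^ 2 := by
          gcongr
          linarith
  · obtain ⟨σ', e, he, hσ', hl⟩ := hlast σ hσ hne
    rw [hl]
    refine ((hlaw σ' hσ').expect_step_le K c₀ D₀ he (centerLaw_card _ _ _) State.writes 1 2
      fun t k _ h2 => h2).trans ?_
    rw [← ENNReal.ofReal_natCast]
    refine ENNReal.ofReal_le_ofReal ?_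
    push_cast
    linarith
  · intro s hs
    obtain ⟨σ', e, he, hσ', hl⟩ := hlast σ hσ hne
    rw [hl] at hs
    have h1 := ((hlaw σ' hσ').step_le K c₀ D₀ he hs).2
    have h2 : (s.writes : ℝ) * τ.num.natAbs ≤ 3 * (4 * K * n * l * τ.den) := by exact_mod_cast h1
    have hnx : Real.log n ≤ x := Real.log_le_log (by linarith) (by linarith)
    -- From `l ≤ 1 + 2 x` and `x ≥ 1 / 2`, with `1 ≤ 4 x ^ 2` and `2 x ≤ 4 x ^ 2`.
    have h3 : (l : ℝ) ≤ 8 * x ^ 2 := by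
      have := le_of_two_pow_le hn hl2
      nlinarith
    have e1 : (n : ℝ) / τ = n * τ.den / τ.num.natAbs := by
      rw [hτr]
      field_simp
    calc (s.writes : ℝ) ≤ 3 * (4 * K * n * l * τ.den) / τ.num.natAbs := by
          rwa [le_div_iff₀ ha0]
      _ = 12 * K * l * (n / τ) := by rw [e1]; ring
      _ ≤ 12 * K * (8 * x ^ 2) * (n / τ) := by
          have : (0 : ℝ) < τ := by exact_mod_cast hτ
          gcongr
      _ = 96 * K * (n / τ) * x ^ 2 := by ring
      _ ≤ C * (n / τ) * x ^ 2 := by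
          have : (0 : ℝ) < τ := by exact_mod_cast hτ
          gcongr
          linarith
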